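/- Let $\delta>0$ be a constant. For a multigraph $G$ with $n\ge 2$ vertices, $m$ edges and minimum cut value $c$, let $\mathrm{FAIL}(p)$ be the probability that $G$ becomes disconnected when each edge fails independently with probability $p\in[0,1]$. Then there are a deterministic algorithm (one program, for a unit-cost random access machine that adds, subtracts and compares natural numbers, uses them as addresses, and computes exactly with real numbers by field operations and comparisons, without rounding) and a constant $A$, both depending only on $\delta$, such that the following holds. Given any such $G$ (as a list of edges), any $p\in[0,1]$ with $p^c<n^{-(2+\delta)}$ (in particular, any $p$ with $\mathrm{FAIL}(p)<n^{-(2+\delta)}$) and any $\varepsilon\in(0,1)$, the algorithm outputs a number $P$ with $$|P-\mathrm{FAIL}(p)|\le\varepsilon\,\mathrm{FAIL}(p)$$ after at most $$m\cdot\left(\frac n\varepsilon\right)^{\exp\left(A\,(1-\log_n\varepsilon)\right)}$$ steps. In particular, for graphs with $m\le n^{2}$ (such as simple graphs) the running time is $(n/\varepsilon)^{\exp(O(1-\log_n\varepsilon))}$, which is polynomial in $n$ for each fixed $\varepsilon$. -/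

import Mathlib

/-! Networks, their failure probability, and a random access machine with exact real arithmetic. -/

/-- A multigraph with vertices `0, …, n - 1` and `m` listed edges (parallel edges are allowed). -/
structure Network (n m : ℕ) where
  ends : Fin m → Fin n × Fin n

namespace Network

variable {n m : ℕ}

/-- What is left of the network when the edges in `F` have failed. -/
def surviving (G : Network n m) (F : Finset (Fin m)) : SimpleGraph (Fin n) :=
  SimpleGraph.fromRel fun u v => ∃ e, e ∉ F ∧ G.ends e = (u, v)

open Classical in
/-- `FAIL(p)`: the probability that the surviving network is disconnected when each edge fails
independently with probability `p`. The sum is over the possible sets `F` of failed edges. -/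
noncomputable def fail (G : Network n m) (p : ℝ) : ℝ :=
  ∑ F : Finset (Fin m),
    if (G.surviving F).Connected then 0 else p ^ F.card * (1 - p) ^ Fᶜ.card

/-- The number of edges with exactly one end in `A`. -/
def cutValue (G : Network n m) (A : Finset (Fin n)) : ℕ :=
  (Finset.univ.filter fun e => ¬ ((G.ends e).1 ∈ A ↔ (G.ends e).2 ∈ A)).card

/-- The least value of a cut, a cut being a partition of the vertices into two nonempty parts. -/
noncomputable def minCut (G : Network n m) : ℕ :=
  sInf {k | ∃ A : Finset (Fin n), A.Nonempty ∧ A ≠ Finset.univ ∧ G.cutValue A = k}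

end Network

/-! A program has finitely many registers for natural numbers and for real numbers at its disposal,
and one unbounded memory of each kind, addressed by natural numbers. -/

namespace RealRAM

structure State where
  nreg : ℕ → ℕ
  nmem : ℕ → ℕ
  rreg : ℕ → ℝ
  rmem : ℕ → ℝ

/-- The elementary operations. The first argument is the register written to, except for the two
store operations. Natural numbers can be added, subtracted (with cut-off at `0`) and used as
addresses, but not multiplied; a natural number can be copied into a real register, but there is no
rounding from real to natural numbers. -/
inductive Op where
  | const (i k : ℕ)
  | add (i j k : ℕ)
  | sub (i j k : ℕ)
  | load (i a : ℕ)
  | store (a i : ℕ)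
  | rcast (i j : ℕ)
  | radd (i j k : ℕ)
  | rsub (i j k : ℕ)
  | rmul (i j k : ℕ)
  | rdiv (i j k : ℕ)
  | rload (i a : ℕ)
  | rstore (a i : ℕ)

open Function in
noncomputable def Op.apply : Op → State → State
  | const i k, s => { s with nreg := update s.nreg i k }
  | add i j k, s => { s with nreg := update s.nreg i (s.nreg j + s.nreg k) }
  | sub i j k, s => { s with nreg := update s.nreg i (s.nreg j - s.nreg k) }
  | load i a, s => { s with nreg := update s.nreg i (s.nmem (s.nreg a)) }
  | store a i, s => { s with nmem := update s.nmem (s.nreg a) (s.nreg i) }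
  | rcast i j, s => { s with rreg := update s.rreg i (s.nreg j : ℝ) }
  | radd i j k, s => { s with rreg := update s.rreg i (s.rreg j + s.rreg k) }
  | rsub i j k, s => { s with rreg := update s.rreg i (s.rreg j - s.rreg k) }
  | rmul i j k, s => { s with rreg := update s.rreg i (s.rreg j * s.rreg k) }
  | rdiv i j k, s => { s with rreg := update s.rreg i (s.rreg j / s.rreg k) }
  | rload i a, s => { s with rreg := update s.rreg i (s.rmem (s.nreg a)) }
  | rstore a i, s => { s with rmem := update s.rmem (s.nreg a) (s.rreg i) }

inductive Test where
  | lt (i j : ℕ)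
  | eq (i j : ℕ)
  | rlt (i j : ℕ)
  | req (i j : ℕ)

def Test.Holds : Test → State → Prop
  | lt i j, s => s.nreg i < s.nreg j
  | eq i j, s => s.nreg i = s.nreg j
  | rlt i j, s => s.rreg i < s.rreg j
  | req i j, s => s.rreg i = s.rreg j

inductive Program where
  | skip
  | op (o : Op)
  | seq (P Q : Program)
  | ite (b : Test) (P Q : Program)
  | loop (b : Test) (P : Program)

/-- `Exec P s t s'`: the program `P`, started in the state `s`, halts after exactly `t` steps in the
state `s'`. Every elementary operation and every evaluation of a test is one step. -/
inductive Exec : Program → State → ℕ → State → Prop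
  | skip (s : State) : Exec .skip s 1 s
  | op (o : Op) (s : State) : Exec (.op o) s 1 (o.apply s)
  | seq {P Q : Program} {s s' s'' : State} {t u : ℕ} :
      Exec P s t s' → Exec Q s' u s'' → Exec (.seq P Q) s (t + u) s''
  | iteTrue {b : Test} {P Q : Program} {s s' : State} {t : ℕ} :
      b.Holds s → Exec P s t s' → Exec (.ite b P Q) s (t + 1) s'
  | iteFalse {b : Test} {P Q : Program} {s s' : State} {t : ℕ} :
      ¬ b.Holds s → Exec Q s t s' → Exec (.ite b P Q) s (t + 1) s'
  | loopStop {b : Test} {P : Program} {s : State} :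
      ¬ b.Holds s → Exec (.loop b P) s 1 s
  | loopStep {b : Test} {P : Program} {s s' s'' : State} {t u : ℕ} :
      b.Holds s → Exec P s t s' → Exec (.loop b P) s' u s'' → Exec (.loop b P) s (t + u + 1) s''

/-- The machine is deterministic: a program has at most one halting run from a given state. -/
theorem Exec.unique {P : Program} {s s₁ s₂ : State} {t₁ t₂ : ℕ}
    (h₁ : Exec P s t₁ s₁) (h₂ : Exec P s t₂ s₂) : t₁ = t₂ ∧ s₁ = s₂ := by
  induction h₁ generalizing t₂ s₂ with
  | skip s => cases h₂; exact ⟨rfl, rfl⟩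
  | op o s => cases h₂; exact ⟨rfl, rfl⟩
  | seq _ _ ih₁ ih₂ =>
    cases h₂ with
    | seq a b =>
      obtain ⟨rfl, rfl⟩ := ih₁ a
      obtain ⟨rfl, rfl⟩ := ih₂ b
      exact ⟨rfl, rfl⟩
  | iteTrue hb _ ih =>
    cases h₂ with
    | iteTrue _ a => obtain ⟨rfl, rfl⟩ := ih a; exact ⟨rfl, rfl⟩
    | iteFalse hb' _ => exact absurd hb hb'
  | iteFalse hb _ ih =>
    cases h₂ with
    | iteTrue hb' _ => exact absurd hb' hb
    | iteFalse _ a => obtain ⟨rfl, rfl⟩ := ih a; exact ⟨rfl, rfl⟩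
  | loopStop hb =>
    cases h₂ with
    | loopStop _ => exact ⟨rfl, rfl⟩
    | loopStep hb' _ _ => exact absurd hb' hb
  | loopStep hb _ _ ih₁ ih₂ =>
    cases h₂ with
    | loopStop hb' => exact absurd hb hb'
    | loopStep _ a b =>
      obtain ⟨rfl, rfl⟩ := ih₁ a
      obtain ⟨rfl, rfl⟩ := ih₂ b
      exact ⟨rfl, rfl⟩

/-- The initial state on the input `G, p, ε`: the registers hold `n, m` and `p, ε`, the memory cells
`2 * e` and `2 * e + 1` hold the ends of the edge `e`, and everything else is `0`. -/
noncomputable def input {n m : ℕ} (G : Network n m) (p ε : ℝ) : State where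
  nreg i := if i = 0 then n else if i = 1 then m else 0
  nmem a :=
    if h : a / 2 < m then
      if a % 2 = 0 then (G.ends ⟨a / 2, h⟩).1 else (G.ends ⟨a / 2, h⟩).2
    else 0
  rreg i := if i = 0 then p else if i = 1 then ε else 0
  rmem _ := 0

/-- The output is the final content of the real register `0`. -/
def State.output (s : State) : ℝ := s.rreg 0

end RealRAM

/-! Let K be the number of components left after the failures, c the minimum cut and x = p^(c/2).
Since x² = p^c ≤ FAIL(p) (`pow_minCut_le_fail`), an absolute error of εx² is good enough.

Extrapolation. FAIL is 1 - P(K = 1). Finite differences give coefficients a_j with Σ_{1≤j≤r} a_j j^k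
= [k = 1] for 1 ≤ k ≤ r (`sum_extrapolationCoeff`), so Σ a_j E[j^K] differs from P(K = 1) only
through the event K > r. The expectation E[j^K] is the sum of p^(number of cut edges) over all
labelings of the vertices with j labels (`sum_pow_card_cutEdges`, the Fortuin-Kasteleyn identity for
the Potts model), which makes the approximation a weighted sum over labelings with r labels.

Error of the truncation. In a network with K ≥ 2 components, at least cK/2 failed edges join
different components. Together with Russo's formula this is a differential inequality in p, and
integrating it up to p = 1 gives E[binom(K, k)] ≤ binom(n, k) x^k for k ≥ 2
(`mean_choose_components_le`). As the hypothesis gives nx < n^(-δ/2), it suffices to take r of the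
order 1 - log_n ε, with a factor that depends on δ.

Large cuts. For q with q^c = n^(-2) the same estimate bounds the sum over all labelings by 3^r.
Passing from q to p gains (nx)^(2α) on labelings with at least αc cut edges, so these are negligible
for α of the order r (`sum_large_cuts_le`). Any set of labelings that contains those with at most αc
cut edges will therefore do (`abs_estimate_sub_fail_le`).

Finding the small cuts. Spanning trees are packed by multiplicative weights: each round takes a
shortest tree for the lengths Y / cap and multiplies Y on its edges by 1 + 1/cap. The total length
grows at most by the factor 1 + 2/c per round, while each crossing of a tree with a labeling adds at
least 2 log 2 to a potential of that labeling. Hence a labeling with at most αc cut edges crosses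
some tree fewer than 4α times (`lt_sum_cap_of_potential`). It is then determined by the labels of
the root and of the later ends of the crossed tree edges, so trying (n + r)^(8α) digit sequences for
each of the O(m) trees reaches it.

Implementation. The algorithm is written in a small structured language. A compiler to the machine
is proved correct with a bound on the number of steps (`Cmd.runs`), and the program is verified by
loop invariants (`run_loop`). As r and α are O(L + 1) with L ≤ 1 - log_n ε, the number of steps is m
n^O((L+1)²). -/

open Finset

/-! ### Means over random subsets and their growth in p -/

section RandomSubset

variable {E : Type*} [Fintype E] [DecidableEq E]

/-- The expectation of `φ F` for a random set `F` that contains each element with probability `p`,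
independently. -/
noncomputable def subsetMean (p : ℝ) (φ : Finset E → ℝ) : ℝ :=
  ∑ F : Finset E, p ^ #F * (1 - p) ^ #Fᶜ * φ F

/-- Pairs (F, e) with e ∉ F correspond to pairs with e ∈ F by inserting e. -/
theorem sum_compl_eq_sum_erase (g : Finset E → E → ℝ) :
    ∑ F : Finset E, ∑ e ∈ Fᶜ, g F e = ∑ F : Finset E, ∑ e ∈ F, g (F.erase e) e := by
  rw [Finset.sum_sigma', Finset.sum_sigma']
  refine Finset.sum_nbij' (fun x => ⟨insert x.2 x.1, x.2⟩) (fun x => ⟨x.1.erase x.2, x.2⟩)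
    ?_ ?_ ?_ ?_ ?_
  · rintro ⟨F, e⟩ h; simp
  · rintro ⟨F, e⟩ h; simp
  · rintro ⟨F, e⟩ h
    simp at h
    simp [erase_insert h]
  · rintro ⟨F, e⟩ h
    simp at h
    simp [insert_erase h]
  · rintro ⟨F, e⟩ h
    simp at h
    simp [erase_insert h]

/-- Russo's formula. The terms from differentiating 1 - p belong to pairs with e ∉ F; moved to F ∪
{e}, they become the subtracted values at `F.erase e`. -/
theorem hasDerivAt_subsetMean (φ : Finset E → ℝ) (p : ℝ) :
    HasDerivAt (fun p => subsetMean p φ)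
      (∑ F : Finset E, ∑ e ∈ F, p ^ (#F - 1) * (1 - p) ^ #Fᶜ * (φ F - φ (F.erase e))) p := by
  have h1 : ∀ F ∈ (univ : Finset (Finset E)),
      HasDerivAt (fun p : ℝ => p ^ #F * (1 - p) ^ #Fᶜ * φ F)
        ((#F * p ^ (#F - 1) * (1 - p) ^ #Fᶜ
          + p ^ #F * (#Fᶜ * (1 - p) ^ (#Fᶜ - 1) * (-1))) * φ F) p := by
    intro F _
    have a := hasDerivAt_pow (#F) p
    have b := ((hasDerivAt_id p).const_sub 1).pow (#Fᶜ)
    exact (a.mul b).mul_const (φ F)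
  have h2 := HasDerivAt.fun_sum h1
  refine HasDerivAt.congr_deriv h2 (Eq.symm ?_)
  have h3 := sum_compl_eq_sum_erase (fun F (_ : E) => p ^ #F * (1 - p) ^ (#Fᶜ - 1) * φ F)
  have h4 : ∀ F : Finset E, ∑ e ∈ F, p ^ (#F - 1) * (1 - p) ^ #Fᶜ * φ (F.erase e)
      = ∑ e ∈ F, p ^ #(F.erase e) * (1 - p) ^ (#(F.erase e)ᶜ - 1) * φ (F.erase e) := by
    intro F
    refine Finset.sum_congr rfl fun e he => ?_
    have hc : #(F.erase e)ᶜ = #Fᶜ + 1 := by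
      rw [compl_erase, card_insert_of_notMem (by simpa using he)]
    rw [card_erase_of_mem he, hc, Nat.add_sub_cancel]
  simp only [mul_sub, Finset.sum_sub_distrib, h4]
  rw [← h3, ← Finset.sum_sub_distrib]
  refine Finset.sum_congr rfl fun F _ => ?_
  simp only [sum_const, nsmul_eq_mul]
  ring

/-- With M for the mean, `hφ` and Russo's formula give kM ≤ 2pM'. So M² / p^k is nondecreasing, and
at p = 1 it equals φ(univ)². Squaring avoids the exponent k/2. -/
theorem subsetMean_sq_le (φ : Finset E → ℝ) (k : ℕ) (hk : 0 < k) (h0 : ∀ F, 0 ≤ φ F)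
    (hφ : ∀ F, k * φ F ≤ 2 * ∑ e ∈ F, (φ F - φ (F.erase e))) (p : ℝ) (hp0 : 0 ≤ p) (hp1 : p ≤ 1) :
    subsetMean p φ ^ 2 ≤ p ^ k * φ univ ^ 2 := by
  have hnn : ∀ q, 0 ≤ q → q ≤ 1 → 0 ≤ subsetMean q φ := fun q h h' =>
    Finset.sum_nonneg fun F _ => by
      have := h0 F
      have : 0 ≤ 1 - q := by linarith
      positivity
  have hone : subsetMean 1 φ = φ univ := by
    unfold subsetMean
    rw [Finset.sum_eq_single univ]
    · simp
    · intro F _ hF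
      have : #Fᶜ ≠ 0 := by simpa using hF
      simp [this]
    · simp
  -- The quotient by p^k is useless at p = 0. There the mean is φ ∅, which `hφ` forces to be 0
  -- because k > 0.
  rcases hp0.eq_or_lt with rfl | hp
  · have : subsetMean 0 φ = φ ∅ := by
      unfold subsetMean
      rw [Finset.sum_eq_single ∅]
      · simp
      · intro F _ hF
        have : #F ≠ 0 := by simpa using hF
        simp [this]
      · simp
    have h := hφ ∅
    have hk' : (0 : ℝ) < k := by exact_mod_cast hk
    have h' : φ ∅ = 0 := by
      have := h0 ∅
      simp at h
      nlinarith
    rw [this, h']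
    simp [hk.ne']
  set D : ℝ → ℝ := fun q => ∑ F : Finset E, ∑ e ∈ F,
    q ^ (#F - 1) * (1 - q) ^ #Fᶜ * (φ F - φ (F.erase e)) with hD
  have hDq : ∀ q, 0 ≤ q → q ≤ 1 → k * subsetMean q φ ≤ 2 * (q * D q) := by
    intro q h h'
    simp only [hD, subsetMean, Finset.mul_sum]
    refine Finset.sum_le_sum fun F _ => ?_
    have hw : 0 ≤ q ^ #F * (1 - q) ^ #Fᶜ := by
      have : 0 ≤ 1 - q := by linarith
      positivity
    have := mul_le_mul_of_nonneg_left (hφ F) hw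
    calc _ = q ^ #F * (1 - q) ^ #Fᶜ * (k * φ F) := by ring
      _ ≤ _ := this
      _ = _ := by
        rw [Finset.mul_sum, Finset.mul_sum]
        refine Finset.sum_congr rfl fun e he => ?_
        have : q ^ #F = q * q ^ (#F - 1) := by
          rw [← pow_succ', Nat.sub_add_cancel (card_pos.2 ⟨e, he⟩)]
        rw [this]; ring
  have hder : ∀ q, 0 < q → HasDerivAt (fun q => subsetMean q φ ^ 2 / q ^ k)
      ((2 * subsetMean q φ * D q * q ^ k - subsetMean q φ ^ 2 * (k * q ^ (k - 1))) / (q ^ k) ^ 2)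
      q := by
    intro q hq
    have a := (hasDerivAt_subsetMean φ q).pow 2
    have b := hasDerivAt_pow k q
    refine (a.div b (by positivity)).congr_deriv ?_
    simp [hD]
  have hmono : MonotoneOn (fun q => subsetMean q φ ^ 2 / q ^ k) (Set.Icc p 1) := by
    refine monotoneOn_of_deriv_nonneg (convex_Icc p 1) ?_ ?_ ?_
    · intro q hq
      exact (hder q (hp.trans_le hq.1)).continuousAt.continuousWithinAt
    · intro q hq
      rw [interior_Icc] at hq
      exact (hder q (hp.trans hq.1)).differentiableAt.differentiableWithinAt
    · intro q hq
      rw [interior_Icc] at hq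
      have hq0 : 0 < q := hp.trans hq.1
      rw [(hder q hq0).deriv]
      refine div_nonneg ?_ (by positivity)
      have h1 := hDq q hq0.le hq.2.le
      have h2 := hnn q hq0.le hq.2.le
      have h3 : q ^ k = q * q ^ (k - 1) := by rw [← pow_succ', Nat.sub_add_cancel hk]
      have h4 : 0 ≤ q ^ (k - 1) := by positivity
      rw [h3]
      have h5 := mul_nonneg (mul_nonneg h2 h4) (sub_nonneg.2 h1)
      nlinarith [h5]
  have := hmono ⟨le_rfl, hp1⟩ ⟨hp1, le_rfl⟩ hp1
  simp only [one_pow, div_one, hone] at this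
  rw [div_le_iff₀ (by positivity)] at this
  linarith

/-- Expand the product of the sums p + (1 - p)[e ∉ C] over all e; each factor equals p or 1. -/
theorem subsetMean_superset (p : ℝ) (C : Finset E) :
    subsetMean p (fun F => if C ⊆ F then 1 else 0) = p ^ #C := by
  have h : ∀ F : Finset E, p ^ #F * (1 - p) ^ #Fᶜ * (if C ⊆ F then (1 : ℝ) else 0)
      = (∏ e ∈ F, p) * ∏ e ∈ univ \ F, (if e ∈ C then 0 else 1 - p) := by
    intro F
    rw [prod_const]
    split_ifs with hC
    · have : ∏ e ∈ univ \ F, (if e ∈ C then 0 else 1 - p) = ∏ e ∈ univ \ F, (1 - p) := by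
        refine prod_congr rfl fun e he => ?_
        simp at he
        rw [if_neg fun h => he (hC h)]
      rw [this, prod_const, mul_one, ← compl_eq_univ_sdiff]
    · obtain ⟨e, heC, heF⟩ := not_subset.1 hC
      rw [Finset.prod_eq_zero (i := e) (by simpa using heF) (by simp [heC])]
      simp
  unfold subsetMean
  simp only [h]
  have := Finset.prod_add (fun _ => p) (fun e => if e ∈ C then 0 else 1 - p) (univ : Finset E)
  rw [powerset_univ] at this
  rw [← this]
  have h2 : ∀ e : E, p + (if e ∈ C then 0 else 1 - p) = if e ∈ C then p else 1 := by
    intro e; split_ifs <;> ring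
  simp only [h2]
  rw [Finset.prod_ite]
  simp

theorem subsetMean_one (p : ℝ) : subsetMean p (fun _ : Finset E => 1) = 1 := by
  simpa using subsetMean_superset p (∅ : Finset E)

theorem subsetMean_mono {p : ℝ} (hp0 : 0 ≤ p) (hp1 : p ≤ 1) {φ ψ : Finset E → ℝ}
    (h : ∀ F, φ F ≤ ψ F) : subsetMean p φ ≤ subsetMean p ψ := by
  refine sum_le_sum fun F _ => mul_le_mul_of_nonneg_left (h F) ?_
  have : 0 ≤ 1 - p := by linarith
  positivity

theorem subsetMean_sum {ι : Type*} (p : ℝ) (s : Finset ι) (a : ι → ℝ) (φ : ι → Finset E → ℝ) :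
    subsetMean p (fun F => ∑ i ∈ s, a i * φ i F) = ∑ i ∈ s, a i * subsetMean p (φ i) := by
  unfold subsetMean
  simp only [mul_sum]
  rw [sum_comm]
  refine sum_congr rfl fun i _ => sum_congr rfl fun F _ => by ring

end RandomSubset

/-! ### Components of the surviving network -/

namespace Network

variable {n m : ℕ}

open Classical in
/-- The number of connected components that are left when the edges in `F` have failed. -/
noncomputable def components (G : Network n m) (F : Finset (Fin m)) : ℕ :=
  Fintype.card (G.surviving F).ConnectedComponent

theorem surviving_adj {G : Network n m} {F : Finset (Fin m)} {u v : Fin n} :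
    (G.surviving F).Adj u v ↔
      u ≠ v ∧ ((∃ e, e ∉ F ∧ G.ends e = (u, v)) ∨ ∃ e, e ∉ F ∧ G.ends e = (v, u)) := by
  simp [surviving, SimpleGraph.fromRel_adj]

theorem surviving_anti (G : Network n m) {F F' : Finset (Fin m)} (h : F ⊆ F') :
    G.surviving F' ≤ G.surviving F := by
  intro u v
  simp only [surviving_adj]
  rintro ⟨h0, ⟨e, he, h1⟩ | ⟨e, he, h1⟩⟩
  · exact ⟨h0, Or.inl ⟨e, fun h' => he (h h'), h1⟩⟩
  · exact ⟨h0, Or.inr ⟨e, fun h' => he (h h'), h1⟩⟩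

theorem map_surjective (G : Network n m) {F F' : Finset (Fin m)} (h : F ⊆ F') :
    Function.Surjective (SimpleGraph.ConnectedComponent.map
      (SimpleGraph.Hom.ofLE (G.surviving_anti h))) := by
  intro C
  induction C using SimpleGraph.ConnectedComponent.ind with
  | _ v => exact ⟨(G.surviving F').connectedComponentMk v, rfl⟩

theorem components_mono (G : Network n m) {F F' : Finset (Fin m)} (h : F ⊆ F') :
    G.components F ≤ G.components F' := by
  classical
  exact Fintype.card_le_of_surjective _ (G.map_surjective h)

theorem components_le (G : Network n m) (F : Finset (Fin m)) : G.components F ≤ n := by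
  classical
  have h : Function.Surjective (G.surviving F).connectedComponentMk := by
    intro C
    induction C using SimpleGraph.ConnectedComponent.ind with
    | _ v => exact ⟨v, rfl⟩
  have h' := Fintype.card_le_of_surjective _ h
  rw [Fintype.card_fin] at h'
  exact h'

/-- The edge `e` joins two different components of the surviving network. -/
def Crosses (G : Network n m) (F : Finset (Fin m)) (e : Fin m) : Prop :=
  (G.surviving F).connectedComponentMk (G.ends e).1 ≠
    (G.surviving F).connectedComponentMk (G.ends e).2

theorem Crosses.mem {G : Network n m} {F : Finset (Fin m)} {e : Fin m} (h : G.Crosses F e) :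
    e ∈ F := by
  by_contra he
  apply h
  by_cases h' : (G.ends e).1 = (G.ends e).2
  · rw [h']
  · exact SimpleGraph.ConnectedComponent.sound
      (SimpleGraph.Adj.reachable (surviving_adj.2 ⟨h', Or.inl ⟨e, he, rfl⟩⟩))

/-- Restoring e identifies two components, so the canonical surjection between the sets of
components is not injective. -/
theorem Crosses.components_lt {G : Network n m} {F : Finset (Fin m)} {e : Fin m}
    (h : G.Crosses F e) : G.components (F.erase e) < G.components F := by
  classical
  refine Fintype.card_lt_of_surjective_not_injective _ (G.map_surjective (erase_subset e F)) ?_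
  intro hinj
  apply h
  apply hinj
  simp only [SimpleGraph.ConnectedComponent.map_mk]
  apply SimpleGraph.ConnectedComponent.sound
  by_cases h' : (G.ends e).1 = (G.ends e).2
  · simp [h']
  · exact SimpleGraph.Adj.reachable (surviving_adj.2 ⟨h', Or.inl ⟨e, by simp, rfl⟩⟩)

theorem minCut_le (G : Network n m) {A : Finset (Fin n)} (h : A.Nonempty) (h' : A ≠ univ) :
    G.minCut ≤ G.cutValue A :=
  Nat.sInf_le ⟨A, h, h', rfl⟩

open Classical in
-- If there are at least two components, each of them is a side of a cut and so has at least c edges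
-- leaving it. These edges cross, and each crossing edge leaves exactly two components.
theorem minCut_mul_components_le (G : Network n m) (F : Finset (Fin m))
    (h2 : 2 ≤ G.components F) :
    G.minCut * G.components F ≤ 2 * #{e | G.Crosses F e} := by
  set H := G.surviving F with hH
  have hcomp : ∀ C : H.ConnectedComponent, G.minCut ≤
      #{e : Fin m | ¬ (H.connectedComponentMk (G.ends e).1 = C ↔
        H.connectedComponentMk (G.ends e).2 = C)} := by
    intro C
    have := G.minCut_le (A := {v | H.connectedComponentMk v = C}) ?_ ?_
    · refine this.trans_eq ?_
      simp [cutValue]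
    · induction C using SimpleGraph.ConnectedComponent.ind with
      | _ v => exact ⟨v, by simp⟩
    · intro hu
      have : 1 < Fintype.card H.ConnectedComponent := h2
      obtain ⟨C', hC'⟩ := Fintype.exists_ne_of_one_lt_card this C
      induction C' using SimpleGraph.ConnectedComponent.ind with
      | _ v =>
        have : v ∈ ({v | H.connectedComponentMk v = C} : Finset (Fin n)) := by
          rw [hu]; exact mem_univ v
        simp at this
        exact hC' this
  calc G.minCut * G.components F
      = ∑ C : H.ConnectedComponent, G.minCut := by
        simp only [sum_const, smul_eq_mul, components, card_univ]
        rw [mul_comm]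
    _ ≤ ∑ C : H.ConnectedComponent, #{e : Fin m | ¬ (H.connectedComponentMk (G.ends e).1 = C ↔
        H.connectedComponentMk (G.ends e).2 = C)} := sum_le_sum fun C _ => hcomp C
    _ = ∑ e : Fin m, #{C : H.ConnectedComponent | ¬ (H.connectedComponentMk (G.ends e).1 = C ↔
        H.connectedComponentMk (G.ends e).2 = C)} := by
        simp only [card_eq_sum_ones, sum_filter]
        exact sum_comm
    _ ≤ ∑ e : Fin m, if G.Crosses F e then 2 else 0 := by
        refine sum_le_sum fun e _ => ?_
        split_ifs with he
        · refine (card_le_card (t := {H.connectedComponentMk (G.ends e).1,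
            H.connectedComponentMk (G.ends e).2}) ?_).trans card_le_two
          intro C hC
          simp only [mem_filter, mem_univ, true_and, mem_insert, mem_singleton] at hC ⊢
          tauto
        · simp only [Crosses, ne_eq, not_not] at he
          rw [← hH] at he
          simp [he]
    _ = 2 * #{e | G.Crosses F e} := by
        rw [← sum_filter, sum_const, smul_eq_mul, mul_comm]

/-- With K components, restoring a crossing edge lowers binom(K, k) by at least binom(K-1, k-1), by
Pascal's rule. There are at least cK/2 such edges, and K binom(K-1, k-1) = k binom(K, k). This is
the hypothesis of `subsetMean_sq_le` with exponent ck. -/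
theorem choose_components_growth (G : Network n m) (k : ℕ) (hk : 2 ≤ k) (F : Finset (Fin m)) :
    ((G.minCut * k : ℕ) : ℝ) * ((G.components F).choose k : ℝ) ≤
      2 * ∑ e ∈ F, (((G.components F).choose k : ℝ) - ((G.components (F.erase e)).choose k : ℝ)) := by
  classical
  have hnn : ∀ e, (0 : ℝ) ≤
      ((G.components F).choose k : ℝ) - ((G.components (F.erase e)).choose k : ℝ) := fun e => by
    rw [sub_nonneg]
    exact_mod_cast Nat.choose_le_choose k (G.components_mono (erase_subset e F))
  by_cases h2 : 2 ≤ G.components F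
  · obtain ⟨a, ha⟩ : ∃ a, G.components F = a + 1 := ⟨G.components F - 1, by omega⟩
    obtain ⟨b, rfl⟩ : ∃ b, k = b + 1 := ⟨k - 1, by omega⟩
    have h1 := G.minCut_mul_components_le F h2
    have hcr : ∀ e, G.Crosses F e → ((a.choose b : ℕ) : ℝ) ≤
        ((G.components F).choose (b + 1) : ℝ) - ((G.components (F.erase e)).choose (b + 1) : ℝ) := by
      intro e he
      have h3 : G.components (F.erase e) ≤ a := by
        have := he.components_lt
        omega
      have h4 := Nat.choose_le_choose (b + 1) h3
      rw [ha, Nat.choose_succ_succ]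
      push_cast
      have : (((G.components (F.erase e)).choose (b + 1) : ℕ) : ℝ) ≤ (a.choose (b + 1) : ℕ) := by
        exact_mod_cast h4
      linarith
    have h5 : (#{e | G.Crosses F e} : ℝ) * (a.choose b : ℝ) ≤ ∑ e ∈ F,
        (((G.components F).choose (b + 1) : ℝ) - ((G.components (F.erase e)).choose (b + 1) : ℝ)) := by
      calc _ = ∑ e ∈ ({e | G.Crosses F e} : Finset (Fin m)), (a.choose b : ℝ) := by simp
        _ ≤ ∑ e ∈ ({e | G.Crosses F e} : Finset (Fin m)), _ :=
          sum_le_sum fun e he => hcr e (by simpa using he)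
        _ ≤ _ := sum_le_sum_of_subset_of_nonneg (fun e he => by
            simp at he
            exact he.mem) fun e _ _ => hnn e
    have h6 : (a + 1) * a.choose b = (a + 1).choose (b + 1) * (b + 1) := Nat.add_one_mul_choose_eq a b
    have h7 : G.minCut * (b + 1) * (a + 1).choose (b + 1) ≤
        2 * (#{e | G.Crosses F e} * a.choose b) := by
      calc _ = G.minCut * (a + 1) * a.choose b := by rw [mul_assoc, mul_assoc, h6]; ring
        _ ≤ 2 * #{e | G.Crosses F e} * a.choose b := by
          rw [ha] at h1
          exact Nat.mul_le_mul_right _ h1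
        _ = _ := by ring
    have h8 : ((G.minCut * (b + 1) : ℕ) : ℝ) * ((a + 1).choose (b + 1) : ℝ) ≤
        2 * (#{e | G.Crosses F e} * (a.choose b : ℝ)) := by exact_mod_cast h7
    rw [ha] at h5 ⊢
    linarith
  · rw [Nat.choose_eq_zero_of_lt (by omega : G.components F < k)]
    simp only [Nat.cast_zero, mul_zero]
    refine mul_nonneg (by norm_num) (sum_nonneg fun e _ => ?_)
    have := hnn e
    rw [Nat.choose_eq_zero_of_lt (by omega : G.components F < k)] at this
    simpa using this

/-- The number of `k`-sets of components is at most what it is for a cycle in which each link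
fails with probability `x`. -/
theorem mean_choose_components_le (G : Network n m) (hc : 0 < G.minCut) {k : ℕ} (hk : 2 ≤ k)
    {p x : ℝ} (hp0 : 0 ≤ p) (hp1 : p ≤ 1) (hx : 0 ≤ x) (hpx : x ^ 2 = p ^ G.minCut) :
    subsetMean p (fun F => ((G.components F).choose k : ℝ)) ≤ n.choose k * x ^ k := by
  have h := subsetMean_sq_le (fun F => ((G.components F).choose k : ℝ)) (G.minCut * k)
    (by positivity) (fun F => by positivity) (G.choose_components_growth k hk) p hp0 hp1
  have h1 : ((G.components univ).choose k : ℝ) ≤ n.choose k := by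
    exact_mod_cast Nat.choose_le_choose k (G.components_le univ)
  refine abs_le_of_sq_le_sq' ?_ (by positivity) |>.2
  refine h.trans ?_
  rw [pow_mul, ← hpx, mul_pow, ← pow_mul, ← pow_mul, mul_comm 2 k, mul_comm]
  gcongr

end Network

/-! ### Extrapolation coefficients -/

/-- The coefficients of the combination `∑ j ∈ [1, r], extrapolationCoeff r j * j ^ k` that is the
indicator of `k = 1` for `1 ≤ k ≤ r`. -/
noncomputable def extrapolationCoeff (r j : ℕ) : ℝ := (-1) ^ (j - 1) * r.choose j / j

/-- The r-th finite difference of y ↦ y^(k-1) at 0 vanishes, the degree being less than r. Up to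
sign, its terms with j ≥ 1 form the sum in question; the term with j = 0 contains 0^(k-1), which is
nonzero only for k = 1. -/
theorem sum_extrapolationCoeff {r k : ℕ} (hk : 1 ≤ k) (hkr : k ≤ r) :
    ∑ j ∈ Icc 1 r, extrapolationCoeff r j * (j : ℝ) ^ k = if k = 1 then 1 else 0 := by
  obtain ⟨i, rfl⟩ : ∃ i, k = i + 1 := ⟨k - 1, by omega⟩
  have h := congr_fun (fwdDiff_iter_pow_eq_zero_of_lt (R := ℝ) (j := i) (n := r) (by omega)) 0
  rw [fwdDiff_iter_eq_sum_shift, Finset.sum_range_succ'] at h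
  simp only [zsmul_eq_mul, zero_add, nsmul_eq_mul, mul_one, Pi.zero_apply] at h
  have h1 : ∑ j ∈ Icc 1 r, extrapolationCoeff r j * (j : ℝ) ^ (i + 1)
      = ∑ j ∈ range r, (-1) ^ j * (r.choose (j + 1) : ℝ) * ((j + 1 : ℕ) : ℝ) ^ i := by
    have e := Finset.sum_Ico_add' (fun j => (-1 : ℝ) ^ (j - 1) * (r.choose j : ℝ) *
      (j : ℝ) ^ (i)) 0 r 1
    simp only [Nat.add_sub_cancel] at e
    rw [range_eq_Ico]
    push_cast at e ⊢
    rw [e]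
    rw [show Ico (0 + 1) (r + 1) = Icc 1 r by ext; simp]
    refine sum_congr rfl fun j hj => ?_
    have : (j : ℝ) ≠ 0 := by
      have := (mem_Icc.1 hj).1
      positivity
    unfold extrapolationCoeff
    field_simp
    ring
  rw [h1]
  have h2 : ∀ j ∈ range r, (((-1 : ℤ) ^ (r - (j + 1)) * (r.choose (j + 1) : ℤ) : ℤ) : ℝ) *
      ((j + 1 : ℕ) : ℝ) ^ i =
      (-1) ^ (r + 1) * ((-1) ^ j * (r.choose (j + 1) : ℝ) * ((j + 1 : ℕ) : ℝ) ^ i) := by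
    intro j hj
    have hj' := mem_range.1 hj
    push_cast
    have : (-1 : ℝ) ^ (r + 1) * (-1) ^ j = (-1) ^ (r - (j + 1)) := by
      rw [← pow_add, show r + 1 + j = (r - (j + 1)) + 2 * (j + 1) by omega, pow_add, pow_mul]
      simp
    rw [← this]; ring
  rw [Finset.sum_congr rfl h2, ← Finset.mul_sum] at h
  have h3 : (-1 : ℝ) ^ (r + 1) * (-1) ^ (r + 1) = 1 := by
    rw [← mul_pow]; simp
  have h4 : (-1 : ℝ) ^ (r + 1) * (-1) ^ r = -1 := by
    rw [← pow_add, show r + 1 + r = 2 * r + 1 by ring, pow_succ, pow_mul]; simp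
  have h5 := congr_arg (fun z => (-1 : ℝ) ^ (r + 1) * z) h
  simp only [mul_add, ← mul_assoc, h3, mul_zero] at h5
  simp only [Nat.sub_zero, Nat.choose_zero_right] at h5
  push_cast at h5 ⊢
  rw [mul_one, h4] at h5
  rcases Nat.eq_zero_or_pos i with rfl | hi
  · simp at h5 ⊢
    linarith
  · rw [zero_pow hi.ne'] at h5
    rw [if_neg (by omega)]
    linarith

theorem abs_extrapolationCoeff_le (r j : ℕ) : |extrapolationCoeff r j| ≤ r.choose j := by
  unfold extrapolationCoeff
  rw [abs_div, abs_mul, abs_pow, abs_neg, abs_one, one_pow, one_mul, Nat.abs_cast, Nat.abs_cast]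
  rcases Nat.eq_zero_or_pos j with rfl | hj
  · simp
  · exact div_le_self (by positivity) (by exact_mod_cast hj)

theorem sum_abs_extrapolationCoeff_le (r : ℕ) :
    ∑ j ∈ Icc 1 r, |extrapolationCoeff r j| ≤ 2 ^ r := by
  calc _ ≤ ∑ j ∈ Icc 1 r, (r.choose j : ℝ) := sum_le_sum fun j _ => abs_extrapolationCoeff_le r j
    _ ≤ ∑ j ∈ range (r + 1), (r.choose j : ℝ) := by
      refine sum_le_sum_of_subset_of_nonneg (fun j hj => ?_) fun _ _ _ => by positivity
      simp at hj ⊢; omega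
    _ = 2 ^ r := by exact_mod_cast Nat.sum_range_choose r

theorem abs_sum_extrapolationCoeff_mul_pow_le (r k : ℕ) :
    |∑ j ∈ Icc 1 r, extrapolationCoeff r j * (j : ℝ) ^ k| ≤ 2 ^ r * (r : ℝ) ^ k := by
  refine (abs_sum_le_sum_abs _ _).trans ?_
  refine le_trans (sum_le_sum (g := fun j => |extrapolationCoeff r j| * (r : ℝ) ^ k) ?_) ?_
  · intro j hj
    rw [abs_mul, abs_of_nonneg (by positivity : (0 : ℝ) ≤ (j : ℝ) ^ k)]
    have : (j : ℝ) ≤ r := by exact_mod_cast (mem_Icc.1 hj).2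
    gcongr
  · rw [← sum_mul]
    exact mul_le_mul_of_nonneg_right (sum_abs_extrapolationCoeff_le r) (by positivity)

/-- The weight of a labeling with greatest label `M`. -/
noncomputable def labelWeight (r M : ℕ) : ℝ := ∑ j ∈ Ioc M r, extrapolationCoeff r j

/-! ### Labelings and the failure probability -/

namespace Network

variable {n m : ℕ}

/-- The edges with differently labeled ends. -/
def cutEdges (G : Network n m) (f : Fin n → ℕ) : Finset (Fin m) :=
  {e | f (G.ends e).1 ≠ f (G.ends e).2}

/-- The labelings of the vertices with labels less than `j`. -/
def labelings (n j : ℕ) : Finset (Fin n → ℕ) := Fintype.piFinset fun _ => range j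

theorem mem_labelings {j : ℕ} {f : Fin n → ℕ} : f ∈ labelings n j ↔ ∀ v, f v < j := by
  simp [labelings]

theorem cutEdges_subset_iff (G : Network n m) (f : Fin n → ℕ) (F : Finset (Fin m)) :
    G.cutEdges f ⊆ F ↔ ∀ u v, (G.surviving F).Adj u v → f u = f v := by
  constructor
  · intro h u v huv
    rw [surviving_adj] at huv
    by_contra hne
    obtain ⟨-, ⟨e, he, h1⟩ | ⟨e, he, h1⟩⟩ := huv
    · exact he (h (by simp [cutEdges, h1, hne]))
    · exact he (h (by simp [cutEdges, h1, Ne.symm hne]))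
  · intro h e he
    by_contra heF
    simp only [cutEdges, mem_filter, mem_univ, true_and] at he
    refine he (h _ _ (surviving_adj.2 ⟨fun h' => he (by rw [h']), Or.inl ⟨e, heF, rfl⟩⟩))

open Classical in
-- A labeling all of whose cut edges have failed is constant along surviving edges, hence is the
-- same as a labeling of the components.
theorem card_labelings_cutEdges_subset (G : Network n m) (F : Finset (Fin m)) (j : ℕ) :
    #{f ∈ labelings n j | G.cutEdges f ⊆ F} = j ^ G.components F := by
  set H := G.surviving F with hH
  have h1 : #(Fintype.piFinset fun _ : H.ConnectedComponent => range j) = j ^ G.components F := by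
    rw [Fintype.card_piFinset]
    simp [components, hH]
  rw [← h1]
  refine card_bij' (fun f _ C => f C.out) (fun g _ v => g (H.connectedComponentMk v)) ?_ ?_ ?_ ?_
  · intro f hf
    simp only [mem_filter, mem_labelings] at hf
    simp [hf.1]
  · intro g hg
    simp only [Fintype.mem_piFinset, mem_range] at hg
    simp only [mem_filter, mem_labelings, cutEdges_subset_iff]
    refine ⟨fun v => hg _, fun u v huv => ?_⟩
    rw [SimpleGraph.ConnectedComponent.sound huv.reachable]
  · intro f hf
    simp only [mem_filter, cutEdges_subset_iff] at hf
    funext v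
    have hr : H.Reachable (H.connectedComponentMk v).out v :=
      SimpleGraph.ConnectedComponent.exact (Quot.out_eq (H.connectedComponentMk v))
    obtain ⟨w⟩ := hr
    change f (H.connectedComponentMk v).out = f v
    generalize (H.connectedComponentMk v).out = u at w
    induction w with
    | nil => rfl
    | cons h _ ih => exact (hf.2 _ _ h).trans ih
  · intro g hg
    funext C
    exact congr_arg g (Quot.out_eq C)

/-- p^#C is the probability that all edges of C fail. Exchanging sum and mean leaves the count of
labelings whose cut edges have all failed. -/
theorem sum_pow_card_cutEdges (G : Network n m) (p : ℝ) (j : ℕ) :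
    ∑ f ∈ labelings n j, p ^ #(G.cutEdges f) =
      subsetMean p (fun F => (j : ℝ) ^ G.components F) := by
  classical
  have h : ∀ F, (j : ℝ) ^ G.components F =
      ∑ f ∈ labelings n j, 1 * (if G.cutEdges f ⊆ F then (1 : ℝ) else 0) := by
    intro F
    rw [← Nat.cast_pow, ← card_labelings_cutEdges_subset]
    simp
  simp only [h]
  rw [subsetMean_sum]
  simp [subsetMean_superset]

theorem surviving_connected_iff (G : Network n m) (hn : 0 < n) (F : Finset (Fin m)) :
    (G.surviving F).Connected ↔ G.components F = 1 := by
  classical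
  have : Nonempty (Fin n) := ⟨⟨0, hn⟩⟩
  rw [components, Fintype.card_eq_one_iff_nonempty_unique]
  constructor
  · intro h
    exact ⟨⟨⟨(G.surviving F).connectedComponentMk ⟨0, hn⟩⟩, fun C => by
      induction C using SimpleGraph.ConnectedComponent.ind with
      | _ v => exact SimpleGraph.ConnectedComponent.sound (h.preconnected _ _)⟩⟩
  · rintro ⟨h⟩
    exact ⟨fun u v => SimpleGraph.ConnectedComponent.exact (Subsingleton.elim _ _)⟩

theorem components_pos (G : Network n m) (hn : 0 < n) (F : Finset (Fin m)) :
    0 < G.components F := by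
  classical
  exact Fintype.card_pos_iff.2 ⟨(G.surviving F).connectedComponentMk ⟨0, hn⟩⟩

theorem one_sub_fail (G : Network n m) (hn : 0 < n) (p : ℝ) :
    1 - G.fail p = subsetMean p (fun F => if G.components F = 1 then 1 else 0) := by
  have h1 := subsetMean_one p (E := Fin m)
  have h2 : G.fail p + subsetMean p (fun F => if G.components F = 1 then 1 else 0) =
      subsetMean p (fun _ : Finset (Fin m) => 1) := by
    unfold fail subsetMean
    rw [← sum_add_distrib]
    refine sum_congr rfl fun F _ => ?_
    simp only [surviving_connected_iff G hn]
    split_ifs <;> ring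
  linarith

/-- The cut values are attained. -/
theorem exists_cutValue_eq_minCut (G : Network n m) (hn : 2 ≤ n) :
    ∃ A : Finset (Fin n), A.Nonempty ∧ A ≠ univ ∧ G.cutValue A = G.minCut := by
  refine Nat.sInf_mem (s := {k | ∃ A : Finset (Fin n), A.Nonempty ∧ A ≠ univ ∧
    G.cutValue A = k}) ⟨_, {⟨0, by omega⟩}, singleton_nonempty _, fun h => ?_, rfl⟩
  have : (⟨1, by omega⟩ : Fin n) ∈ ({⟨0, by omega⟩} : Finset (Fin n)) := h ▸ mem_univ _
  simp at this

/-- If all edges of a minimum cut fail, no walk leads from one side to the other. This lower bound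
turns absolute errors of order p^c into relative ones. -/
theorem pow_minCut_le_fail (G : Network n m) (hn : 2 ≤ n) {p : ℝ} (hp0 : 0 ≤ p) (hp1 : p ≤ 1) :
    p ^ G.minCut ≤ G.fail p := by
  classical
  obtain ⟨A, hA, hA', h⟩ := G.exists_cutValue_eq_minCut hn
  rw [← h, cutValue, ← subsetMean_superset]
  have h1 := G.one_sub_fail (by omega) p
  have h2 := subsetMean_one p (E := Fin m)
  have : G.fail p = subsetMean p (fun F => 1 - if G.components F = 1 then 1 else 0) := by
    have h3 : subsetMean p (fun F => (1 : ℝ) - if G.components F = 1 then 1 else 0) =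
        subsetMean p (fun _ : Finset (Fin m) => 1) -
          subsetMean p (fun F => if G.components F = 1 then 1 else 0) := by
      unfold subsetMean
      rw [← sum_sub_distrib]
      refine sum_congr rfl fun F _ => by ring
    rw [h3, ← h1, h2]; ring
  rw [this]
  refine subsetMean_mono hp0 hp1 fun F => ?_
  split_ifs with h3 h4 h4
  · exfalso
    rw [← surviving_connected_iff G (by omega)] at h4
    obtain ⟨a, ha⟩ := hA
    obtain ⟨b, hb⟩ : ∃ b, b ∉ A := by
      by_contra hb
      push Not at hb
      exact hA' (eq_univ_of_forall hb)
    have hadj : ∀ u v, (G.surviving F).Adj u v → (u ∈ A ↔ v ∈ A) := by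
      intro u v huv
      rw [surviving_adj] at huv
      by_contra hne
      obtain ⟨-, ⟨e, he, h1⟩ | ⟨e, he, h1⟩⟩ := huv
      · exact he (h3 (by simp [h1, hne]))
      · refine he (h3 ?_)
        simp only [mem_filter, mem_univ, true_and, h1]
        tauto
    -- A walk from a to b would stay on the side A.
    obtain ⟨w⟩ := h4.preconnected a b
    induction w with
    | nil => exact hb ha
    | cons h _ ih => exact ih ((hadj _ _ h).1 ha) hb
  · simp
  · simp
  · simp

/-- A labeling occurs in the j-th inner sum exactly when its greatest label is less than j; its
total coefficient is thus a sum over the j above that label. -/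
theorem sum_labelWeight (G : Network n m) (r : ℕ) (p : ℝ) :
    ∑ f ∈ labelings n r, labelWeight r (univ.sup f) * p ^ #(G.cutEdges f) =
      ∑ j ∈ Icc 1 r, extrapolationCoeff r j *
        ∑ f ∈ labelings n j, p ^ #(G.cutEdges f) := by
  have h1 : ∀ j ∈ Icc 1 r, ∀ f : Fin n → ℕ, f ∈ labelings n j ↔
      f ∈ labelings n r ∧ j ∈ Ioc (univ.sup f) r := by
    intro j hj f
    rw [mem_Icc] at hj
    have : univ.sup f < j ↔ ∀ v, f v < j := by
      rw [Finset.sup_lt_iff (by simp; omega)]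
      simp
    rw [mem_Ioc, this, mem_labelings, mem_labelings]
    exact ⟨fun h => ⟨fun v => (h v).trans_le hj.2, h, hj.2⟩, fun h => h.2.1⟩
  simp only [labelWeight, sum_mul, mul_sum]
  refine sum_comm' fun f j => ?_
  constructor
  · rintro ⟨hf, hj⟩
    have hj' : j ∈ Icc 1 r := by
      rw [mem_Ioc] at hj
      rw [mem_Icc]; omega
    exact ⟨(h1 j hj' f).2 ⟨hf, hj⟩, hj'⟩
  · rintro ⟨hf, hj⟩
    exact (h1 j hj f).1 hf

end Network

/-! ### Error estimates -/

namespace Network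

variable {n m : ℕ}

/-- The combination is exact when K ≤ r. For K > r it is at most 2^r r^K ≤ (2r)^K, which is one term
of Σ_{r<j≤n} (2r)^j binom(K, j); the mean of binom(K, j) has been bounded for j ≥ 2. -/
theorem abs_extrapolation_sub_le (G : Network n m) (hn : 0 < n) (hc : 0 < G.minCut) {r : ℕ}
    (hr : 0 < r) {p x : ℝ} (hp0 : 0 ≤ p) (hp1 : p ≤ 1) (hx : 0 ≤ x)
    (hpx : x ^ 2 = p ^ G.minCut) :
    |∑ f ∈ labelings n r, labelWeight r (univ.sup f) * p ^ #(G.cutEdges f) - (1 - G.fail p)| ≤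
      ∑ j ∈ Ioc r n, n.choose j * (2 * r * x) ^ j := by
  have h1 : ∑ f ∈ labelings n r, labelWeight r (univ.sup f) * p ^ #(G.cutEdges f) -
      (1 - G.fail p) = subsetMean p (fun F => (∑ j ∈ Icc 1 r, extrapolationCoeff r j *
        (j : ℝ) ^ G.components F) - if G.components F = 1 then 1 else 0) := by
    rw [sum_labelWeight, one_sub_fail G hn]
    simp only [sum_pow_card_cutEdges]
    rw [← subsetMean_sum]
    simp only [subsetMean]
    rw [← sum_sub_distrib]
    refine sum_congr rfl fun F _ => by ring
  have h2 : ∀ F, |(∑ j ∈ Icc 1 r, extrapolationCoeff r j *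
        (j : ℝ) ^ G.components F) - if G.components F = 1 then 1 else 0| ≤
      ∑ j ∈ Ioc r n, (2 * r : ℝ) ^ j * ((G.components F).choose j : ℝ) := by
    intro F
    by_cases hk : G.components F ≤ r
    · rw [sum_extrapolationCoeff (G.components_pos hn F) hk, sub_self, abs_zero]
      exact sum_nonneg fun j _ => by positivity
    · push Not at hk
      rw [if_neg (by omega), sub_zero]
      refine (abs_sum_extrapolationCoeff_mul_pow_le _ _).trans ?_
      have h3 : (2 * r : ℝ) ^ (G.components F) *
          ((G.components F).choose (G.components F) : ℝ) ≤
          ∑ j ∈ Ioc r n, (2 * r : ℝ) ^ j * ((G.components F).choose j : ℝ) :=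
        single_le_sum (f := fun j => (2 * r : ℝ) ^ j * ((G.components F).choose j : ℝ))
          (fun j _ => by positivity) (mem_Ioc.2 ⟨hk, G.components_le F⟩)
      refine le_trans ?_ h3
      rw [Nat.choose_self, Nat.cast_one, mul_one, mul_pow]
      have : (2 : ℝ) ^ r ≤ 2 ^ G.components F := pow_le_pow_right₀ (by norm_num) hk.le
      gcongr
  rw [h1]
  have h4 : subsetMean p (fun F => ∑ j ∈ Ioc r n, (2 * r : ℝ) ^ j *
      ((G.components F).choose j : ℝ)) ≤ ∑ j ∈ Ioc r n, n.choose j * (2 * r * x) ^ j := by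
    rw [subsetMean_sum]
    refine sum_le_sum fun j hj => ?_
    have := G.mean_choose_components_le hc (k := j) (by have := (mem_Ioc.1 hj).1; omega)
      hp0 hp1 hx hpx
    calc _ ≤ (2 * r : ℝ) ^ j * (n.choose j * x ^ j) := by gcongr
      _ = _ := by rw [mul_pow]; ring
  refine le_trans ?_ h4
  rw [abs_le]
  constructor
  · have : -subsetMean p (fun F => ∑ j ∈ Ioc r n, (2 * r : ℝ) ^ j *
      ((G.components F).choose j : ℝ)) = subsetMean p (fun F => -∑ j ∈ Ioc r n, (2 * r : ℝ) ^ j *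
      ((G.components F).choose j : ℝ)) := by
      simp [subsetMean]
    rw [this]
    exact subsetMean_mono hp0 hp1 fun F => (abs_le.1 (h2 F)).1
  · exact subsetMean_mono hp0 hp1 fun F => (abs_le.1 (h2 F)).2

theorem abs_labelWeight_le (r M : ℕ) : |labelWeight r M| ≤ 2 ^ r := by
  refine (abs_sum_le_sum_abs _ _).trans (le_trans ?_ (sum_abs_extrapolationCoeff_le r))
  refine sum_le_sum_of_subset_of_nonneg (fun j hj => ?_) fun _ _ _ => abs_nonneg _
  rw [mem_Ioc] at hj
  rw [mem_Icc]; omega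

theorem exp_nat_le (r : ℕ) : Real.exp r ≤ 3 ^ r := by
  rw [← mul_one (r : ℝ), Real.exp_nat_mul]
  have := Real.exp_one_lt_d9
  gcongr
  linarith

/-- Here x = 1/n, so that E[binom(K, i)] ≤ binom(n, i) n^(-i) ≤ 1/i!, and E[r^K] is dominated by the
exponential series of r. -/
theorem sum_labelings_pow_le (G : Network n m) (hn : 0 < n) (hc : 0 < G.minCut) (r : ℕ)
    {p : ℝ} (hp0 : 0 ≤ p) (hp1 : p ≤ 1) (hp : (1 / (n : ℝ)) ^ 2 = p ^ G.minCut) :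
    ∑ f ∈ labelings n r, p ^ #(G.cutEdges f) ≤ 3 ^ r := by
  rw [sum_pow_card_cutEdges]
  -- The bound for the mean of binom(K, i) needs i ≥ 2; for i = 1 the factor 1 = 1/1! takes its
  -- place.
  have h1 : ∀ F, (r : ℝ) ^ G.components F ≤
      ∑ i ∈ Icc 1 n, (r : ℝ) ^ i * (if i = 1 then 1 else ((G.components F).choose i : ℝ)) := by
    intro F
    have hpos := G.components_pos hn F
    refine le_trans ?_ (single_le_sum (f := fun i => (r : ℝ) ^ i *
      (if i = 1 then 1 else ((G.components F).choose i : ℝ)))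
      (fun i _ => ?_) (mem_Icc.2 ⟨hpos, G.components_le F⟩))
    · simp
    · split_ifs <;> positivity
  refine (subsetMean_mono hp0 hp1 h1).trans ?_
  have h2 : ∑ i ∈ range (n + 1), (r : ℝ) ^ i / (i.factorial : ℝ) ≤ 3 ^ r :=
    (Real.sum_le_exp_of_nonneg (by positivity) _).trans (exp_nat_le r)
  refine le_trans ?_ h2
  have h3 := subsetMean_sum p (Icc 1 n) (fun i => (r : ℝ) ^ i)
    (fun i F => if i = 1 then (1 : ℝ) else ((G.components F).choose i : ℝ))
  rw [h3]
  refine le_trans (sum_le_sum (g := fun i => (r : ℝ) ^ i / (i.factorial : ℝ)) ?_)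
    (sum_le_sum_of_subset_of_nonneg (fun i hi => ?_) fun _ _ _ => by positivity)
  · intro i hi
    rw [mem_Icc] at hi
    rw [div_eq_mul_inv]
    refine mul_le_mul_of_nonneg_left ?_ (by positivity)
    by_cases hi1 : i = 1
    · subst hi1
      simp [subsetMean_one]
    · simp only [hi1, if_false]
      refine (G.mean_choose_components_le hc (k := i) (by omega) hp0 hp1 (by positivity) hp).trans ?_
      have h4 := Nat.choose_le_pow_div (α := ℝ) i n
      calc (n.choose i : ℝ) * (1 / n) ^ i ≤ (n ^ i : ℝ) / i.factorial * (1 / n) ^ i := by gcongr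
        _ = _ := by
          have : (n : ℝ) ^ i * (1 / n) ^ i = 1 := by
            rw [← mul_pow, mul_one_div_cancel (by positivity), one_pow]
          rw [div_mul_eq_mul_div, this, one_div]
  · rw [mem_Icc] at hi
    rw [mem_range]; omega

/-- Write p = tq with q^c = n^(-2), so that t^c = (nx)² ≤ 1. On cuts of at least αc edges the power
of t is at most (nx)^(2α), and the powers of q sum to at most 3^r. The weights contribute 2^r. -/
theorem sum_large_cuts_le (G : Network n m) (hn : 0 < n) (hc : 0 < G.minCut) (r α : ℕ)
    {p x : ℝ} (hp0 : 0 ≤ p) (hx : 0 ≤ x) (hpx : x ^ 2 = p ^ G.minCut) (hnx : n * x ≤ 1)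
    (S : Finset (Fin n → ℕ)) (hS : S ⊆ labelings n r)
    (hcut : ∀ f ∈ S, α * G.minCut ≤ #(G.cutEdges f)) :
    ∑ f ∈ S, |labelWeight r (univ.sup f) * p ^ #(G.cutEdges f)| ≤ 6 ^ r * (n * x) ^ (2 * α) := by
  have hn0 : (0 : ℝ) < n := by exact_mod_cast hn
  have hn1 : (1 : ℝ) ≤ n := by exact_mod_cast hn
  have hc0 : (G.minCut : ℝ) ≠ 0 := by exact_mod_cast hc.ne'
  set q : ℝ := (n : ℝ) ^ (-2 / (G.minCut : ℝ)) with hq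
  have hq0 : 0 < q := by positivity
  have hqc : q ^ G.minCut = (1 / (n : ℝ)) ^ 2 := by
    rw [hq, ← Real.rpow_natCast, ← Real.rpow_mul hn0.le, div_mul_cancel₀ _ hc0,
      Real.rpow_neg hn0.le]
    norm_num
  have hq1 : q ≤ 1 := by
    refine Real.rpow_le_one_of_one_le_of_nonpos hn1 ?_
    exact div_nonpos_of_nonpos_of_nonneg (by norm_num) (by positivity)
  set t := p / q with ht
  have ht0 : 0 ≤ t := by positivity
  have htc : t ^ G.minCut = (n * x) ^ 2 := by
    rw [ht, div_pow, hqc, ← hpx]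
    field_simp
  have ht1 : t ≤ 1 := by
    by_contra h
    push Not at h
    have := one_lt_pow₀ h hc.ne'
    rw [htc] at this
    have h2 : (n * x) ^ 2 ≤ 1 := pow_le_one₀ (by positivity) hnx
    linarith
  calc ∑ f ∈ S, |labelWeight r (univ.sup f) * p ^ #(G.cutEdges f)|
      ≤ ∑ f ∈ S, 2 ^ r * (n * x) ^ (2 * α) * q ^ #(G.cutEdges f) := by
        refine sum_le_sum fun f hf => ?_
        rw [abs_mul, abs_of_nonneg (by positivity : 0 ≤ p ^ #(G.cutEdges f)), mul_assoc]
        refine mul_le_mul (abs_labelWeight_le _ _) ?_ (by positivity) (by positivity)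
        have h1 : p ^ #(G.cutEdges f) = t ^ #(G.cutEdges f) * q ^ #(G.cutEdges f) := by
          rw [← mul_pow, ht, div_mul_cancel₀ _ hq0.ne']
        rw [h1]
        refine mul_le_mul_of_nonneg_right ?_ (by positivity)
        calc t ^ #(G.cutEdges f) ≤ t ^ (α * G.minCut) := pow_le_pow_of_le_one ht0 ht1 (hcut f hf)
          _ = (n * x) ^ (2 * α) := by
            rw [mul_comm, pow_mul, htc, ← pow_mul]
    _ = 2 ^ r * (n * x) ^ (2 * α) * ∑ f ∈ S, q ^ #(G.cutEdges f) := by rw [mul_sum]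
    _ ≤ 2 ^ r * (n * x) ^ (2 * α) * 3 ^ r := by
        refine mul_le_mul_of_nonneg_left ?_ (by positivity)
        exact (sum_le_sum_of_subset_of_nonneg hS fun _ _ _ => by positivity).trans
          (G.sum_labelings_pow_le hn hc r hq0.le hq1 hqc.symm)
    _ = _ := by
        rw [show (6 : ℝ) = 2 * 3 by norm_num, mul_pow (2 : ℝ) 3]; ring

/-- The bound for the truncation at `r` components. -/
theorem sum_choose_mul_pow_le {d L r : ℕ} {x ε : ℝ} (hn : 2 ≤ n) (hd : 2 ≤ d) (hx : 0 ≤ x)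
    (hxd : (n * x) ^ d * n ≤ 1) (hε : 1 ≤ ε * (n : ℝ) ^ L) (hr : 6 ^ (2 * d) ≤ r)
    (hrL : 1 + 2 * d * (4 + L) ≤ r) :
    ∑ j ∈ Ioc r n, (n.choose j : ℝ) * (2 * r * x) ^ j ≤ ε / 2 * x ^ 2 := by
  have hn0 : (0 : ℝ) < n := by positivity
  have hn1 : (1 : ℝ) ≤ n := by exact_mod_cast (by omega : 1 ≤ n)
  have hε0 : 0 < ε := by
    by_contra h
    push Not at h
    have : ε * (n : ℝ) ^ L ≤ 0 := mul_nonpos_of_nonpos_of_nonneg h (by positivity)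
    linarith
  rcases le_or_gt n r with hnr | hnr
  · rw [Ioc_eq_empty (by omega), sum_empty]; positivity
  -- In the j-th term binom(n, j) ≤ n^j / j!, and r^j / j! ≤ e^r ≤ 3^r ≤ 3^j because j > r. So the
  -- term is at most (3 · 2nx)^j = z^j.
  set z : ℝ := 6 * (n * x) with hz
  have hz0 : 0 ≤ z := by positivity
  have hz1 : z ^ (2 * d) ≤ 1 / n := by
    have h6 : (6 : ℝ) ^ (2 * d) ≤ n := by exact_mod_cast hr.trans hnr.le
    have h7 : (n * x) ^ d ≤ 1 / n := by rwa [le_div_iff₀ hn0]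
    calc z ^ (2 * d) = 6 ^ (2 * d) * ((n * x) ^ d) ^ 2 := by
          rw [hz, mul_pow, mul_comm 2 d, pow_mul (n * x)]
      _ ≤ n * (1 / n) ^ 2 := by gcongr
      _ = 1 / n := by field_simp
  have hzle : z ≤ 1 := by
    by_contra h
    push Not at h
    have := one_lt_pow₀ h (by omega : 2 * d ≠ 0)
    have h2 : 1 / (n : ℝ) ≤ 1 := by rw [div_le_one hn0]; exact hn1
    linarith
  -- Two factors z are kept to produce x². Of the power 4 + L of 1/n, three factors cancel the n² in
  -- z² and the number of terms; one pays for the constant and L pay for ε.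
  have hzq : z ^ (r - 1) ≤ (1 / n : ℝ) ^ (4 + L) := by
    calc z ^ (r - 1) ≤ z ^ (2 * d * (4 + L)) := pow_le_pow_of_le_one hz0 hzle (by omega)
      _ = (z ^ (2 * d)) ^ (4 + L) := pow_mul _ _ _
      _ ≤ _ := by gcongr
  have hterm : ∀ j ∈ Ioc r n, (n.choose j : ℝ) * (2 * r * x) ^ j ≤ z ^ (r + 1) := by
    intro j hj
    rw [mem_Ioc] at hj
    have h1 : (r : ℝ) ^ j / j.factorial ≤ 3 ^ j :=
      (Real.pow_div_factorial_le_exp _ (by positivity) j).trans ((exp_nat_le r).trans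
        (pow_le_pow_right₀ (by norm_num) hj.1.le))
    calc (n.choose j : ℝ) * (2 * r * x) ^ j ≤ (n ^ j : ℝ) / j.factorial * (2 * r * x) ^ j := by
          gcongr
          exact Nat.choose_le_pow_div j n
      _ = ((r : ℝ) ^ j / j.factorial) * (2 * (n * x)) ^ j := by
          simp only [mul_pow]; ring
      _ ≤ 3 ^ j * (2 * (n * x)) ^ j := by gcongr
      _ = z ^ j := by rw [← mul_pow, hz]; ring
      _ ≤ z ^ (r + 1) := pow_le_pow_of_le_one hz0 hzle hj.1
  calc ∑ j ∈ Ioc r n, (n.choose j : ℝ) * (2 * r * x) ^ j ≤ ∑ j ∈ Ioc r n, z ^ (r + 1) :=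
        sum_le_sum hterm
    _ = ((n - r : ℕ) : ℝ) * z ^ (r + 1) := by simp
    _ ≤ n * z ^ (r + 1) := by
        gcongr
        exact Nat.sub_le _ _
    _ = n * (z ^ 2 * z ^ (r - 1)) := by
        rw [← pow_add]; congr 2; omega
    _ ≤ n * (z ^ 2 * (1 / n : ℝ) ^ (4 + L)) := by gcongr
    _ = 36 * x ^ 2 * (1 / n) ^ (1 + L) := by
        rw [hz]
        simp only [one_div, inv_pow, pow_add]
        field_simp
        ring
    _ ≤ ε / 2 * x ^ 2 := by
        -- The constant is 36 / 72 = 1/2; in the present case n > r ≥ 6^4.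
        have h72 : (72 : ℝ) ≤ n := by
          have h1 : 6 ^ (2 * 2) ≤ 6 ^ (2 * d) := Nat.pow_le_pow_right (by norm_num) (by omega)
          exact_mod_cast (by omega : 72 ≤ n)
        have h8 : (1 / n : ℝ) ^ L ≤ ε := by
          rw [one_div, inv_pow, inv_le_iff_one_le_mul₀ (by positivity)]
          exact hε
        have h9 : (1 / n : ℝ) ≤ 1 / 72 := by
          gcongr
        calc 36 * x ^ 2 * (1 / n) ^ (1 + L) = 36 * x ^ 2 * ((1 / n) * (1 / n) ^ L) := by
              rw [pow_add, pow_one]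
          _ ≤ 36 * x ^ 2 * (1 / 72 * ε) := by gcongr
          _ = _ := by ring

/-- Of the factor n^(-(4r+3)) supplied by (nx)^(d(4r+3)), the part n^(-3r) absorbs 6^r since n³ ≥ 8,
the part n^(-r) is at most ε, n^(-2) cancels the n² in (nx)², and the last 1/n is at most 1/2. -/
theorem six_pow_mul_pow_le {d L r α : ℕ} {x ε : ℝ} (hn : 2 ≤ n) (hx : 0 ≤ x)
    (hxd : (n * x) ^ d * n ≤ 1) (hnx : n * x ≤ 1) (hε : 1 ≤ ε * (n : ℝ) ^ L) (hLr : L ≤ r)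
    (hα : 1 + d * (4 * r + 3) ≤ α) :
    6 ^ r * (n * x) ^ (2 * α) ≤ ε / 2 * x ^ 2 := by
  have hn0 : (0 : ℝ) < n := by positivity
  have hn2 : (2 : ℝ) ≤ n := by exact_mod_cast hn
  have h1 : (n * x) ^ d ≤ 1 / n := by rwa [le_div_iff₀ hn0]
  have h2 : (n * x) ^ (2 * α) ≤ (n * x) ^ 2 * (1 / n) ^ (4 * r + 3) := by
    calc (n * x) ^ (2 * α) ≤ (n * x) ^ (2 + d * (4 * r + 3)) :=
          pow_le_pow_of_le_one (by positivity) hnx (by omega)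
      _ = (n * x) ^ 2 * ((n * x) ^ d) ^ (4 * r + 3) := by rw [pow_add, pow_mul]
      _ ≤ _ := by gcongr
  have h3 : (1 / n : ℝ) ^ r ≤ ε := by
    have : (1 / n : ℝ) ^ r ≤ (1 / n : ℝ) ^ L :=
      pow_le_pow_of_le_one (by positivity) (by rw [div_le_one hn0]; linarith) hLr
    refine this.trans ?_
    rw [one_div, inv_pow, inv_le_iff_one_le_mul₀ (by positivity)]
    exact hε
  have h4 : (6 : ℝ) ^ r * (1 / n) ^ (3 * r) ≤ 1 := by
    rw [pow_mul, ← mul_pow]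
    refine pow_le_one₀ (by positivity) ?_
    rw [one_div, inv_pow, mul_inv_le_iff₀ (by positivity)]
    nlinarith [pow_le_pow_left₀ (by norm_num) hn2 3]
  have h5 : (1 / n : ℝ) ≤ 1 / 2 := by gcongr
  calc 6 ^ r * (n * x) ^ (2 * α) ≤ 6 ^ r * ((n * x) ^ 2 * (1 / n) ^ (4 * r + 3)) := by gcongr
    _ = (6 ^ r * (1 / n) ^ (3 * r)) * (1 / n : ℝ) ^ r * (1 / n) * x ^ 2 := by
        rw [show 4 * r + 3 = 3 * r + r + 1 + 2 by ring]
        simp only [pow_add]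
        field_simp
    _ ≤ 1 * ε * (1 / 2) * x ^ 2 := by
        have : 0 ≤ ε := le_trans (by positivity) h3
        gcongr
    _ = _ := by ring

/-- Every set of labelings that contains those with few cut edges yields an approximation of the
failure probability. -/
theorem abs_estimate_sub_fail_le (G : Network n m) (hn : 2 ≤ n) (hc : 0 < G.minCut)
    {d L r α : ℕ} {p ε : ℝ} (hp0 : 0 ≤ p) (hp1 : p ≤ 1) (hd : 2 ≤ d)
    (hpd : (n ^ 2 * p ^ G.minCut) ^ d * n ^ 2 ≤ 1) (hε : 1 ≤ ε * (n : ℝ) ^ L)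
    (hr : 6 ^ (2 * d) ≤ r) (hrL : 1 + 2 * d * (4 + L) ≤ r) (hα : 1 + d * (4 * r + 3) ≤ α)
    (S : Finset (Fin n → ℕ)) (hS : S ⊆ labelings n r)
    (hcut : ∀ f ∈ labelings n r, #(G.cutEdges f) ≤ α * G.minCut → f ∈ S) :
    |1 - ∑ f ∈ S, labelWeight r (univ.sup f) * p ^ #(G.cutEdges f) - G.fail p| ≤
      ε * G.fail p := by
  have hn1 : (1 : ℝ) ≤ n := by exact_mod_cast (by omega : 1 ≤ n)
  set x := √(p ^ G.minCut) with hxdef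
  have hx : 0 ≤ x := Real.sqrt_nonneg _
  have hpx : x ^ 2 = p ^ G.minCut := Real.sq_sqrt (by positivity)
  -- This is the square root of `hpd`.
  have hxd : (n * x) ^ d * n ≤ 1 := by
    refine abs_le_of_sq_le_sq' (b := 1) ?_ zero_le_one |>.2
    rw [one_pow]
    refine le_trans (le_of_eq ?_) hpd
    rw [← hpx]; ring
  have hnx : n * x ≤ 1 := by
    by_contra h
    push Not at h
    have h1 := one_lt_pow₀ h (by omega : d ≠ 0)
    nlinarith
  have hε0 : 0 ≤ ε := by
    by_contra h
    push Not at h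
    have : ε * (n : ℝ) ^ L ≤ 0 := mul_nonpos_of_nonpos_of_nonneg h.le (by positivity)
    linarith
  have hrpos : 0 < r := by omega
  have e1 := (G.abs_extrapolation_sub_le (by omega) hc hrpos hp0 hp1 hx hpx).trans
    (sum_choose_mul_pow_le hn hd hx hxd hε hr hrL)
  have hLr : L ≤ r := by nlinarith
  have e2 := (abs_sum_le_sum_abs _ _).trans <|
    (G.sum_large_cuts_le (by omega) hc r α hp0 hx hpx hnx (labelings n r \ S) sdiff_subset
    (fun f hf => by
      rw [mem_sdiff] at hf
      by_contra h
      exact hf.2 (hcut f hf.1 (by omega)))).trans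
    (six_pow_mul_pow_le hn hx hxd hnx hε hLr hα)
  -- Truncation and omitted labelings cost εx²/2 each, and x² is at most the failure probability.
  have e3 := G.pow_minCut_le_fail hn hp0 hp1
  rw [← hpx] at e3
  have e4 := sum_sdiff hS (f := fun f => labelWeight r (univ.sup f) * p ^ #(G.cutEdges f))
  have e5 : ε * x ^ 2 ≤ ε * G.fail p := mul_le_mul_of_nonneg_left e3 hε0
  rw [abs_le] at e1 e2 ⊢
  constructor <;> linarith [e1.1, e1.2, e2.1, e2.2]

end Network

/-! ### Comparison of sums through level sets -/

theorem integral_indicator_lt {a T : ℝ} (ha : 0 ≤ a) (haT : a ≤ T) :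
    ∫ τ in Set.Ioc 0 T, (Set.Iio a).indicator (fun _ => (1 : ℝ)) τ = a := by
  rw [MeasureTheory.setIntegral_indicator measurableSet_Iio]
  have : Set.Ioc 0 T ∩ Set.Iio a = Set.Ioo 0 a := by
    ext x
    simp only [Set.mem_inter_iff, Set.mem_Ioc, Set.mem_Iio, Set.mem_Ioo]
    constructor
    · rintro ⟨⟨h1, _⟩, h2⟩; exact ⟨h1, h2⟩
    · rintro ⟨h1, h2⟩; exact ⟨⟨h1, by linarith⟩, h2⟩
  rw [this]
  simp [ha]

/-- Comparison of weighted sums through their level sets. -/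
theorem mul_sum_le_of_level_sets {ι κ : Type*} (s : Finset ι) (t : Finset κ) {a : ι → ℝ}
    {w b : κ → ℝ} {c : ℝ} (ha : ∀ i ∈ s, 0 ≤ a i) (hb : ∀ x ∈ t, 0 ≤ b x)
    (h : ∀ τ, 0 ≤ τ → c * #{i ∈ s | τ < a i} ≤ ∑ x ∈ t with τ < b x, w x) :
    c * ∑ i ∈ s, a i ≤ ∑ x ∈ t, w x * b x := by
  set T : ℝ := ∑ i ∈ s, a i + ∑ x ∈ t, b x with hT
  have haT : ∀ i ∈ s, a i ≤ T := fun i hi =>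
    (single_le_sum ha hi).trans (le_add_of_nonneg_right (sum_nonneg hb))
  have hbT : ∀ x ∈ t, b x ≤ T := fun x hx =>
    (single_le_sum hb hx).trans (le_add_of_nonneg_left (sum_nonneg ha))
  have hint : ∀ y : ℝ, MeasureTheory.IntegrableOn
      ((Set.Iio y).indicator (fun _ => (1 : ℝ))) (Set.Ioc 0 T) := fun y =>
    (MeasureTheory.integrable_const (1 : ℝ)).indicator measurableSet_Iio
  -- Layer cake: every summand is the integral of the indicator of the τ below it, so the hypothesis
  -- may be integrated over τ.
  have h1 : c * ∑ i ∈ s, a i = ∫ τ in Set.Ioc 0 T,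
      c * ∑ i ∈ s, (Set.Iio (a i)).indicator (fun _ => (1 : ℝ)) τ := by
    rw [MeasureTheory.integral_const_mul, MeasureTheory.integral_finsetSum _ fun i _ => hint _]
    congr 1
    exact sum_congr rfl fun i hi => (integral_indicator_lt (ha i hi) (haT i hi)).symm
  have h2 : ∑ x ∈ t, w x * b x = ∫ τ in Set.Ioc 0 T,
      ∑ x ∈ t, w x * (Set.Iio (b x)).indicator (fun _ => (1 : ℝ)) τ := by
    rw [MeasureTheory.integral_finsetSum _ fun i _ => (hint _).const_mul _]
    refine sum_congr rfl fun x hx => ?_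
    rw [MeasureTheory.integral_const_mul, integral_indicator_lt (hb x hx) (hbT x hx)]
  rw [h1, h2]
  refine MeasureTheory.setIntegral_mono_on ?_ ?_ measurableSet_Ioc ?_
  · exact (MeasureTheory.integrable_finsetSum _ fun i _ => hint _).const_mul _
  · exact MeasureTheory.integrable_finsetSum _ fun i _ => (hint _).const_mul _
  · intro τ hτ
    have := h τ hτ.1.le
    rw [card_eq_sum_ones, sum_filter, sum_filter] at this
    push_cast at this
    refine (le_of_eq ?_).trans (this.trans (le_of_eq ?_))
    · simp [Set.indicator_apply]
    · simp [Set.indicator_apply]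

/-! ### Packing of spanning trees by multiplicative weights -/

/-- The vertices `ord 0, ord 1, …, ord (K - 1)` are the first ones of a graph on `range n` with edges
where `cap` is positive, in an order in which Prim's algorithm can reach them, through the edges
from `par`. -/
structure IsPrimPrefix (n K : ℕ) (cap : ℕ → ℕ → ℕ) (len : ℕ → ℕ → ℝ) (ord par : ℕ → ℕ) :
    Prop where
  ord_lt : ∀ k < K, ord k < n
  inj : ∀ i < K, ∀ k < K, ord i = ord k → i = k
  par_mem : ∀ k, 0 < k → k < K → ∃ i < k, par (ord k) = ord i
  pos : ∀ k, 0 < k → k < K → 0 < cap (par (ord k)) (ord k)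
  min : ∀ k, 0 < k → k < K → ∀ i < k, ∀ v < n, (∀ j < k, ord j ≠ v) → 0 < cap (ord i) v →
    len (par (ord k)) (ord k) ≤ len (ord i) v

/-- A shortest spanning tree, as found by Prim's algorithm. -/
abbrev IsPrimTree (n : ℕ) (cap : ℕ → ℕ → ℕ) (len : ℕ → ℕ → ℝ) (ord par : ℕ → ℕ) : Prop :=
  IsPrimPrefix n n cap len ord par

section Packing

variable {n : ℕ} {cap : ℕ → ℕ → ℕ} {c : ℕ}

theorem IsPrimTree.par_lt {len : ℕ → ℕ → ℝ} {ord par : ℕ → ℕ} (h : IsPrimTree n cap len ord par)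
    {k : ℕ} (hk : 0 < k) (hkn : k < n) : par (ord k) < n := by
  obtain ⟨i, hi, e⟩ := h.par_mem k hk hkn
  rw [e]
  exact h.ord_lt i (by omega)

/-- A shortest spanning tree is short in comparison with the total length of the graph. -/
theorem IsPrimTree.mul_sum_len_le {len : ℕ → ℕ → ℝ} {ord par : ℕ → ℕ}
    (h : IsPrimTree n cap len ord par) (hcap : ∀ u v, cap u v = cap v u)
    (hlen : ∀ u < n, ∀ v < n, len u v = len v u) (hnn : ∀ u < n, ∀ v < n, 0 ≤ len u v)
    (hcut : ∀ D ⊆ range n, D.Nonempty → D ≠ range n →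
      c ≤ ∑ u ∈ D, ∑ v ∈ range n \ D, cap u v) :
    c * ∑ k ∈ Ico 1 n, len (par (ord k)) (ord k) ≤
      ∑ x ∈ range n ×ˢ range n, (cap x.1 x.2 : ℝ) * len x.1 x.2 := by
  classical
  refine mul_sum_le_of_level_sets _ _ (w := fun x : ℕ × ℕ => (cap x.1 x.2 : ℝ)) ?_ ?_ ?_
  · intro k hk
    rw [mem_Ico] at hk
    exact hnn _ (h.par_lt hk.1 hk.2) _ (h.ord_lt k hk.2)
  · intro x hx
    rw [mem_product, mem_range, mem_range] at hx
    exact hnn _ hx.1 _ hx.2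
  intro τ _
  -- Fix a level τ and call edges of length at most τ short. To each tree edge longer than τ belongs
  -- the component D of its later end with respect to short edges. These components turn out to be
  -- disjoint, and at least c units of capacity leave each of them over long edges.
  set R : ℕ → ℕ → Prop := fun u v => u < n ∧ v < n ∧ 0 < cap u v ∧ len u v ≤ τ with hR
  have hRsymm : ∀ u v, R u v → R v u := fun u v ⟨hu, hv, h1, h2⟩ =>
    ⟨hv, hu, hcap u v ▸ h1, hlen u hu v hv ▸ h2⟩
  have hRTsymm : ∀ u v, Relation.ReflTransGen R u v → Relation.ReflTransGen R v u := by
    intro u v huv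
    induction huv with
    | refl => exact .refl
    | tail _ h1 ih => exact .head (hRsymm _ _ h1) ih
  set K := {k ∈ Ico 1 n | τ < len (par (ord k)) (ord k)} with hK
  set D : ℕ → Finset ℕ := fun k => {w ∈ range n | Relation.ReflTransGen R (ord k) w} with hD
  -- Prim's rule: if the k-th vertex joins over a long edge, no short edge leaves the vertices
  -- reached before.
  have hclosed : ∀ k ∈ K, ∀ u w, (∃ i < k, u = ord i) → Relation.ReflTransGen R u w →
      ∃ i < k, w = ord i := by
    intro k hk u w hu huw
    rw [hK, mem_filter, mem_Ico] at hk
    induction huw with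
    | refl => exact hu
    | @tail a b _ hab ih =>
      obtain ⟨i, hi, rfl⟩ := ih
      by_contra hb
      push Not at hb
      have := h.min k hk.1.1 hk.1.2 i hi b hab.2.1 (fun j hj e => hb j hj e.symm) hab.2.2.1
      have h3 := hab.2.2.2
      linarith [hk.2]
  have hnot : ∀ k ∈ K, ∀ i < k, ∀ w, Relation.ReflTransGen R (ord k) w →
      ¬ Relation.ReflTransGen R (ord i) w := by
    intro k hk i hi w h1 h2
    obtain ⟨j, hj, e⟩ := hclosed k hk _ _ ⟨i, hi, rfl⟩ (h2.trans (hRTsymm _ _ h1))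
    rw [hK, mem_filter, mem_Ico] at hk
    have := h.inj k hk.1.2 j (by omega) e
    omega
  have hdisj : Set.PairwiseDisjoint (K : Set ℕ) D := by
    intro i hi k hk hik
    rw [Function.onFun, disjoint_left]
    intro w h1 h2
    rw [hD, mem_filter] at h1 h2
    rcases lt_or_gt_of_ne hik with h3 | h3
    · exact hnot k hk i h3 w h2.2 h1.2
    · exact hnot i hi k h3 w h1.2 h2.2
  set g : ℕ → ℕ := fun u => ∑ v ∈ range n with τ < len u v, cap u v with hg
  have hDk : ∀ k ∈ K, c ≤ ∑ u ∈ D k, g u := by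
    intro k hk
    have hk' := hk
    rw [hK, mem_filter, mem_Ico] at hk'
    refine (hcut (D k) (filter_subset _ _) ⟨ord k, ?_⟩ ?_).trans ?_
    · rw [hD, mem_filter, mem_range]
      exact ⟨h.ord_lt k hk'.1.2, .refl⟩
    · intro hu
      -- A component equal to the whole vertex set would contain the root, which is reached before
      -- the k-th vertex.
      have h0 : ord 0 ∈ D k := by
        rw [hu, mem_range]
        exact h.ord_lt 0 (by omega)
      rw [hD, mem_filter] at h0
      exact hnot k hk 0 (by omega) _ h0.2 .refl
    · refine sum_le_sum fun u hu => ?_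
      change _ ≤ ∑ v ∈ range n with τ < len u v, cap u v
      rw [sum_filter]
      rw [hD, mem_filter, mem_range] at hu
      refine le_trans (sum_le_sum (g := fun v => if τ < len u v then cap u v else 0) ?_)
        (sum_le_sum_of_subset_of_nonneg sdiff_subset fun _ _ _ => Nat.zero_le _)
      intro v hv
      rw [hD, mem_sdiff, mem_filter, mem_range] at hv
      split_ifs with hl
      · exact le_rfl
      · by_contra hpos
        refine hv.2 ⟨hv.1, hu.2.tail ⟨hu.1, hv.1, by omega, by linarith⟩⟩
  have h1 : c * #K ≤ ∑ u ∈ range n, g u := by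
    calc c * #K = ∑ k ∈ K, c := by rw [sum_const, smul_eq_mul, mul_comm]
      _ ≤ ∑ k ∈ K, ∑ u ∈ D k, g u := sum_le_sum hDk
      _ = ∑ u ∈ K.biUnion D, g u := (sum_biUnion hdisj).symm
      _ ≤ _ := by
        refine sum_le_sum_of_subset_of_nonneg ?_ fun _ _ _ => Nat.zero_le _
        exact biUnion_subset.2 fun k _ => filter_subset _ _
  have h2 : ∑ u ∈ range n, g u = ∑ x ∈ range n ×ˢ range n with τ < len x.1 x.2, cap x.1 x.2 := by
    rw [sum_filter, sum_product]
    simp only [hg, sum_filter]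
  rw [h2] at h1
  exact_mod_cast h1

/-- The total length of the graph for the lengths `Y / cap`. -/
noncomputable def totalLength (n : ℕ) (cap : ℕ → ℕ → ℕ) (Y : ℕ → ℕ → ℝ) : ℝ :=
  ∑ x ∈ range n ×ˢ range n, (cap x.1 x.2 : ℝ) * (Y x.1 x.2 / cap x.1 x.2)

/-- The logarithmic potential of the cut given by the labeling `f`. -/
noncomputable def cutPotential (n : ℕ) (cap : ℕ → ℕ → ℕ) (f : ℕ → ℕ) (Y : ℕ → ℕ → ℝ) : ℝ :=
  ∑ x ∈ range n ×ˢ range n, if f x.1 = f x.2 then 0 else (cap x.1 x.2 : ℝ) * Real.log (Y x.1 x.2)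

/-- The increase of `Y` on the edge from `u` to `v`. -/
noncomputable def bump (cap : ℕ → ℕ → ℕ) (u v : ℕ) (Y : ℕ → ℕ → ℝ) : ℕ → ℕ → ℝ := fun a b =>
  if (a = u ∧ b = v) ∨ (a = v ∧ b = u) then Y a b * (1 + 1 / cap u v) else Y a b

theorem sum_product_two_points {u v : ℕ} (hu : u < n) (hv : v < n) (z : ℝ) :
    ∑ x ∈ range n ×ˢ range n, ((if x = (u, v) then z else 0) + if x = (v, u) then z else 0) =
      2 * z := by
  rw [sum_add_distrib, sum_ite_eq', sum_ite_eq', if_pos (by simp [hu, hv]),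
    if_pos (by simp [hu, hv])]
  ring

theorem totalLength_bump {u v : ℕ} (hu : u < n) (hv : v < n) (huv : u ≠ v)
    (hcap : cap u v = cap v u) (hpos : 0 < cap u v) {Y : ℕ → ℕ → ℝ} (hY : Y u v = Y v u) :
    totalLength n cap (bump cap u v Y) = totalLength n cap Y + 2 * (Y u v / cap u v) := by
  rw [← sum_product_two_points hu hv, totalLength, totalLength, ← sum_add_distrib]
  refine sum_congr rfl fun x _ => ?_
  obtain ⟨a, b⟩ := x
  have hc : (cap u v : ℝ) ≠ 0 := by positivity
  simp only [bump, Prod.mk.injEq]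
  by_cases h1 : a = u ∧ b = v
  · obtain ⟨rfl, rfl⟩ := h1
    simp [huv, Ne.symm huv]
    field_simp
  by_cases h2 : a = v ∧ b = u
  · obtain ⟨rfl, rfl⟩ := h2
    simp [huv, Ne.symm huv, ← hcap, hY]
    field_simp
  simp [h1, h2]

/-- By Bernoulli's inequality (1 + 1/k)^k ≥ 2. Thus the gain of potential from one crossing does not
depend on the capacity. -/
theorem log_two_le_mul_log (k : ℕ) (hk : 0 < k) :
    Real.log 2 ≤ k * Real.log (1 + 1 / (k : ℝ)) := by
  rw [← Real.log_pow]
  refine Real.log_le_log (by norm_num) ?_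
  have h := one_add_mul_le_pow (a := 1 / (k : ℝ)) (le_trans (by norm_num) (by positivity :
    (0 : ℝ) ≤ 1 / (k : ℝ))) k
  have hk' : (k : ℝ) ≠ 0 := by positivity
  rw [mul_one_div_cancel hk'] at h
  linarith

/-- The factor 1 + 1/cap adds cap · log(1 + 1/cap) ≥ log 2 for each of the two orders of the ends,
provided that the edge is cut. -/
theorem cutPotential_bump {u v : ℕ} (hu : u < n) (hv : v < n) (huv : u ≠ v)
    (hcap : cap u v = cap v u) (hpos : 0 < cap u v) {Y : ℕ → ℕ → ℝ}
    (hY : ∀ a < n, ∀ b < n, 0 < Y a b) (f : ℕ → ℕ) :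
    cutPotential n cap f Y + (if f u = f v then 0 else 2 * Real.log 2) ≤
      cutPotential n cap f (bump cap u v Y) := by
  have h2 : cutPotential n cap f (bump cap u v Y) = cutPotential n cap f Y +
      2 * (if f u = f v then 0 else cap u v * Real.log (1 + 1 / (cap u v : ℝ))) := by
    rw [← sum_product_two_points hu hv, cutPotential, cutPotential, ← sum_add_distrib]
    refine sum_congr rfl fun x hx => ?_
    obtain ⟨a, b⟩ := x
    rw [mem_product, mem_range, mem_range] at hx
    have hYab := hY a hx.1 b hx.2
    have hc : (0 : ℝ) < 1 + 1 / cap u v := by positivity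
    simp only [bump, Prod.mk.injEq]
    by_cases h1 : a = u ∧ b = v
    · obtain ⟨rfl, rfl⟩ := h1
      simp only [huv, Ne.symm huv, and_self, or_false, if_true, if_false, add_zero]
      split_ifs
      · simp
      · rw [Real.log_mul hYab.ne' hc.ne']; ring
    by_cases h2 : a = v ∧ b = u
    · obtain ⟨rfl, rfl⟩ := h2
      simp only [huv, Ne.symm huv, and_self, false_or, if_true, if_false, zero_add,
        eq_comm (a := f b)]
      rw [← hcap]
      split_ifs
      · simp
      · rw [Real.log_mul hYab.ne' hc.ne']; ring
    simp [h1, h2]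
  rw [h2]
  have := log_two_le_mul_log _ hpos
  split_ifs <;> linarith

/-- `Y` after the increase on the first `k` edges of a tree. -/
noncomputable def treeBump (cap : ℕ → ℕ → ℕ) (ord par : ℕ → ℕ) (Y : ℕ → ℕ → ℝ) :
    ℕ → ℕ → ℕ → ℝ
  | 0 => Y
  | k + 1 => bump cap (par (ord (k + 1))) (ord (k + 1)) (treeBump cap ord par Y k)

theorem bump_pos {u v : ℕ} {Y : ℕ → ℕ → ℝ} (hY : ∀ a < n, ∀ b < n, 0 < Y a b) :
    ∀ a < n, ∀ b < n, 0 < bump cap u v Y a b := by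
  intro a ha b hb
  have := hY a ha b hb
  unfold bump
  split_ifs <;> positivity

theorem bump_symm {u v : ℕ} {Y : ℕ → ℕ → ℝ} (hY : ∀ a < n, ∀ b < n, Y a b = Y b a) :
    ∀ a < n, ∀ b < n, bump cap u v Y a b = bump cap u v Y b a := by
  intro a ha b hb
  have := hY a ha b hb
  unfold bump
  rw [this]
  congr 1
  apply propext
  tauto

theorem treeBump_pos {ord par : ℕ → ℕ} {Y : ℕ → ℕ → ℝ} (hY : ∀ a < n, ∀ b < n, 0 < Y a b) (k : ℕ) :
    ∀ a < n, ∀ b < n, 0 < treeBump cap ord par Y k a b := by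
  induction k with
  | zero => exact hY
  | succ k ih => exact bump_pos ih

theorem treeBump_symm {ord par : ℕ → ℕ} {Y : ℕ → ℕ → ℝ} (hY : ∀ a < n, ∀ b < n, Y a b = Y b a)
    (k : ℕ) : ∀ a < n, ∀ b < n, treeBump cap ord par Y k a b = treeBump cap ord par Y k b a := by
  induction k with
  | zero => exact hY
  | succ k ih => exact bump_symm ih

theorem IsPrimTree.par_ne {len : ℕ → ℕ → ℝ} {ord par : ℕ → ℕ} (h : IsPrimTree n cap len ord par)
    {k : ℕ} (hk : 0 < k) (hkn : k < n) : par (ord k) ≠ ord k := by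
  obtain ⟨i, hi, e⟩ := h.par_mem k hk hkn
  rw [e]
  intro e'
  have := h.inj i (by omega) k hkn e'
  omega

/-- The first k tree edges only involve vertices up to position k. Hence each tree edge still has
its value from the beginning of the round when its turn comes. -/
theorem IsPrimTree.treeBump_eq {len : ℕ → ℕ → ℝ} {ord par : ℕ → ℕ}
    (h : IsPrimTree n cap len ord par) {Y : ℕ → ℕ → ℝ} {k l : ℕ} (hkl : k < l) (hl : l < n)
    (a : ℕ) : treeBump cap ord par Y k a (ord l) = Y a (ord l) := by
  induction k with
  | zero => rfl
  | succ k ih =>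
    rw [treeBump, bump, if_neg, ih (by omega)]
    rintro (⟨-, e⟩ | ⟨-, e⟩)
    · have := h.inj l hl (k + 1) (by omega) e
      omega
    · obtain ⟨i, hi, e'⟩ := h.par_mem (k + 1) (by omega) (by omega)
      rw [e'] at e
      have := h.inj l hl i (by omega) e
      omega

theorem IsPrimTree.totalLength_treeBump {len : ℕ → ℕ → ℝ} {ord par : ℕ → ℕ}
    (h : IsPrimTree n cap len ord par) (hcap : ∀ u v, cap u v = cap v u)
    {Y : ℕ → ℕ → ℝ} (hY : ∀ a < n, ∀ b < n, Y a b = Y b a) {k : ℕ} (hk : k < n) :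
    totalLength n cap (treeBump cap ord par Y k) = totalLength n cap Y +
      2 * ∑ i ∈ Ico 1 (k + 1), Y (par (ord i)) (ord i) / cap (par (ord i)) (ord i) := by
  induction k with
  | zero => simp [treeBump]
  | succ k ih =>
    have h1 := h.par_lt (k := k + 1) (by omega) hk
    have h2 := h.ord_lt (k + 1) hk
    rw [treeBump, totalLength_bump h1 h2 (h.par_ne (by omega) hk) (hcap _ _)
      (h.pos _ (by omega) hk) (treeBump_symm hY k _ h1 _ h2), ih (by omega),
      h.treeBump_eq (by omega) hk, sum_Ico_succ_top (by omega : 1 ≤ k + 1)]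
    ring

/-- The number of tree edges with differently labeled ends. -/
def treeCrossings (n : ℕ) (ord par f : ℕ → ℕ) : ℕ :=
  #{k ∈ Ico 1 n | f (par (ord k)) ≠ f (ord k)}

theorem IsPrimTree.cutPotential_treeBump {len : ℕ → ℕ → ℝ} {ord par : ℕ → ℕ}
    (h : IsPrimTree n cap len ord par) (hcap : ∀ u v, cap u v = cap v u)
    {Y : ℕ → ℕ → ℝ} (hY : ∀ a < n, ∀ b < n, 0 < Y a b) (f : ℕ → ℕ) {k : ℕ} (hk : k < n) :
    cutPotential n cap f Y + 2 * Real.log 2 * treeCrossings (k + 1) ord par f ≤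
      cutPotential n cap f (treeBump cap ord par Y k) := by
  induction k with
  | zero => simp [treeBump, treeCrossings]
  | succ k ih =>
    have h1 := h.par_lt (k := k + 1) (by omega) hk
    have h2 := h.ord_lt (k + 1) hk
    rw [treeBump]
    refine le_trans ?_ (cutPotential_bump h1 h2 (h.par_ne (by omega) hk) (hcap _ _)
      (h.pos _ (by omega) hk) (treeBump_pos hY k) f)
    have h3 := ih (by omega)
    have h4 : (treeCrossings (k + 1 + 1) ord par f : ℝ) = treeCrossings (k + 1) ord par f +
        if f (par (ord (k + 1))) = f (ord (k + 1)) then 0 else 1 := by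
      simp only [treeCrossings, card_filter]
      rw [sum_Ico_succ_top (by omega : 1 ≤ k + 1)]
      push_cast
      congr 1
      split_ifs <;> simp_all
    rw [h4]
    split_ifs at h4 ⊢ <;> linarith

/-- One round of the packing of trees. -/
theorem IsPrimTree.totalLength_round {ord par : ℕ → ℕ} {Y : ℕ → ℕ → ℝ}
    (h : IsPrimTree n cap (fun u v => Y u v / cap u v) ord par)
    (hcap : ∀ u v, cap u v = cap v u) (hn : 0 < n) (hc : 0 < c)
    (hcut : ∀ D ⊆ range n, D.Nonempty → D ≠ range n →
      c ≤ ∑ u ∈ D, ∑ v ∈ range n \ D, cap u v)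
    (hY : ∀ a < n, ∀ b < n, 0 < Y a b) (hYs : ∀ a < n, ∀ b < n, Y a b = Y b a) :
    totalLength n cap (treeBump cap ord par Y (n - 1)) ≤ totalLength n cap Y * (1 + 2 / c) := by
  rw [h.totalLength_treeBump hcap hYs (by omega), Nat.sub_add_cancel hn]
  -- The shortest tree has at most the fraction 1/c of the total length. The round adds twice the
  -- tree length, once for each order of the ends.
  have h1 := h.mul_sum_len_le hcap (fun u hu v hv => by rw [hYs u hu v hv, hcap])
    (fun u hu v hv => div_nonneg (hY u hu v hv).le (by positivity)) hcut
  have hc' : (0 : ℝ) < c := by exact_mod_cast hc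
  rw [← le_div_iff₀' hc'] at h1
  have h2 : totalLength n cap Y * (1 + 2 / c) = totalLength n cap Y +
    2 * ((∑ x ∈ range n ×ˢ range n, (cap x.1 x.2 : ℝ) * (Y x.1 x.2 / cap x.1 x.2)) / c) := by
    rw [totalLength]; ring
  rw [h2]
  gcongr

/-- Where the capacity is positive, Y is one of the summands cap · (Y / cap) of the total length;
where it is 0, nothing is contributed. -/
theorem cutPotential_le {Y : ℕ → ℕ → ℝ} (hY : ∀ a < n, ∀ b < n, 0 < Y a b) (f : ℕ → ℕ) :
    cutPotential n cap f Y ≤ (∑ x ∈ range n ×ˢ range n with f x.1 ≠ f x.2, (cap x.1 x.2 : ℝ)) *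
      Real.log (totalLength n cap Y) := by
  rw [cutPotential, sum_mul, sum_filter]
  refine sum_le_sum fun x hx => ?_
  by_cases hf : f x.1 = f x.2
  · simp [hf]
  simp only [hf, if_false, ne_eq, not_false_eq_true, if_true]
  rcases Nat.eq_zero_or_pos (cap x.1 x.2) with h0 | h0
  · simp [h0]
  refine mul_le_mul_of_nonneg_left ?_ (by positivity)
  have hx' := hx
  rw [mem_product, mem_range, mem_range] at hx'
  refine Real.log_le_log (hY _ hx'.1 _ hx'.2) ?_
  have h1 := single_le_sum (f := fun x : ℕ × ℕ => (cap x.1 x.2 : ℝ) *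
    (Y x.1 x.2 / cap x.1 x.2)) (fun y hy => by
      rw [mem_product, mem_range, mem_range] at hy
      have := hY _ hy.1 _ hy.2
      positivity) hx
  refine le_trans (le_of_eq ?_) h1
  have : (cap x.1 x.2 : ℝ) ≠ 0 := by positivity
  field_simp

/-- After sufficiently many rounds, the potential of a small cut is not as large as it would be if
all trees had crossed it often. -/
theorem lt_sum_cap_of_potential {Y : ℕ → ℕ → ℝ} {α N : ℕ} (hn : 0 < n) (hc : 0 < c) (hα : 0 < α)
    (hY : ∀ a < n, ∀ b < n, 0 < Y a b) (f : ℕ → ℕ)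
    (hpos : 0 < totalLength n cap Y)
    (hlen : totalLength n cap Y ≤ n ^ 2 * (1 + 2 / (c : ℝ)) ^ N)
    (hpot : 2 * Real.log 2 * (4 * α) * N ≤ cutPotential n cap f Y) (hN : 4 * (c * n) < N) :
    2 * (α * c) < ∑ x ∈ range n ×ˢ range n with f x.1 ≠ f x.2, cap x.1 x.2 := by
  by_contra hle
  push Not at hle
  have hc' : (0 : ℝ) < c := by exact_mod_cast hc
  have hα' : (0 : ℝ) < α := by exact_mod_cast hα
  have hn' : (0 : ℝ) < n := by exact_mod_cast hn
  have hle' : (∑ x ∈ range n ×ˢ range n with f x.1 ≠ f x.2, (cap x.1 x.2 : ℝ)) ≤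
      2 * (α * c) := by exact_mod_cast hle
  have h1 := hpot.trans (cutPotential_le hY f)
  have h2 : Real.log (totalLength n cap Y) ≤ 2 * n + N * (2 / c) := by
    refine (Real.log_le_log hpos hlen).trans ?_
    rw [Real.log_mul (by positivity) (by positivity), Real.log_pow, Real.log_pow]
    have h3 := Real.log_le_sub_one_of_pos hn'
    have h4 := Real.log_le_sub_one_of_pos (by positivity : (0 : ℝ) < 1 + 2 / c)
    push_cast
    have h5 : (N : ℝ) * Real.log (1 + 2 / c) ≤ N * (2 / c) :=
      mul_le_mul_of_nonneg_left (by linarith) (by positivity)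
    linarith
  -- If the labeling had at most αc cut edges (2αc in ordered pairs), its potential would be at most
  -- 2αc(2n + 2N/c) = α(4cn + 4N).
  have h3 : 2 * Real.log 2 * (4 * α) * N ≤ 2 * (α * c) * (2 * n + N * (2 / c)) := by
    refine h1.trans ((mul_le_mul_of_nonneg_left h2 (sum_nonneg fun _ _ => by positivity)).trans ?_)
    exact mul_le_mul_of_nonneg_right hle' (by positivity)
  have h4 : 2 * ((α : ℝ) * c) * (2 * n + N * (2 / c)) = α * (4 * (c * n) + 4 * N) := by
    field_simp; ring
  rw [h4] at h3
  have h5 : 2 * Real.log 2 * (4 * α) * N = α * (8 * Real.log 2 * N) := by ring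
  rw [h5] at h3
  have h6 := le_of_mul_le_mul_left h3 hα'
  -- Dividing by α leaves 8N log 2 ≤ 4cn + 4N < 5N, but 8 log 2 > 5.
  have h7 := Real.log_two_gt_d9
  have h8 : (4 * (c * n) : ℝ) < N := by exact_mod_cast hN
  have h9 : (0 : ℝ) < N := lt_of_le_of_lt (by positivity) h8
  nlinarith

end Packing

/-! ### Edge multiplicities as capacities -/

namespace Network

variable {n m : ℕ}

/-- The number of edges between `u` and `v` (twice the number of loops if `u = v`). -/
def multiplicity (G : Network n m) (u v : ℕ) : ℕ :=
  #{e | (((G.ends e).1 : ℕ), ((G.ends e).2 : ℕ)) = (u, v)} +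
    #{e | (((G.ends e).2 : ℕ), ((G.ends e).1 : ℕ)) = (u, v)}

theorem multiplicity_comm (G : Network n m) (u v : ℕ) :
    G.multiplicity u v = G.multiplicity v u := by
  simp only [multiplicity, Prod.mk.injEq]
  rw [add_comm]
  congr 3 <;> (ext; tauto)

theorem sum_multiplicity (G : Network n m) (s : Finset (ℕ × ℕ)) :
    ∑ x ∈ s, G.multiplicity x.1 x.2 =
      #{e | (((G.ends e).1 : ℕ), ((G.ends e).2 : ℕ)) ∈ s} +
      #{e | (((G.ends e).2 : ℕ), ((G.ends e).1 : ℕ)) ∈ s} := by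
  have key : ∀ g : Fin m → ℕ × ℕ, ∑ x ∈ s, #{e | g e = (x.1, x.2)} = #{e | g e ∈ s} := by
    intro g
    simp only [card_filter]
    rw [sum_comm]
    refine sum_congr rfl fun e _ => ?_
    simp
  simp only [multiplicity, sum_add_distrib, key]

/-- Each edge of the cut is counted once, in the direction from D to its complement. -/
theorem minCut_le_sum_multiplicity (G : Network n m) (D : Finset ℕ) (hD : D ⊆ range n)
    (hD0 : D.Nonempty) (hDn : D ≠ range n) :
    G.minCut ≤ ∑ u ∈ D, ∑ v ∈ range n \ D, G.multiplicity u v := by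
  rw [← sum_product' D (range n \ D) (fun u v => G.multiplicity u v), sum_multiplicity]
  refine (G.minCut_le (A := {v | (v : ℕ) ∈ D}) ?_ ?_).trans ?_
  · obtain ⟨u, hu⟩ := hD0
    exact ⟨⟨u, mem_range.1 (hD hu)⟩, by simpa using hu⟩
  · intro h
    apply hDn
    refine hD.antisymm fun u hu => ?_
    have : (⟨u, mem_range.1 hu⟩ : Fin n) ∈ ({v | (v : ℕ) ∈ D} : Finset (Fin n)) := by
      rw [h]; exact mem_univ _
    simpa using this
  · rw [cutValue, ← card_union_of_disjoint]
    · refine card_le_card fun e he => ?_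
      simp only [mem_filter, mem_univ, true_and] at he
      simp only [mem_union, mem_filter, mem_univ, true_and, mem_product, mem_sdiff, mem_range,
        Fin.is_lt]
      tauto
    · rw [disjoint_left]
      intro e h1 h2
      simp only [mem_filter, mem_univ, true_and, mem_product, mem_sdiff] at h1 h2
      exact h1.2.2 h2.1

theorem sum_multiplicity_cut (G : Network n m) (f : ℕ → ℕ) :
    ∑ x ∈ range n ×ˢ range n with f x.1 ≠ f x.2, G.multiplicity x.1 x.2 =
      2 * #(G.cutEdges fun v => f v) := by
  rw [sum_multiplicity, two_mul]
  congr 2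
  · ext e; simp [cutEdges]
  · ext e; simp [cutEdges, eq_comm]

/-- Single vertices are cuts, and the degrees sum to at most 2m. Consequently 8m + 1 rounds exceed
4cn, although the program never computes c. -/
theorem minCut_mul_le (G : Network n m) (hn : 2 ≤ n) : G.minCut * n ≤ 2 * m := by
  calc G.minCut * n = ∑ v : Fin n, G.minCut := by simp [mul_comm]
    _ ≤ ∑ v : Fin n, G.cutValue {v} := by
      refine sum_le_sum fun v _ => G.minCut_le (singleton_nonempty v) fun h => ?_
      have : #({v} : Finset (Fin n)) = n := by rw [h]; simp
      simp at this
      omega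
    _ ≤ ∑ v : Fin n, ∑ e : Fin m, ((if v = (G.ends e).1 then 1 else 0) +
        if v = (G.ends e).2 then 1 else 0) := by
      refine sum_le_sum fun v _ => ?_
      rw [cutValue, card_filter]
      refine sum_le_sum fun e _ => ?_
      simp only [mem_singleton, eq_comm (b := v)]
      split_ifs <;> simp_all
    _ = 2 * m := by
      rw [sum_comm]
      simp [sum_add_distrib, mul_comm]

end Network

/-! ### A structured language and its compilation -/

namespace RealRAM

/-- `P`, started in `s`, halts after at most `T` steps in a state with the property `Q`. -/
def Runs (P : Program) (s : State) (T : ℕ) (Q : State → Prop) : Prop :=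
  ∃ t s', Exec P s t s' ∧ t ≤ T ∧ Q s'

theorem Runs.mono {P : Program} {s : State} {T T' : ℕ} {Q Q' : State → Prop} (h : Runs P s T Q)
    (hT : T ≤ T') (hQ : ∀ s, Q s → Q' s) : Runs P s T' Q' := by
  obtain ⟨t, s', h1, h2, h3⟩ := h
  exact ⟨t, s', h1, h2.trans hT, hQ s' h3⟩

theorem Runs.seq {P P' : Program} {s : State} {T T' : ℕ} {Q Q' : State → Prop}
    (h : Runs P s T Q) (h' : ∀ s', Q s' → Runs P' s' T' Q') :
    Runs (.seq P P') s (T + T') Q' := by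
  obtain ⟨t, s', h1, h2, h3⟩ := h
  obtain ⟨t', s'', h4, h5, h6⟩ := h' s' h3
  exact ⟨t + t', s'', .seq h1 h4, by omega, h6⟩

theorem Runs.op {o : Op} {s : State} {Q : State → Prop} (h : Q (o.apply s)) :
    Runs (.op o) s 1 Q :=
  ⟨1, _, .op o s, le_rfl, h⟩

theorem Runs.ite {b : Test} {P P' : Program} {s : State} {T : ℕ} {Q : State → Prop}
    (h : b.Holds s → Runs P s T Q) (h' : ¬ b.Holds s → Runs P' s T Q) :
    Runs (.ite b P P') s (T + 1) Q := by
  by_cases hb : b.Holds s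
  · obtain ⟨t, s', h1, h2, h3⟩ := h hb
    exact ⟨t + 1, s', .iteTrue hb h1, by omega, h3⟩
  · obtain ⟨t, s', h1, h2, h3⟩ := h' hb
    exact ⟨t + 1, s', .iteFalse hb h1, by omega, h3⟩

/-- A loop that is run exactly `j` times, with the invariant `I`. -/
theorem Runs.loop {b : Test} {P : Program} {T : ℕ} (I : ℕ → State → Prop) (j : ℕ)
    (hb : ∀ k < j, ∀ s, I k s → b.Holds s) (hj : ∀ s, I j s → ¬ b.Holds s)
    (hP : ∀ k < j, ∀ s, I k s → Runs P s T (I (k + 1))) {s : State} (hs : I 0 s) :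
    Runs (.loop b P) s (j * (T + 1) + 1) (I j) := by
  have key : ∀ i ≤ j, ∀ s, I (j - i) s → Runs (.loop b P) s (i * (T + 1) + 1) (I j) := by
    intro i
    induction i with
    | zero => exact fun _ s hs => ⟨1, s, .loopStop (hj s hs), by omega, hs⟩
    | succ i ih =>
      intro hi s hs
      obtain ⟨t, s', h1, h2, h3⟩ := hP _ (by omega) s hs
      rw [show j - (i + 1) + 1 = j - i by omega] at h3
      obtain ⟨u, s'', h4, h5, h6⟩ := ih (by omega) s' h3
      refine ⟨t + u + 1, s'', .loopStep (hb _ (by omega) s hs) h1 h4, ?_, h6⟩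
      rw [Nat.succ_mul]; omega
  exact key j le_rfl s (by simpa using hs)

/-! A language with variables, arrays, expressions and bounded loops. -/

/-- A state of the structured language: variables and arrays for natural and for real numbers, and
an input array that is only read. -/
structure HState where
  inp : ℕ → ℕ
  nv : ℕ → ℕ
  na : Fin 8 → ℕ → ℕ
  rv : ℕ → ℝ
  ra : Fin 8 → ℕ → ℝ

inductive NExp where
  | lit (k : ℕ)
  | var (i : ℕ)
  | add (e f : NExp)
  | sub (e f : NExp)
  | get (a : Fin 8) (e : NExp)
  | inp (e : NExp)

inductive RExp where
  | var (i : ℕ)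
  | cast (e : NExp)
  | add (e f : RExp)
  | sub (e f : RExp)
  | mul (e f : RExp)
  | div (e f : RExp)
  | get (a : Fin 8) (e : NExp)

inductive Cond where
  | lt (e f : NExp)
  | eq (e f : NExp)
  | rlt (e f : RExp)

inductive Cmd where
  | skip
  | setN (i : ℕ) (e : NExp)
  | setA (a : Fin 8) (e f : NExp)
  | setR (i : ℕ) (e : RExp)
  | setRA (a : Fin 8) (e : NExp) (f : RExp)
  | seq (c d : Cmd)
  | ite (b : Cond) (c d : Cmd)
  | loop (x y : ℕ) (c : Cmd)

def NExp.eval (σ : HState) : NExp → ℕ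
  | lit k => k
  | var i => σ.nv i
  | add e f => e.eval σ + f.eval σ
  | sub e f => e.eval σ - f.eval σ
  | get a e => σ.na a (e.eval σ)
  | inp e => σ.inp (e.eval σ)

noncomputable def RExp.eval (σ : HState) : RExp → ℝ
  | var i => σ.rv i
  | cast e => (e.eval σ : ℝ)
  | add e f => e.eval σ + f.eval σ
  | sub e f => e.eval σ - f.eval σ
  | mul e f => e.eval σ * f.eval σ
  | div e f => e.eval σ / f.eval σ
  | get a e => σ.ra a (e.eval σ)

def Cond.Holds (σ : HState) : Cond → Prop
  | lt e f => e.eval σ < f.eval σ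
  | eq e f => e.eval σ = f.eval σ
  | rlt e f => e.eval σ < f.eval σ

namespace HState

def setN (σ : HState) (i k : ℕ) : HState :=
  { σ with nv := Function.update σ.nv i k }

def setA (σ : HState) (a : Fin 8) (i k : ℕ) : HState :=
  { σ with na := Function.update σ.na a (Function.update (σ.na a) i k) }

noncomputable def setR (σ : HState) (i : ℕ) (z : ℝ) : HState :=
  { σ with rv := Function.update σ.rv i z }

noncomputable def setRA (σ : HState) (a : Fin 8) (i : ℕ) (z : ℝ) : HState :=
  { σ with ra := Function.update σ.ra a (Function.update (σ.ra a) i z) }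

end HState

/-- `f (k - 1) (… (f 1 (f 0 σ)))`. -/
def iterate {α : Type*} (f : ℕ → α → α) : ℕ → α → α
  | 0, σ => σ
  | k + 1, σ => f k (iterate f k σ)

open Classical in
/-- The state in which a command ends. The loop `loop x y c` runs `c` for `x = 0, 1, …` as long as
`x < y`. -/
noncomputable def Cmd.run : Cmd → HState → HState
  | skip, σ => σ
  | setN i e, σ => σ.setN i (e.eval σ)
  | setA a e f, σ => σ.setA a (e.eval σ) (f.eval σ)
  | setR i e, σ => σ.setR i (e.eval σ)
  | setRA a e f, σ => σ.setRA a (e.eval σ) (f.eval σ)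
  | seq c d, σ => d.run (c.run σ)
  | ite b c d, σ => if b.Holds σ then c.run σ else d.run σ
  | loop x y c, σ => (iterate (fun k τ => c.run (τ.setN x k)) (σ.nv y) σ).setN x (σ.nv y)

namespace Cmd

/-- The command may change the variable `i`. -/
def modN : Cmd → ℕ → Bool
  | setN j _, i => i == j
  | seq c d, i => c.modN i || d.modN i
  | ite _ c d, i => c.modN i || d.modN i
  | loop x _ c, i => i == x || c.modN i
  | _, _ => false

/-- The command may change the array `a`. -/
def modA : Cmd → Fin 8 → Bool
  | setA b _ _, a => a == b
  | seq c d, a => c.modA a || d.modA a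
  | ite _ c d, a => c.modA a || d.modA a
  | loop _ _ c, a => c.modA a
  | _, _ => false

/-- The command may change the real variable `i`. -/
def modR : Cmd → ℕ → Bool
  | setR j _, i => i == j
  | seq c d, i => c.modR i || d.modR i
  | ite _ c d, i => c.modR i || d.modR i
  | loop _ _ c, i => c.modR i
  | _, _ => false

/-- The command may change the real array `a`. -/
def modRA : Cmd → Fin 8 → Bool
  | setRA b _ _, a => a == b
  | seq c d, a => c.modRA a || d.modRA a
  | ite _ c d, a => c.modRA a || d.modRA a
  | loop _ _ c, a => c.modRA a
  | _, _ => false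

theorem iterate_preserves {α β : Type*} (g : α → β) (f : ℕ → α → α) (k : ℕ) (σ : α)
    (h : ∀ k τ, g (f k τ) = g τ) : g (iterate f k σ) = g σ := by
  induction k with
  | zero => rfl
  | succ k ih => rw [iterate, h, ih]

theorem run_inp (c : Cmd) (σ : HState) : (c.run σ).inp = σ.inp := by
  induction c generalizing σ with
  | skip | setN | setA | setR | setRA => rfl
  | seq c d hc hd => rw [run, hd, hc]
  | ite b c d hc hd =>
    rw [run]
    split_ifs
    · exact hc σ
    · exact hd σ
  | loop x y c hc =>
    rw [run]
    exact iterate_preserves (fun τ : HState => τ.inp) _ _ _ fun k τ => hc _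

theorem run_nv {c : Cmd} {i : ℕ} (h : c.modN i = false) (σ : HState) :
    (c.run σ).nv i = σ.nv i := by
  induction c generalizing σ with
  | skip | setA | setR | setRA => rfl
  | setN j e =>
    simp only [modN, beq_eq_false_iff_ne] at h
    simp [run, HState.setN, h]
  | seq c d hc hd =>
    simp only [modN, Bool.or_eq_false_iff] at h
    rw [run, hd h.2, hc h.1]
  | ite b c d hc hd =>
    simp only [modN, Bool.or_eq_false_iff] at h
    rw [run]
    split_ifs
    · exact hc h.1 σ
    · exact hd h.2 σ
  | loop x y c hc =>
    simp only [modN, Bool.or_eq_false_iff, beq_eq_false_iff_ne] at h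
    have := iterate_preserves (fun τ : HState => τ.nv i) (fun k τ => c.run (τ.setN x k)) (σ.nv y) σ
      (fun k τ => by
        rw [hc h.2]
        simp [HState.setN, h.1])
    rw [run]
    simpa [HState.setN, h.1] using this

theorem run_na {c : Cmd} {a : Fin 8} (h : c.modA a = false) (σ : HState) :
    (c.run σ).na a = σ.na a := by
  induction c generalizing σ with
  | skip | setN | setR | setRA => rfl
  | setA j e =>
    simp only [modA, beq_eq_false_iff_ne] at h
    simp [run, HState.setA, h]
  | seq c d hc hd =>
    simp only [modA, Bool.or_eq_false_iff] at h
    rw [run, hd h.2, hc h.1]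
  | ite b c d hc hd =>
    simp only [modA, Bool.or_eq_false_iff] at h
    rw [run]
    split_ifs
    · exact hc h.1 σ
    · exact hd h.2 σ
  | loop x y c hc =>
    exact iterate_preserves (fun τ : HState => τ.na a) (fun k τ => c.run (τ.setN x k)) (σ.nv y) σ
      (fun k τ => hc h _)

theorem run_rv {c : Cmd} {i : ℕ} (h : c.modR i = false) (σ : HState) :
    (c.run σ).rv i = σ.rv i := by
  induction c generalizing σ with
  | skip | setN | setA | setRA => rfl
  | setR j e =>
    simp only [modR, beq_eq_false_iff_ne] at h
    simp [run, HState.setR, h]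
  | seq c d hc hd =>
    simp only [modR, Bool.or_eq_false_iff] at h
    rw [run, hd h.2, hc h.1]
  | ite b c d hc hd =>
    simp only [modR, Bool.or_eq_false_iff] at h
    rw [run]
    split_ifs
    · exact hc h.1 σ
    · exact hd h.2 σ
  | loop x y c hc =>
    exact iterate_preserves (fun τ : HState => τ.rv i) (fun k τ => c.run (τ.setN x k)) (σ.nv y) σ
      (fun k τ => hc h _)

theorem run_ra {c : Cmd} {a : Fin 8} (h : c.modRA a = false) (σ : HState) :
    (c.run σ).ra a = σ.ra a := by
  induction c generalizing σ with
  | skip | setN | setR | setA => rfl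
  | setRA j e =>
    simp only [modRA, beq_eq_false_iff_ne] at h
    simp [run, HState.setRA, h]
  | seq c d hc hd =>
    simp only [modRA, Bool.or_eq_false_iff] at h
    rw [run, hd h.2, hc h.1]
  | ite b c d hc hd =>
    simp only [modRA, Bool.or_eq_false_iff] at h
    rw [run]
    split_ifs
    · exact hc h.1 σ
    · exact hd h.2 σ
  | loop x y c hc =>
    exact iterate_preserves (fun τ : HState => τ.ra a) (fun k τ => c.run (τ.setN x k)) (σ.nv y) σ
      (fun k τ => hc h _)

/-- The bounds of the loops are not changed by commands with write set `W`, and a loop changes its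
counter only by counting. -/
def wf (W : ℕ → Bool) : Cmd → Bool
  | seq c d => c.wf W && d.wf W
  | ite _ c d => c.wf W && d.wf W
  | loop x y c => !(W y) && !(c.modN x) && (x != y) && c.wf W
  | _ => true

end Cmd

/-! Compilation. The variable `i` is kept in the register `2 * i`, the address of the first cell
after the input in the register `1`; the other registers are used for intermediate
results: those for natural numbers from `3` and those for real numbers from `1` on. -/

/-- Replace the index in the temporary register `2 * d + 3` by its position among the cells of all
arrays. -/
def arrayIndex (a : Fin 8) (d : ℕ) : Program :=
  .seq (.op (.const (2 * (d + 1) + 3) a)) <|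
  .seq (.op (.add (2 * d + 3) (2 * d + 3) (2 * d + 3))) <|
  .seq (.op (.add (2 * d + 3) (2 * d + 3) (2 * d + 3))) <|
  .seq (.op (.add (2 * d + 3) (2 * d + 3) (2 * d + 3))) <|
  .op (.add (2 * d + 3) (2 * d + 3) (2 * (d + 1) + 3))

/-- At depth d the result is left in register 2d + 3, while smaller temporaries stay intact. In the
absence of a move operation a variable is copied by adding 0. Reading the input beyond its end
yields 0, since the arrays begin there. -/
def NExp.compile : NExp → ℕ → Program
  | lit k, d => .op (.const (2 * d + 3) k)
  | var i, d => .seq (.op (.const (2 * d + 3) 0)) (.op (.add (2 * d + 3) (2 * i) (2 * d + 3)))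
  | add e f, d => .seq (e.compile d) <| .seq (f.compile (d + 1)) <|
      .op (.add (2 * d + 3) (2 * d + 3) (2 * (d + 1) + 3))
  | sub e f, d => .seq (e.compile d) <| .seq (f.compile (d + 1)) <|
      .op (.sub (2 * d + 3) (2 * d + 3) (2 * (d + 1) + 3))
  | get a e, d => .seq (e.compile d) <| .seq (arrayIndex a d) <|
      .seq (.op (.add (2 * d + 3) (2 * d + 3) 1)) (.op (.load (2 * d + 3) (2 * d + 3)))
  | inp e, d => .seq (e.compile d) <|
      .ite (.lt (2 * d + 3) 1) (.op (.load (2 * d + 3) (2 * d + 3))) (.op (.const (2 * d + 3) 0))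

def NExp.cost : NExp → ℕ
  | lit _ => 1
  | var _ => 2
  | add e f => e.cost + f.cost + 1
  | sub e f => e.cost + f.cost + 1
  | get _ e => e.cost + 7
  | inp e => e.cost + 2

/-- The result goes to real register 2d + 1. Natural temporaries are free for reuse at every depth,
as no intermediate real result depends on them. -/
def RExp.compile : RExp → ℕ → Program
  | var i, d => .seq (.op (.const (2 * 0 + 3) 0)) <| .seq (.op (.rcast (2 * d + 1) (2 * 0 + 3))) <|
      .op (.radd (2 * d + 1) (2 * i) (2 * d + 1))
  | cast e, d => .seq (e.compile 0) (.op (.rcast (2 * d + 1) (2 * 0 + 3)))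
  | add e f, d => .seq (e.compile d) <| .seq (f.compile (d + 1)) <|
      .op (.radd (2 * d + 1) (2 * d + 1) (2 * (d + 1) + 1))
  | sub e f, d => .seq (e.compile d) <| .seq (f.compile (d + 1)) <|
      .op (.rsub (2 * d + 1) (2 * d + 1) (2 * (d + 1) + 1))
  | mul e f, d => .seq (e.compile d) <| .seq (f.compile (d + 1)) <|
      .op (.rmul (2 * d + 1) (2 * d + 1) (2 * (d + 1) + 1))
  | div e f, d => .seq (e.compile d) <| .seq (f.compile (d + 1)) <|
      .op (.rdiv (2 * d + 1) (2 * d + 1) (2 * (d + 1) + 1))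
  | get a e, d => .seq (e.compile 0) <| .seq (arrayIndex a 0) (.op (.rload (2 * d + 1) (2 * 0 + 3)))

def RExp.cost : RExp → ℕ
  | var _ => 3
  | cast e => e.cost + 1
  | add e f => e.cost + f.cost + 1
  | sub e f => e.cost + f.cost + 1
  | mul e f => e.cost + f.cost + 1
  | div e f => e.cost + f.cost + 1
  | get _ e => e.cost + 6

def Cond.compile (P P' : Program) : Cond → Program
  | lt e f => .seq (e.compile 0) <| .seq (f.compile 1) <| .ite (.lt (2 * 0 + 3) (2 * 1 + 3)) P P'
  | eq e f => .seq (e.compile 0) <| .seq (f.compile 1) <| .ite (.eq (2 * 0 + 3) (2 * 1 + 3)) P P'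
  | rlt e f => .seq (e.compile 0) <| .seq (f.compile 1) <| .ite (.rlt (2 * 0 + 1) (2 * 1 + 1)) P P'

def Cond.cost : Cond → ℕ
  | lt e f => e.cost + f.cost + 1
  | eq e f => e.cost + f.cost + 1
  | rlt e f => e.cost + f.cost + 1

/-- In `setRA` the value is computed before the index, because evaluating a real expression may
overwrite natural temporaries. -/
def Cmd.compile : Cmd → Program
  | skip => .skip
  | setN i e => .seq (e.compile 0) <| .seq (.op (.const (2 * 1 + 3) 0)) <|
      .op (.add (2 * i) (2 * 0 + 3) (2 * 1 + 3))
  | setA a e f => .seq (e.compile 0) <| .seq (arrayIndex a 0) <|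
      .seq (.op (.add (2 * 0 + 3) (2 * 0 + 3) 1)) <| .seq (f.compile 1) <| .op (.store (2 * 0 + 3) (2 * 1 + 3))
  | setR i e => .seq (e.compile 0) <| .seq (.op (.const (2 * 0 + 3) 0)) <|
      .seq (.op (.rcast (2 * 1 + 1) (2 * 0 + 3))) <| .op (.radd (2 * i) (2 * 0 + 1) (2 * 1 + 1))
  | setRA a e f => .seq (f.compile 0) <| .seq (e.compile 0) <| .seq (arrayIndex a 0) <|
      .op (.rstore (2 * 0 + 3) (2 * 0 + 1))
  | seq c d => .seq c.compile d.compile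
  | ite b c d => b.compile c.compile d.compile
  | loop x y c => .seq (.op (.const (2 * x) 0)) <| .loop (.lt (2 * x) (2 * y)) <|
      .seq c.compile <| .seq (.op (.const (2 * 0 + 3) 1)) <| .op (.add (2 * x) (2 * x) (2 * 0 + 3))

/-- A bound for the number of steps in terms of the values of the variables. -/
def Cmd.bound : Cmd → (ℕ → ℕ) → ℕ
  | skip, _ => 1
  | setN _ e, _ => e.cost + 2
  | setA _ e f, _ => e.cost + f.cost + 7
  | setR _ e, _ => e.cost + 3
  | setRA _ e f, _ => e.cost + f.cost + 6
  | seq c d, ν => c.bound ν + d.bound ν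
  | ite b c d, ν => b.cost + max (c.bound ν) (d.bound ν)
  | loop _ y c, ν => ν y * (c.bound ν + 3) + 2

/-- The state `s` of the machine represents `σ`, with the arrays beginning at the address `b`. -/
structure Rep (b : ℕ) (σ : HState) (s : State) : Prop where
  base : s.nreg 1 = b
  nv : ∀ i, s.nreg (2 * i) = σ.nv i
  inp : ∀ a < b, s.nmem a = σ.inp a
  inp_zero : ∀ a, b ≤ a → σ.inp a = 0
  na : ∀ (a : Fin 8) i, s.nmem (8 * i + a + b) = σ.na a i
  rv : ∀ i, s.rreg (2 * i) = σ.rv i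
  ra : ∀ (a : Fin 8) i, s.rmem (8 * i + a) = σ.ra a i

/-- Only natural temporary registers from number `d` on have changed. -/
structure KeepN (d : ℕ) (s s' : State) : Prop where
  nreg : ∀ j, j % 2 = 0 ∨ j < 2 * d + 3 → s'.nreg j = s.nreg j
  nmem : s'.nmem = s.nmem
  rreg : s'.rreg = s.rreg
  rmem : s'.rmem = s.rmem

theorem KeepN.refl (d : ℕ) (s : State) : KeepN d s s := ⟨fun _ _ => rfl, rfl, rfl, rfl⟩

theorem KeepN.trans {d d' : ℕ} {s s' s'' : State} (h : KeepN d s s') (h' : KeepN d' s' s'')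
    (hd : d ≤ d') : KeepN d s s'' :=
  ⟨fun j hj => (h'.nreg j (by omega)).trans (h.nreg j hj), h'.nmem.trans h.nmem,
    h'.rreg.trans h.rreg, h'.rmem.trans h.rmem⟩

theorem KeepN.rep {b d : ℕ} {σ : HState} {s s' : State} (h : KeepN d s s') (hs : Rep b σ s) :
    Rep b σ s' where
  base := (h.nreg 1 (by omega)).trans hs.base
  nv i := (h.nreg _ (by omega)).trans (hs.nv i)
  inp := by rw [h.nmem]; exact hs.inp
  inp_zero := hs.inp_zero
  na := by rw [h.nmem]; exact hs.na
  rv := by rw [h.rreg]; exact hs.rv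
  ra := by rw [h.rmem]; exact hs.ra

/-- The state `s` with the natural register `j` set to `v`. -/
def State.setN (s : State) (j v : ℕ) : State := { s with nreg := Function.update s.nreg j v }

/-- The state `s` with the real register `j` set to `v`. -/
noncomputable def State.setR (s : State) (j : ℕ) (v : ℝ) : State :=
  { s with rreg := Function.update s.rreg j v }

theorem KeepN.setN {d j : ℕ} {s s' : State} (h : KeepN d s s') (v : ℕ) (h1 : j % 2 = 1)
    (h2 : 2 * d + 3 ≤ j) : KeepN d s (s'.setN j v) :=
  ⟨fun i hi => (Function.update_of_ne (by omega) _ _).trans (h.nreg i hi), h.nmem, h.rreg, h.rmem⟩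

theorem runs_arrayIndex (a : Fin 8) (d : ℕ) (s : State) :
    Runs (arrayIndex a d) s 5 fun s' => KeepN d s s' ∧
      s'.nreg (2 * d + 3) = 8 * s.nreg (2 * d + 3) + a := by
  refine ⟨_, _, .seq (.op _ _) (.seq (.op _ _) (.seq (.op _ _) (.seq (.op _ _) (.op _ _)))),
    le_rfl, ?_, ?_⟩
  · exact ((((((KeepN.refl d s).setN (j := 2 * (d + 1) + 3) a (by omega) (by omega)).setN
      (j := 2 * d + 3) _ (by omega) (by omega)).setN (j := 2 * d + 3) _ (by omega) (by omega)).setN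
      (j := 2 * d + 3) _ (by omega) (by omega)).setN (j := 2 * d + 3) _ (by omega) (by omega))
  · simp [Op.apply]
    omega

/-- The compiled expression computes the value of the expression. -/
def NExp.Correct (b : ℕ) (σ : HState) (e : NExp) : Prop :=
  ∀ (d : ℕ) (s : State), Rep b σ s →
    Runs (e.compile d) s e.cost fun s' => KeepN d s s' ∧ s'.nreg (2 * d + 3) = e.eval σ

theorem NExp.Correct.binary {b : ℕ} {σ : HState} {e f : NExp} (he : e.Correct b σ)
    (hf : f.Correct b σ) {d : ℕ} {s : State} (hs : Rep b σ s) {o : Op} {g : ℕ → ℕ → ℕ}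
    (ho : ∀ s : State, o.apply s = s.setN (2 * d + 3) (g (s.nreg (2 * d + 3)) (s.nreg (2 * (d + 1) + 3)))) :
    Runs (.seq (e.compile d) (.seq (f.compile (d + 1)) (.op o))) s (e.cost + f.cost + 1)
      fun s' => KeepN d s s' ∧ s'.nreg (2 * d + 3) = g (e.eval σ) (f.eval σ) := by
  refine Runs.mono ((he d s hs).seq fun s₁ h₁ => (hf (d + 1) s₁ (h₁.1.rep hs)).seq
    (Q' := fun s' => KeepN d s s' ∧ s'.nreg (2 * d + 3) = g (e.eval σ) (f.eval σ))
    fun s₂ h₂ => .op ?_) (by omega) fun _ h => h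
  rw [ho]
  refine ⟨(h₁.1.trans h₂.1 (by omega)).setN _ (by omega) (by omega), ?_⟩
  simp only [State.setN, Function.update_self]
  rw [h₂.2, h₂.1.nreg _ (by omega), h₁.2]

theorem NExp.correct (b : ℕ) (σ : HState) (e : NExp) : e.Correct b σ := by
  induction e with
  | lit k =>
    exact fun d s hs => .op ⟨(KeepN.refl d s).setN k (by omega) (by omega), by
      simp [Op.apply, eval]⟩
  | var i =>
    intro d s hs
    refine ⟨_, _, .seq (.op _ _) (.op _ _), le_rfl, ?_, ?_⟩
    · exact ((KeepN.refl d s).setN (j := 2 * d + 3) 0 (by omega) (by omega)).setN (j := 2 * d + 3) _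
        (by omega) (by omega)
    · have : 2 * i ≠ 2 * d + 3 := by omega
      simp [Op.apply, eval, this, hs.nv]
  | add e f he hf => exact fun d s hs => he.binary hf hs (g := (· + ·)) fun s => rfl
  | sub e f he hf => exact fun d s hs => he.binary hf hs (g := (· - ·)) fun s => rfl
  | get a e he =>
    intro d s hs
    refine Runs.mono ((he d s hs).seq fun s₁ h₁ => (runs_arrayIndex a d s₁).seq
      fun s₂ h₂ => Runs.seq (T := 1) (T' := 1) (Q := fun s₃ => KeepN d s s₃ ∧
        s₃.nreg (2 * d + 3) = 8 * e.eval σ + a + b)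
      (Q' := fun s₃ => KeepN d s s₃ ∧ s₃.nreg (2 * d + 3) = σ.na a (e.eval σ)) ?_ fun s₃ h₃ => ?_)
      (by simp only [cost]; omega) fun _ h => h
    · have h12 := h₁.1.trans h₂.1 le_rfl
      refine .op ⟨h12.setN _ (by omega) (by omega), ?_⟩
      simp only [Op.apply, Function.update_self]
      rw [h₂.2, h₁.2, (h12.rep hs).base]
    · refine .op ⟨h₃.1.setN _ (by omega) (by omega), ?_⟩
      simp only [Op.apply, Function.update_self]
      rw [h₃.2, (h₃.1.rep hs).na]
  | inp e he =>
    intro d s hs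
    refine Runs.mono ((he d s hs).seq fun s₁ h₁ => Runs.ite (T := 1)
      (Q := fun s₃ => KeepN d s s₃ ∧ s₃.nreg (2 * d + 3) = σ.inp (e.eval σ))
      (fun hlt => .op ?_) fun hlt => .op ?_) (by simp only [cost]; omega) fun _ h => h
    · refine ⟨h₁.1.setN _ (by omega) (by omega), ?_⟩
      simp only [Test.Holds, h₁.2, (h₁.1.rep hs).base] at hlt
      simp only [Op.apply, Function.update_self]
      rw [h₁.2, (h₁.1.rep hs).inp _ hlt]
    · refine ⟨h₁.1.setN _ (by omega) (by omega), ?_⟩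
      simp only [Test.Holds, h₁.2, (h₁.1.rep hs).base] at hlt
      simp only [Op.apply, Function.update_self]
      rw [(h₁.1.rep hs).inp_zero _ (by omega)]

/-- Only temporary registers have changed, and real ones only from number `d` on. -/
structure KeepR (d : ℕ) (s s' : State) : Prop where
  nreg : ∀ j, j % 2 = 0 ∨ j < 3 → s'.nreg j = s.nreg j
  nmem : s'.nmem = s.nmem
  rreg : ∀ j, j % 2 = 0 ∨ j < 2 * d + 1 → s'.rreg j = s.rreg j
  rmem : s'.rmem = s.rmem

theorem KeepN.keepR {d : ℕ} {s s' : State} (h : KeepN d s s') (d' : ℕ) : KeepR d' s s' :=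
  ⟨fun j hj => h.nreg j (by omega), h.nmem, fun j _ => by rw [h.rreg], h.rmem⟩

theorem KeepR.trans {d d' : ℕ} {s s' s'' : State} (h : KeepR d s s') (h' : KeepR d' s' s'')
    (hd : d ≤ d') : KeepR d s s'' :=
  ⟨fun j hj => (h'.nreg j hj).trans (h.nreg j hj), h'.nmem.trans h.nmem,
    fun j hj => (h'.rreg j (by omega)).trans (h.rreg j hj), h'.rmem.trans h.rmem⟩

theorem KeepR.setR {d j : ℕ} {s s' : State} (h : KeepR d s s') (v : ℝ) (h1 : j % 2 = 1)
    (h2 : 2 * d + 1 ≤ j) : KeepR d s (s'.setR j v) :=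
  ⟨h.nreg, h.nmem, fun i hi => (Function.update_of_ne (by omega) _ _).trans (h.rreg i hi), h.rmem⟩

theorem KeepR.setN {d j : ℕ} {s s' : State} (h : KeepR d s s') (v : ℕ) (h1 : j % 2 = 1)
    (h2 : 3 ≤ j) : KeepR d s (s'.setN j v) :=
  ⟨fun i hi => (Function.update_of_ne (by omega) _ _).trans (h.nreg i hi), h.nmem, h.rreg, h.rmem⟩

theorem KeepR.refl (d : ℕ) (s : State) : KeepR d s s := (KeepN.refl d s).keepR d

theorem KeepR.rep {b d : ℕ} {σ : HState} {s s' : State} (h : KeepR d s s') (hs : Rep b σ s) :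
    Rep b σ s' where
  base := (h.nreg 1 (by omega)).trans hs.base
  nv i := (h.nreg _ (by omega)).trans (hs.nv i)
  inp := by rw [h.nmem]; exact hs.inp
  inp_zero := hs.inp_zero
  na := by rw [h.nmem]; exact hs.na
  rv i := (h.rreg _ (by omega)).trans (hs.rv i)
  ra := by rw [h.rmem]; exact hs.ra

/-- The compiled expression computes the value of the expression. -/
def RExp.Correct (b : ℕ) (σ : HState) (e : RExp) : Prop :=
  ∀ (d : ℕ) (s : State), Rep b σ s →
    Runs (e.compile d) s e.cost fun s' => KeepR d s s' ∧ s'.rreg (2 * d + 1) = e.eval σ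

theorem RExp.Correct.binary {b : ℕ} {σ : HState} {e f : RExp} (he : e.Correct b σ)
    (hf : f.Correct b σ) {d : ℕ} {s : State} (hs : Rep b σ s) {o : Op} {g : ℝ → ℝ → ℝ}
    (ho : ∀ s : State, o.apply s = s.setR (2 * d + 1) (g (s.rreg (2 * d + 1)) (s.rreg (2 * (d + 1) + 1)))) :
    Runs (.seq (e.compile d) (.seq (f.compile (d + 1)) (.op o))) s (e.cost + f.cost + 1)
      fun s' => KeepR d s s' ∧ s'.rreg (2 * d + 1) = g (e.eval σ) (f.eval σ) := by
  refine Runs.mono ((he d s hs).seq fun s₁ h₁ => (hf (d + 1) s₁ (h₁.1.rep hs)).seq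
    (Q' := fun s' => KeepR d s s' ∧ s'.rreg (2 * d + 1) = g (e.eval σ) (f.eval σ))
    fun s₂ h₂ => .op ?_) (by omega) fun _ h => h
  rw [ho]
  refine ⟨(h₁.1.trans h₂.1 (by omega)).setR _ (by omega) (by omega), ?_⟩
  simp only [State.setR, Function.update_self]
  rw [h₂.2, h₂.1.rreg _ (by omega), h₁.2]

theorem RExp.correct (b : ℕ) (σ : HState) (e : RExp) : e.Correct b σ := by
  induction e with
  | var i =>
    intro d s hs
    refine ⟨_, _, .seq (.op _ _) (.seq (.op _ _) (.op _ _)), le_rfl, ?_, ?_⟩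
    · exact (((KeepR.refl d s).setN (j := 2 * 0 + 3) 0 (by omega) (by omega)).setR (j := 2 * d + 1) _
        (by omega) (by omega)).setR (j := 2 * d + 1) _ (by omega) (by omega)
    · have : 2 * i ≠ 2 * d + 1 := by omega
      simp [Op.apply, eval, this, hs.rv]
  | cast e =>
    intro d s hs
    refine (NExp.correct b σ e 0 s hs).seq fun s₁ h₁ => .op ⟨(h₁.1.keepR d).setR _ (by omega)
      (by omega), ?_⟩
    simp [Op.apply, eval, h₁.2]
  | add e f he hf => exact fun d s hs => he.binary hf hs (g := (· + ·)) fun s => rfl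
  | sub e f he hf => exact fun d s hs => he.binary hf hs (g := (· - ·)) fun s => rfl
  | mul e f he hf => exact fun d s hs => he.binary hf hs (g := (· * ·)) fun s => rfl
  | div e f he hf => exact fun d s hs => he.binary hf hs (g := (· / ·)) fun s => rfl
  | get a e =>
    intro d s hs
    refine Runs.mono ((NExp.correct b σ e 0 s hs).seq fun s₁ h₁ => (runs_arrayIndex a 0 s₁).seq
      (T' := 1) (Q' := fun s₃ => KeepR d s s₃ ∧ s₃.rreg (2 * d + 1) = σ.ra a (e.eval σ))
      fun s₂ h₂ => .op ?_) (by simp only [cost]; omega) fun _ h => h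
    have h12 := h₁.1.trans h₂.1 le_rfl
    refine ⟨(h12.keepR d).setR _ (by omega) (by omega), ?_⟩
    simp only [Op.apply, Function.update_self]
    rw [h₂.2, h₁.2, (h12.rep hs).ra]

theorem Cond.runs {b : ℕ} {σ : HState} (c : Cond) {P P' : Program} {s : State} (hs : Rep b σ s)
    {T : ℕ} {Q : State → Prop} (h : c.Holds σ → ∀ s, Rep b σ s → Runs P s T Q)
    (h' : ¬ c.Holds σ → ∀ s, Rep b σ s → Runs P' s T Q) :
    Runs (c.compile P P') s (c.cost + T) Q := by
  cases c with
  | lt e f | eq e f =>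
    refine Runs.mono ((e.correct b σ 0 s hs).seq fun s₁ h₁ =>
      (f.correct b σ 1 s₁ (h₁.1.rep hs)).seq fun s₂ h₂ => .ite (T := T) (Q := Q)
      (fun ht => h ?_ s₂ (h₂.1.rep (h₁.1.rep hs))) fun ht => h' ?_ s₂ (h₂.1.rep (h₁.1.rep hs)))
      (by simp only [cost]; omega) fun _ h => h
    all_goals
      simp only [Test.Holds] at ht
      rw [h₂.2, h₂.1.nreg _ (by omega), h₁.2] at ht
      exact ht
  | rlt e f =>
    refine Runs.mono ((e.correct b σ 0 s hs).seq fun s₁ h₁ =>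
      (f.correct b σ 1 s₁ (h₁.1.rep hs)).seq fun s₂ h₂ => .ite (T := T) (Q := Q)
      (fun ht => h ?_ s₂ (h₂.1.rep (h₁.1.rep hs))) fun ht => h' ?_ s₂ (h₂.1.rep (h₁.1.rep hs)))
      (by simp only [cost]; omega) fun _ h => h
    all_goals
      simp only [Test.Holds] at ht
      rw [h₂.2, h₂.1.rreg _ (by omega), h₁.2] at ht
      exact ht

theorem Rep.setN {b : ℕ} {σ : HState} {s : State} (hs : Rep b σ s) (i v : ℕ) :
    Rep b (σ.setN i v) (s.setN (2 * i) v) where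
  base := (Function.update_of_ne (by omega) _ _).trans hs.base
  nv j := by
    simp only [HState.setN, State.setN, Function.update_apply]
    simp [hs.nv]
  inp := hs.inp
  inp_zero := hs.inp_zero
  na := hs.na
  rv := hs.rv
  ra := hs.ra

theorem Rep.setR {b : ℕ} {σ : HState} {s : State} (hs : Rep b σ s) (i : ℕ) (v : ℝ) :
    Rep b (σ.setR i v) (s.setR (2 * i) v) where
  base := hs.base
  nv := hs.nv
  inp := hs.inp
  inp_zero := hs.inp_zero
  na := hs.na
  rv j := by
    simp only [HState.setR, State.setR, Function.update_apply]
    simp [hs.rv]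
  ra := hs.ra

theorem arrayIndex_eq_iff {a a' : Fin 8} {i i' : ℕ} :
    8 * i + (a : ℕ) = 8 * i' + a' ↔ a = a' ∧ i = i' := by
  have := a.isLt
  have := a'.isLt
  rw [Fin.ext_iff]
  omega

theorem Rep.setA {b : ℕ} {σ : HState} {s : State} (hs : Rep b σ s) (a : Fin 8) (i v : ℕ) :
    Rep b (σ.setA a i v) { s with nmem := Function.update s.nmem (8 * i + a + b) v } where
  base := hs.base
  nv := hs.nv
  inp j hj := (Function.update_of_ne (by omega) _ _).trans (hs.inp j hj)
  inp_zero := hs.inp_zero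
  na a' i' := by
    simp only [HState.setA, Function.update_apply, add_left_inj, arrayIndex_eq_iff]
    by_cases h : a' = a
    · subst h
      simp [hs.na, Function.update_apply]
    · simp [h, hs.na]
  rv := hs.rv
  ra := hs.ra

theorem Rep.setRA {b : ℕ} {σ : HState} {s : State} (hs : Rep b σ s) (a : Fin 8) (i : ℕ) (v : ℝ) :
    Rep b (σ.setRA a i v) { s with rmem := Function.update s.rmem (8 * i + a) v } where
  base := hs.base
  nv := hs.nv
  inp := hs.inp
  inp_zero := hs.inp_zero
  na := hs.na
  rv := hs.rv
  ra a' i' := by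
    simp only [HState.setRA, Function.update_apply, arrayIndex_eq_iff]
    by_cases h : a' = a
    · subst h
      simp [hs.ra, Function.update_apply]
    · simp [h, hs.ra]

/-- Only variables that bound loops matter, and `wf` keeps them out of the write set. So step bounds
can be evaluated in the initial state. -/
theorem Cmd.bound_congr {W : ℕ → Bool} {c : Cmd} (h : c.wf W = true) {ν ν' : ℕ → ℕ}
    (hν : ∀ i, W i = false → ν i = ν' i) : c.bound ν = c.bound ν' := by
  induction c with
  | skip | setN | setA | setR | setRA => rfl
  | seq c d hc hd =>
    simp only [wf, Bool.and_eq_true] at h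
    simp only [bound, hc h.1, hd h.2]
  | ite b c d hc hd =>
    simp only [wf, Bool.and_eq_true] at h
    simp only [bound, hc h.1, hd h.2]
  | loop x y c hc =>
    simp only [wf, Bool.and_eq_true, Bool.not_eq_true'] at h
    simp only [bound, hc h.2, hν y h.1.1.1]

theorem setN_eq_self {σ : HState} {i k : ℕ} (h : σ.nv i = k) : σ.setN i k = σ := by
  subst h
  simp [HState.setN]

/-- A compiled command does what the command does, within the bound. -/
theorem Cmd.runs {W : ℕ → Bool} {b : ℕ} (c : Cmd) (hW : ∀ i, c.modN i = true → W i = true)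
    (hwf : c.wf W = true) {σ : HState} {s : State} (hs : Rep b σ s) :
    Runs c.compile s (c.bound σ.nv) (Rep b (c.run σ)) := by
  induction c generalizing σ s with
  | skip => exact ⟨1, s, .skip s, le_rfl, hs⟩
  | setN i e =>
    refine Runs.mono ((e.correct b σ 0 s hs).seq fun s₁ h₁ => Runs.seq (T := 1) (T' := 1)
      (Q := fun s₂ => KeepN 0 s s₂ ∧ s₂.nreg (2 * 0 + 3) = e.eval σ ∧ s₂.nreg (2 * 1 + 3) = 0) ?_
      fun s₂ h₂ => .op ?_) (by simp only [bound]; omega) fun _ h => h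
    · refine .op ⟨h₁.1.setN _ (by omega) (by omega), ?_⟩
      simpa [Op.apply, Function.update_apply] using h₁.2
    · have := (h₂.1.rep hs).setN i (e.eval σ)
      simpa [run, Op.apply, State.setN, h₂.2.1, h₂.2.2] using this
  | setA a e f =>
    refine Runs.mono ((e.correct b σ 0 s hs).seq fun s₁ h₁ => (runs_arrayIndex a 0 s₁).seq
      fun s₂ h₂ => Runs.seq (T := 1) (T' := f.cost + 1) (Q := fun s₃ => KeepN 0 s s₃ ∧
        s₃.nreg (2 * 0 + 3) = 8 * e.eval σ + a + b) ?_
      fun s₃ h₃ => (f.correct b σ 1 s₃ (h₃.1.rep hs)).seq fun s₄ h₄ => .op ?_)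
      (by simp only [bound]; omega) fun _ h => h
    · have h12 := h₁.1.trans h₂.1 le_rfl
      refine .op ⟨h12.setN _ (by omega) (by omega), ?_⟩
      simp only [Op.apply, Function.update_self]
      rw [h₂.2, h₁.2, (h12.rep hs).base]
    · have := (h₄.1.rep (h₃.1.rep hs)).setA a (e.eval σ) (f.eval σ)
      simp only [Op.apply]
      rw [h₄.2, h₄.1.nreg _ (by omega), h₃.2]
      exact this
  | setR i e =>
    refine Runs.mono ((e.correct b σ 0 s hs).seq fun s₁ h₁ => Runs.seq (T := 1) (T' := 1 + 1)
      (Q := fun s₂ => KeepR 0 s s₂ ∧ s₂.rreg (2 * 0 + 1) = e.eval σ ∧ s₂.nreg (2 * 0 + 3) = 0) ?_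
      fun s₂ h₂ => Runs.seq
      (Q := fun s₃ => KeepR 0 s s₃ ∧ s₃.rreg (2 * 0 + 1) = e.eval σ ∧ s₃.rreg (2 * 1 + 1) = 0) ?_
      fun s₃ h₃ => .op ?_) (by simp only [bound]; omega) fun _ h => h
    · refine .op ⟨h₁.1.setN _ (by omega) (by omega), ?_⟩
      simpa [Op.apply, Function.update_apply] using h₁.2
    · refine .op ⟨h₂.1.setR _ (by omega) (by omega), ?_⟩
      simpa [Op.apply, Function.update_apply, h₂.2.2] using h₂.2.1
    · have := (h₃.1.rep hs).setR i (e.eval σ)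
      simpa [run, Op.apply, State.setR, h₃.2.1, h₃.2.2] using this
  | setRA a e f =>
    refine Runs.mono ((f.correct b σ 0 s hs).seq fun s₀ h₀ =>
      (e.correct b σ 0 s₀ (h₀.1.rep hs)).seq fun s₁ h₁ => (runs_arrayIndex a 0 s₁).seq
      fun s₂ h₂ => .op ?_) (by simp only [bound]; omega) fun _ h => h
    have h12 := h₁.1.trans h₂.1 le_rfl
    have := (h12.rep (h₀.1.rep hs)).setRA a (e.eval σ) (f.eval σ)
    simp only [Op.apply]
    rw [h₂.2, h₁.2, congrFun h12.rreg, h₀.2]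
    exact this
  | seq c d hc hd =>
    simp only [wf, Bool.and_eq_true] at hwf
    simp only [modN, Bool.or_eq_true] at hW
    refine Runs.mono ((hc (fun i h => hW i (.inl h)) hwf.1 hs).seq fun s₁ h₁ =>
      hd (fun i h => hW i (.inr h)) hwf.2 h₁) ?_ fun _ h => h
    simp only [bound]
    refine Nat.add_le_add_left (le_of_eq (bound_congr hwf.2 fun i hi => run_nv ?_ σ)) _
    by_contra h
    rw [hW i (.inl (by simpa using h))] at hi
    cases hi
  | ite q c d hc hd =>
    simp only [wf, Bool.and_eq_true] at hwf
    simp only [modN, Bool.or_eq_true] at hW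
    refine q.runs hs (T := max (c.bound σ.nv) (d.bound σ.nv)) (fun ht s hs => ?_) fun ht s hs => ?_
    · refine Runs.mono (hc (fun i h => hW i (.inl h)) hwf.1 hs) (le_max_left _ _) ?_
      simp [run, ht]
    · refine Runs.mono (hd (fun i h => hW i (.inr h)) hwf.2 hs) (le_max_right _ _) ?_
      simp [run, ht]
  | loop x y c hc =>
    simp only [wf, Bool.and_eq_true, Bool.not_eq_true', bne_iff_ne] at hwf
    simp only [modN, Bool.or_eq_true, beq_iff_eq] at hW
    obtain ⟨⟨⟨hy, hx⟩, hxy⟩, hcwf⟩ := hwf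
    set it := fun k => iterate (fun k τ => c.run (τ.setN x k)) k σ with hit
    -- Iterations leave everything outside W unchanged, in particular the bound of this loop and the
    -- bounds of the loops within it.
    have hfix : ∀ k i, W i = false → (it k).nv i = σ.nv i := by
      intro k i hi
      have hix : i ≠ x := fun h => by rw [hW i (.inl h)] at hi; cases hi
      have hci : c.modN i = false := by
        by_contra h
        rw [hW i (.inr (by simpa using h))] at hi
        cases hi
      exact iterate_preserves (fun τ : HState => τ.nv i) _ _ _ fun k τ => by
        simp [run_nv hci, HState.setN, hix]
    refine Runs.mono (Runs.seq (T := 1) (Q := Rep b ((it 0).setN x 0)) (.op (hs.setN x 0))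
      fun s hs => Runs.loop (T := c.bound σ.nv + 2) (fun k => Rep b ((it k).setN x k)) (σ.nv y)
      ?_ ?_ ?_ hs) (by simp only [bound]; ring_nf; omega) fun _ h => h
    · intro k hk s hs
      have h1 := hs.nv x
      have h2 := hs.nv y
      simp only [HState.setN, Function.update_self, Function.update_of_ne hxy.symm, hfix k y hy]
        at h1 h2
      simp only [Test.Holds, h1, h2]
      exact hk
    · intro s hs
      have h1 := hs.nv x
      have h2 := hs.nv y
      simp only [HState.setN, Function.update_self, Function.update_of_ne hxy.symm, hfix _ y hy]
        at h1 h2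
      simp only [Test.Holds, h1, h2]
      omega
    · intro k hk s hs
      have hbd : c.bound ((it k).setN x k).nv = c.bound σ.nv := by
        refine bound_congr hcwf fun i hi => ?_
        have hix : i ≠ x := fun h => by rw [hW i (.inl h)] at hi; cases hi
        simp [HState.setN, hix, hfix k i hi]
      have h1 := hc (fun i h => hW i (.inr h)) hcwf hs
      rw [hbd] at h1
      refine h1.seq fun s₁ h₁ => Runs.seq (T := 1) (T' := 1)
        (Q := fun s₂ => KeepN 0 s₁ s₂ ∧ s₂.nreg (2 * 0 + 3) = 1) ?_ fun s₂ h₂ => .op ?_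
      · exact .op ⟨(KeepN.refl 0 s₁).setN _ (by omega) (by omega), by simp [Op.apply]⟩
      · have h3 := (h₂.1.rep h₁).setN x (k + 1)
        have h4 : s₂.nreg (2 * x) = k := by
          rw [(h₂.1.rep h₁).nv, run_nv hx]
          simp [HState.setN]
        have h5 : it (k + 1) = c.run ((it k).setN x k) := rfl
        rw [h5]
        simpa [Op.apply, State.setN, h4, h₂.2] using h3

end RealRAM

/-! ### The program and its invariants -/

namespace RealRAM

namespace HState

variable (σ : HState) (i j k : ℕ) (a b : Fin 8) (z : ℝ)

@[simp] theorem setN_nv : (σ.setN i k).nv j = if j = i then k else σ.nv j :=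
  Function.update_apply _ _ _ _
@[simp] theorem setN_na : (σ.setN i k).na = σ.na := rfl
@[simp] theorem setN_rv : (σ.setN i k).rv = σ.rv := rfl
@[simp] theorem setN_ra : (σ.setN i k).ra = σ.ra := rfl
@[simp] theorem setN_inp : (σ.setN i k).inp = σ.inp := rfl
@[simp] theorem setA_nv : (σ.setA a i k).nv = σ.nv := rfl
@[simp] theorem setA_na : (σ.setA a i k).na b j = if b = a ∧ j = i then k else σ.na b j := by
  by_cases h : b = a
  · subst h; simp [setA, Function.update_apply]
  · simp [setA, h]
@[simp] theorem setA_rv : (σ.setA a i k).rv = σ.rv := rfl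
@[simp] theorem setA_ra : (σ.setA a i k).ra = σ.ra := rfl
@[simp] theorem setR_nv : (σ.setR i z).nv = σ.nv := rfl
@[simp] theorem setR_na : (σ.setR i z).na = σ.na := rfl
@[simp] theorem setR_rv : (σ.setR i z).rv j = if j = i then z else σ.rv j :=
  Function.update_apply _ _ _ _
@[simp] theorem setR_ra : (σ.setR i z).ra = σ.ra := rfl
@[simp] theorem setRA_nv : (σ.setRA a i z).nv = σ.nv := rfl
@[simp] theorem setRA_na : (σ.setRA a i z).na = σ.na := rfl
@[simp] theorem setRA_rv : (σ.setRA a i z).rv = σ.rv := rfl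
@[simp] theorem setRA_ra : (σ.setRA a i z).ra b j = if b = a ∧ j = i then z else σ.ra b j := by
  by_cases h : b = a
  · subst h; simp [setRA, Function.update_apply]
  · simp [setRA, h]

end HState

/-- `τ` is a state that may be reached from `σ` by commands that change only what `c` may change. -/
structure Frame (c : Cmd) (σ τ : HState) : Prop where
  inp : τ.inp = σ.inp
  nv : ∀ i, c.modN i = false → τ.nv i = σ.nv i
  na : ∀ a, c.modA a = false → τ.na a = σ.na a
  rv : ∀ i, c.modR i = false → τ.rv i = σ.rv i
  ra : ∀ a, c.modRA a = false → τ.ra a = σ.ra a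

theorem frame_run (c : Cmd) (σ : HState) : Frame c σ (c.run σ) :=
  ⟨c.run_inp σ, fun _ h => Cmd.run_nv h σ, fun _ h => Cmd.run_na h σ, fun _ h => Cmd.run_rv h σ,
    fun _ h => Cmd.run_ra h σ⟩

/-- The rule for loops. In the proof of the step, the state is the one in which the body starts. -/
theorem run_loop {x y : ℕ} {c : Cmd} {σ : HState} (I : ℕ → HState → Prop) (h0 : I 0 σ)
    (hx : ∀ k τ v, I k τ → I k (τ.setN x v))
    (hs : ∀ k < σ.nv y, ∀ τ, Frame (.loop x y c) σ τ → τ.nv x = k → I k τ → I (k + 1) (c.run τ)) :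
    I (σ.nv y) ((Cmd.loop x y c).run σ) := by
  have key : ∀ k ≤ σ.nv y, I k (iterate (fun k τ => c.run (τ.setN x k)) k σ) ∧
      Frame (.loop x y c) σ (iterate (fun k τ => c.run (τ.setN x k)) k σ) := by
    intro k
    induction k with
    | zero => exact fun _ => ⟨h0, rfl, fun _ _ => rfl, fun _ _ => rfl, fun _ _ => rfl,
        fun _ _ => rfl⟩
    | succ k ih =>
      intro hk
      obtain ⟨h1, h2⟩ := ih (by omega)
      set τ := iterate (fun k τ => c.run (τ.setN x k)) k σ with hτ
      have h3 : Frame (.loop x y c) σ (τ.setN x k) := by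
        refine ⟨h2.inp, fun i hi => ?_, h2.na, h2.rv, h2.ra⟩
        have hi' := hi
        simp only [Cmd.modN, Bool.or_eq_false_iff, beq_eq_false_iff_ne] at hi'
        simp [hi'.1, h2.nv i hi]
      refine ⟨hs k (by omega) _ h3 (by simp) (hx _ _ _ h1), ?_⟩
      have h4 := frame_run c (τ.setN x k)
      refine ⟨h4.inp.trans h3.inp, fun i hi => ?_, fun a ha => (h4.na a ha).trans (h3.na a ha),
        fun i hi => (h4.rv i hi).trans (h3.rv i hi), fun a ha => (h4.ra a ha).trans (h3.ra a ha)⟩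
      have hi' := hi
      simp only [Cmd.modN, Bool.or_eq_false_iff, beq_eq_false_iff_ne] at hi'
      exact (h4.nv i hi'.2).trans (h3.nv i hi)
  exact hx _ _ _ (key _ le_rfl).1

/-! The program. Variables for natural numbers: `0` number `n` of vertices, `1` number of edges,
`2` exponent `L` with `n ^ (-L) ≤ ε`, `3` number `r` of labels, `4` number `D` of label changes,
`5` number of digits, `6` number of rounds, `7` base of the digits, `8` number of digit sequences,
`9` `n - 1`, `10` `n ^ 2`; from `11` on counters and auxiliary variables.
Arrays for natural numbers: `0` the multiples of `n`, `1` membership in the tree, `2` the order in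
which vertices join the tree, `3` parents, `4` digits, `5` label changes, `6` labels, `7` codes of
the labelings met so far. Real variables: `0` probability and output, `1` `ε`, `2` power of `1 / n`,
`3` accumulator, from `4` on auxiliary. Real arrays: `0` multiplicities, `1` load factors, `2` powers
of the probability, `3` partial sums of the coefficients. -/

/-- `z := x * y` -/
def mulCmd (z x c y : ℕ) : Cmd :=
  .seq (.setN z (.lit 0)) (.loop c y (.setN z (.add (.var z) (.var x))))

def NExp.smul : ℕ → NExp → NExp
  | 0, _ => .lit 0
  | k + 1, e => .add (smul k e) e

/-- Repeated while n^(-L) > ε, this finds the least suitable L without any rounding. -/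
def precisionStep : Cmd :=
  .seq (.setR 2 (.div (.var 2) (.cast (.var 0)))) (.setN 2 (.add (.var 2) (.lit 1)))

/-- r = C(L + 1), D = 4α with α = 1 + d(4r + 3), two digits per label change, 8m + 1 rounds. With
base n + r a digit can be a vertex or a label, and also n or r, which stand for no vertex and no
label. -/
def parameters (C d : ℕ) : Cmd :=
  .seq (.setN 3 (.smul C (.add (.var 2) (.lit 1)))) <|
  .seq (.setN 4 (.smul 4 (.add (.lit 1) (.smul d (.add (.smul 4 (.var 3)) (.lit 3)))))) <|
  .seq (.setN 5 (.add (.var 4) (.var 4))) <|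
  .seq (.setN 6 (.add (.smul 8 (.var 1)) (.lit 1))) <|
  .seq (.setN 7 (.add (.var 0) (.var 3))) <|
  .setN 9 (.sub (.var 0) (.lit 1))

/-- Multiplication is a loop over the second factor, which is therefore the small base and not the
growing power. -/
def countSequences : Cmd :=
  .seq (mulCmd 10 0 11 0) <|
  .seq (.setN 8 (.lit 1)) <|
  .loop 11 5 (.seq (mulCmd 13 8 12 7) (.setN 8 (.var 13)))

/-- Tabulated multiples of n make matrix entries addressable at constant cost. -/
def rowTable : Cmd :=
  .seq (.setN 13 (.lit 0)) <|
  .loop 11 0 (.seq (.setA 0 (.var 11) (.var 13)) (.setN 13 (.add (.var 13) (.var 0))))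

def fillOnes : Cmd :=
  .loop 11 10 (.seq (.setRA 1 (.var 11) (.cast (.lit 1))) (.setRA 2 (.var 11) (.cast (.lit 1))))

/-- The position of the entry `(x, y)` of a matrix. -/
def entry (x y : ℕ) : NExp := .add (.get 0 (.var x)) (.var y)

def countEdge (x y : ℕ) : Cmd :=
  .seq (.setRA 0 (entry x y) (.add (.get 0 (entry x y)) (.cast (.lit 1))))
    (.setRA 2 (entry x y) (.mul (.get 2 (entry x y)) (.var 0)))

def readEdges : Cmd :=
  .loop 11 1 <|
    .seq (.setN 13 (.inp (.add (.var 11) (.var 11)))) <|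
    .seq (.setN 14 (.inp (.add (.add (.var 11) (.var 11)) (.lit 1)))) <|
    .seq (countEdge 13 14) (countEdge 14 13)

/-- Real variable 4 runs through binom(r, k) by its recursion in k, real variable 5 through the
signs. -/
def coefficients : Cmd :=
  .seq (.setR 4 (.cast (.lit 1))) <| .seq (.setR 5 (.cast (.lit 1))) <|
  .loop 11 3 <|
    .seq (.setR 4 (.div (.mul (.var 4) (.cast (.sub (.var 3) (.var 11))))
      (.cast (.add (.var 11) (.lit 1))))) <|
    .seq (.setRA 3 (.add (.var 11) (.lit 1)) (.add (.get 3 (.var 11))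
      (.div (.mul (.var 5) (.var 4)) (.cast (.add (.var 11) (.lit 1)))))) <|
    .setR 5 (.sub (.cast (.lit 0)) (.var 5))

/-- Take the edge from vertex `17` to vertex `18` if it is shorter than what has been found. -/
def considerEdge : Cmd :=
  .ite (.eq (.get 1 (.var 17)) (.lit 1))
    (.ite (.eq (.get 1 (.var 18)) (.lit 0))
      (.ite (.rlt (.cast (.lit 0)) (.get 0 (entry 17 18)))
        (.seq (.setR 4 (.div (.get 1 (entry 17 18)) (.get 0 (entry 17 18)))) <|
          .ite (.eq (.var 19) (.lit 0))
            (.seq (.setN 19 (.lit 1)) <| .seq (.setR 5 (.var 4)) <|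
              .seq (.setN 20 (.var 17)) (.setN 21 (.var 18)))
            (.ite (.rlt (.var 4) (.var 5))
              (.seq (.setR 5 (.var 4)) <| .seq (.setN 20 (.var 17)) (.setN 21 (.var 18)))
              .skip))
        .skip)
      .skip)
    .skip

def findEdge : Cmd :=
  .seq (.setN 19 (.lit 0)) (.loop 17 0 (.loop 18 0 considerEdge))

def growTree : Cmd :=
  .seq (.loop 17 0 (.setA 1 (.var 17) (.lit 0))) <|
  .seq (.setA 1 (.lit 0) (.lit 1)) <|
  .seq (.setA 2 (.lit 0) (.lit 0)) <|
  .loop 16 9 <|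
    .seq findEdge <|
    .seq (.setA 1 (.var 21) (.lit 1)) <|
    .seq (.setA 3 (.var 21) (.var 20)) <|
    .setA 2 (.add (.var 16) (.lit 1)) (.var 21)

def loadTree : Cmd :=
  .loop 16 9 <|
    .seq (.setN 18 (.get 2 (.add (.var 16) (.lit 1)))) <|
    .seq (.setN 17 (.get 3 (.var 18))) <|
    .seq (.setR 4 (.add (.cast (.lit 1)) (.div (.cast (.lit 1)) (.get 0 (entry 17 18))))) <|
    .seq (.setRA 1 (entry 17 18) (.mul (.get 1 (entry 17 18)) (.var 4)))
      (.setRA 1 (entry 18 17) (.mul (.get 1 (entry 18 17)) (.var 4)))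

/-- The digits are pairs of a vertex and its new label; r, which is not a label, means no change. -/
def setChanges : Cmd :=
  .seq (.loop 17 0 (.setA 5 (.var 17) (.var 3)))
    (.loop 16 4 (.setA 5 (.get 4 (.add (.var 16) (.var 16)))
      (.get 4 (.add (.add (.var 16) (.var 16)) (.lit 1)))))

/-- In the order of the tree, parents come first. A vertex without a change inherits the label of
its parent, and the root takes 0 by default. -/
def setLabels : Cmd :=
  .loop 16 0 <|
    .seq (.setN 17 (.get 2 (.var 16))) <|
    .ite (.lt (.get 5 (.var 17)) (.var 3))
      (.setA 6 (.var 17) (.get 5 (.var 17)))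
      (.ite (.eq (.var 16) (.lit 0))
        (.setA 6 (.var 17) (.lit 0))
        (.setA 6 (.var 17) (.get 6 (.get 3 (.var 17)))))

/-- The code serves as an address in array 7, so that a labeling met before is recognized in one
step. Variable 20 collects the greatest label. -/
def encode : Cmd :=
  .seq (.setN 19 (.lit 0)) <| .seq (.setN 20 (.lit 0)) <|
  .loop 17 0 <|
    .seq (mulCmd 21 19 16 3) <|
    .seq (.setN 19 (.add (.var 21) (.get 6 (.var 17)))) <|
    .ite (.lt (.var 20) (.get 6 (.var 17))) (.setN 20 (.get 6 (.var 17))) .skip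

def cutProbability : Cmd :=
  .seq (.setR 4 (.cast (.lit 1))) <|
  .loop 17 0 <| .loop 18 0 <|
    .ite (.lt (.var 17) (.var 18))
      (.ite (.eq (.get 6 (.var 17)) (.get 6 (.var 18))) .skip
        (.setR 4 (.mul (.var 4) (.get 2 (entry 17 18)))))
      .skip

/-- The weight of a labeling is the difference of the partial sums of coefficients at r and at the
greatest label. -/
def account : Cmd :=
  .ite (.eq (.get 7 (.var 19)) (.lit 0))
    (.seq (.setA 7 (.var 19) (.lit 1)) <|
      .seq cutProbability <|
      .setR 3 (.add (.var 3) (.mul (.sub (.get 3 (.var 3)) (.get 3 (.var 20))) (.var 4))))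
    .skip

def nextDigits : Cmd :=
  .seq (.setN 19 (.lit 1)) <|
  .loop 16 5 <|
    .seq (.setN 20 (.add (.get 4 (.var 16)) (.var 19))) <|
    .ite (.eq (.var 20) (.var 7))
      (.setA 4 (.var 16) (.lit 0))
      (.seq (.setA 4 (.var 16) (.var 20)) (.setN 19 (.lit 0)))

def tryLabelings : Cmd :=
  .seq (.loop 16 5 (.setA 4 (.var 16) (.lit 0))) <|
  .loop 15 8 <|
    .seq setChanges <| .seq setLabels <| .seq encode <| .seq account nextDigits

def rounds : Cmd :=
  .loop 14 6 (.seq growTree (.seq loadTree tryLabelings))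

def preparation : Cmd :=
  .seq rowTable <| .seq fillOnes <| .seq readEdges coefficients

def estimate : Cmd :=
  .seq preparation <| .seq rounds <| .setR 0 (.sub (.cast (.lit 1)) (.var 3))

theorem run_mulCmd {z x c y : ℕ} (σ : HState) (hzx : z ≠ x) (hzy : z ≠ y) (hzc : z ≠ c)
    (hxc : x ≠ c) : ((mulCmd z x c y).run σ).nv z = σ.nv x * σ.nv y := by
  have := run_loop (x := c) (y := y) (c := .setN z (.add (.var z) (.var x)))
    (σ := σ.setN z 0) (fun k τ => τ.nv z = σ.nv x * k ∧ τ.nv x = σ.nv x) (by simp [hzx.symm])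
    (fun k τ v h => by simpa [hzc, hxc] using h) (fun k _ τ _ _ h => by
      simp [Cmd.run, NExp.eval, h.1, h.2, hzx.symm]
      ring)
  simp only [HState.setN_nv, hzy.symm, if_false] at this
  exact this.1

@[simp] theorem NExp.eval_smul (σ : HState) (k : ℕ) (e : NExp) :
    (smul k e).eval σ = k * e.eval σ := by
  induction k with
  | zero => simp [smul, eval]
  | succ k ih => simp [smul, eval, ih]; ring

@[simp] theorem eval_entry (σ : HState) (x y : ℕ) :
    (entry x y).eval σ = σ.na 0 (σ.nv x) + σ.nv y := rfl

/-- What the rounds find in the memory and do not change. -/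
structure Env (n r D : ℕ) (cap : ℕ → ℕ → ℕ) (p : ℝ) (σ : HState) : Prop where
  nv_n : σ.nv 0 = n
  nv_r : σ.nv 3 = r
  nv_D : σ.nv 4 = D
  nv_digits : σ.nv 5 = D + D
  nv_base : σ.nv 7 = n + r
  nv_count : σ.nv 8 = (n + r) ^ (D + D)
  nv_pred : σ.nv 9 = n - 1
  row : ∀ u < n, σ.na 0 u = u * n
  mult : ∀ u < n, ∀ v < n, σ.ra 0 (u * n + v) = cap u v
  pow : ∀ u < n, ∀ v < n, σ.ra 2 (u * n + v) = p ^ cap u v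
  coeff : ∀ M ≤ r, σ.ra 3 M = ∑ j ∈ Icc 1 M, extrapolationCoeff r j

theorem Env.congr {n r D : ℕ} {cap : ℕ → ℕ → ℕ} {p : ℝ} {σ τ : HState} (h : Env n r D cap p σ)
    (hn : ∀ i < 10, τ.nv i = σ.nv i) (ha : τ.na 0 = σ.na 0) (h0 : τ.ra 0 = σ.ra 0)
    (h2 : τ.ra 2 = σ.ra 2) (h3 : τ.ra 3 = σ.ra 3) : Env n r D cap p τ where
  nv_n := (hn 0 (by norm_num)).trans h.nv_n
  nv_r := (hn 3 (by norm_num)).trans h.nv_r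
  nv_D := (hn 4 (by norm_num)).trans h.nv_D
  nv_digits := (hn 5 (by norm_num)).trans h.nv_digits
  nv_base := (hn 7 (by norm_num)).trans h.nv_base
  nv_count := (hn 8 (by norm_num)).trans h.nv_count
  nv_pred := (hn 9 (by norm_num)).trans h.nv_pred
  row := by rw [ha]; exact h.row
  mult := by rw [h0]; exact h.mult
  pow := by rw [h2]; exact h.pow
  coeff := by rw [h3]; exact h.coeff

/-- The command changes nothing of what the rounds need. -/
def Cmd.keepsEnv (c : Cmd) : Bool :=
  (List.range 10).all (fun i => !c.modN i) && !c.modA 0 && !c.modRA 0 && !c.modRA 2 && !c.modRA 3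

theorem Env.frame {n r D : ℕ} {cap : ℕ → ℕ → ℕ} {p : ℝ} {σ τ : HState} (h : Env n r D cap p σ)
    {c : Cmd} (hc : c.keepsEnv = true) (hF : Frame c σ τ) : Env n r D cap p τ := by
  simp only [Cmd.keepsEnv, Bool.and_eq_true, List.all_eq_true, List.mem_range,
    Bool.not_eq_true'] at hc
  exact h.congr (fun i hi => hF.nv i (hc.1.1.1.1 i hi)) (hF.na _ hc.1.1.1.2) (hF.ra _ hc.1.1.2)
    (hF.ra _ hc.1.2) (hF.ra _ hc.2)

theorem Env.run {n r D : ℕ} {cap : ℕ → ℕ → ℕ} {p : ℝ} {σ : HState} (h : Env n r D cap p σ)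
    {c : Cmd} (hc : c.keepsEnv = true) : Env n r D cap p (c.run σ) :=
  h.frame hc (frame_run c σ)

end RealRAM

/-! ### Correctness of the tree construction -/

namespace RealRAM

variable {n r D : ℕ} {cap : ℕ → ℕ → ℕ} {p : ℝ}

/-- The edges that leave the set of vertices with mark `1`. -/
def Leaves (n : ℕ) (cap : ℕ → ℕ → ℕ) (mark : ℕ → ℕ) (u v : ℕ) : Prop :=
  u < n ∧ v < n ∧ mark u = 1 ∧ mark v = 0 ∧ 0 < cap u v

/-- The search has found a shortest one of the leaving edges with the property `Q`, if any. -/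
def Found (n : ℕ) (cap : ℕ → ℕ → ℕ) (mark : ℕ → ℕ) (len : ℕ → ℕ → ℝ) (Q : ℕ → ℕ → Prop)
    (τ : HState) : Prop :=
  (τ.nv 19 = 0 ∧ ∀ u v, Leaves n cap mark u v → ¬ Q u v) ∨
  (τ.nv 19 = 1 ∧ Leaves n cap mark (τ.nv 20) (τ.nv 21) ∧ τ.rv 5 = len (τ.nv 20) (τ.nv 21) ∧
    ∀ u v, Leaves n cap mark u v → Q u v → τ.rv 5 ≤ len u v)

theorem Found.weaken {mark : ℕ → ℕ} {len : ℕ → ℕ → ℝ} {Q Q' : ℕ → ℕ → Prop} {τ : HState}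
    (h : Found n cap mark len Q τ) (hQ : ∀ u v, Leaves n cap mark u v → Q' u v → Q u v) :
    Found n cap mark len Q' τ := by
  rcases h with ⟨h1, h2⟩ | ⟨h1, h2, h3, h4⟩
  · exact .inl ⟨h1, fun u v h h' => h2 u v h (hQ u v h h')⟩
  · exact .inr ⟨h1, h2, h3, fun u v h h' => h4 u v h (hQ u v h h')⟩

theorem found_considerEdge {σ : HState} (hE : Env n r D cap p σ) {Q Q' : ℕ → ℕ → Prop}
    {u v : ℕ} (hu : σ.nv 17 = u) (hv : σ.nv 18 = v) (hun : u < n) (hvn : v < n)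
    {len : ℕ → ℕ → ℝ} (hlen : len u v = σ.ra 1 (u * n + v) / cap u v)
    (h : Found n cap (σ.na 1) len Q σ)
    (hQ : ∀ a b, Q' a b → Q a b ∨ (a = u ∧ b = v)) :
    Found n cap (σ.na 1) len Q' (considerEdge.run σ) := by
  have hcap := hE.mult u hun v hvn
  have hrow := hE.row u hun
  simp only [considerEdge, Cmd.run, Cond.Holds, NExp.eval, RExp.eval, eval_entry, hu, hv, hrow,
    hcap, HState.setR_rv, HState.setR_nv, Nat.cast_zero, Nat.cast_pos, if_true,
    (by norm_num : ¬ (5 : ℕ) = 4), if_false]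
  by_cases hL : Leaves n cap (σ.na 1) u v
  · obtain ⟨-, -, h1, h2, h3⟩ := hL
    rw [if_pos h1, if_pos h2, if_pos h3]
    split_ifs with h4 h5
    · refine .inr ⟨by simp, ?_, ?_, fun a b hab hab' => ?_⟩
      · simpa [hu, hv] using ⟨hun, hvn, h1, h2, h3⟩
      · simp [hu, hv, hlen]
      · rcases h with ⟨-, h6⟩ | ⟨h6, -⟩
        · rcases hQ a b hab' with h7 | ⟨rfl, rfl⟩
          · exact absurd h7 (h6 a b hab)
          · simp [hlen]
        · omega
    · rcases h with ⟨h6, -⟩ | ⟨h6, h7, h8, h9⟩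
      · exact absurd h6 h4
      · refine .inr ⟨by simp [h6], ?_, ?_, fun a b hab hab' => ?_⟩
        · simpa [hu, hv] using ⟨hun, hvn, h1, h2, h3⟩
        · simp [hv, hlen]
        · rcases hQ a b hab' with h10 | ⟨rfl, rfl⟩
          · simp at h5 ⊢
            exact h5.le.trans (h9 a b hab h10)
          · simp [hlen]
    · rcases h with ⟨h6, -⟩ | ⟨h6, h7, h8, h9⟩
      · exact absurd h6 h4
      · refine .inr ⟨h6, h7, by simpa using h8, fun a b hab hab' => ?_⟩
        rcases hQ a b hab' with h10 | ⟨rfl, rfl⟩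
        · simpa using h9 a b hab h10
        · rw [hlen]
          simpa using h5
  · have h1 := h.weaken (Q' := Q') fun a b hab hab' => by
      rcases hQ a b hab' with h7 | ⟨rfl, rfl⟩
      · exact h7
      · exact absurd hab hL
    split_ifs with h2 h3 h4
    · exact absurd ⟨hun, hvn, h2, h3, h4⟩ hL
    all_goals first | exact h1 | exact absurd ⟨hun, hvn, h2, h3, by assumption⟩ hL

theorem Found.setN {mark : ℕ → ℕ} {len : ℕ → ℕ → ℝ} {Q : ℕ → ℕ → Prop} {τ : HState}
    (h : Found n cap mark len Q τ) {i : ℕ} (hi : i < 19) (v : ℕ) :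
    Found n cap mark len Q (τ.setN i v) := by
  have h1 : 19 ≠ i := by omega
  have h2 : 20 ≠ i := by omega
  have h3 : 21 ≠ i := by omega
  simpa [Found, h1, h2, h3] using h

theorem found_findEdge {σ : HState} (hE : Env n r D cap p σ) :
    Found n cap (σ.na 1) (fun u v => σ.ra 1 (u * n + v) / cap u v) (fun _ _ => True)
      (findEdge.run σ) := by
  set len : ℕ → ℕ → ℝ := fun u v => σ.ra 1 (u * n + v) / cap u v with hlen
  have key := run_loop (x := 17) (y := 0) (c := .loop 18 0 considerEdge) (σ := σ.setN 19 0)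
    (fun k τ => Found n cap (σ.na 1) len (fun a _ => a < k) τ)
    (.inl ⟨by simp, by simp⟩) (fun k τ v h => h.setN (by norm_num) v) ?_
  · refine Found.weaken key fun u v huv _ => ?_
    simp [hE.nv_n, huv.1]
  intro u hu τ hF hτ h
  have hEτ : Env n r D cap p τ := hE.frame (c := findEdge) (by decide)
    ⟨hF.inp, fun i hi => (hF.nv i (by
      simp only [findEdge, Cmd.modN, Bool.or_eq_false_iff] at hi ⊢
      exact hi.2)).trans (by
      simp only [findEdge, Cmd.modN, Bool.or_eq_false_iff, beq_eq_false_iff_ne] at hi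
      simp [hi.1]), hF.na, hF.rv, hF.ra⟩
  have hun : u < n := by simpa [hE.nv_n] using hu
  have key2 := run_loop (x := 18) (y := 0) (c := considerEdge) (σ := τ)
    (fun k τ => Found n cap (σ.na 1) len (fun a b => a < u ∨ (a = u ∧ b < k)) τ)
    (by simpa using h) (fun k τ v h => h.setN (by norm_num) v) ?_
  · refine Found.weaken key2 fun a b hab h1 => ?_
    have := hab.2.1
    rw [hEτ.nv_n]
    omega
  intro v hv ρ hG hρ h'
  have hvn : v < n := by simpa [hEτ.nv_n] using hv
  have h1 : ρ.na 1 = σ.na 1 := (hG.na 1 rfl).trans (hF.na 1 rfl)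
  have h2 : ρ.ra 1 = σ.ra 1 := (hG.ra 1 rfl).trans (hF.ra 1 rfl)
  rw [← h1] at h' ⊢
  refine found_considerEdge (hEτ.frame (by decide) hG) ((hG.nv 17 rfl).trans hτ) hρ hun hvn
    (by rw [hlen, h2]) h' fun a b hab => ?_
  omega

end RealRAM

namespace RealRAM

variable {n r D : ℕ} {cap : ℕ → ℕ → ℕ} {p : ℝ}

/-- Otherwise the marked vertices would form a cut of value 0 < c. -/
theorem exists_leaves {c : ℕ} (hc : 0 < c)
    (hcut : ∀ D ⊆ range n, D.Nonempty → D ≠ range n →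
      c ≤ ∑ u ∈ D, ∑ v ∈ range n \ D, cap u v)
    {mark : ℕ → ℕ} (hmark : ∀ v < n, mark v = 1 ∨ mark v = 0) {a b : ℕ} (ha : a < n) (hb : b < n)
    (hma : mark a = 1) (hmb : mark b = 0) : ∃ u v, Leaves n cap mark u v := by
  by_contra hne
  push Not at hne
  have h := hcut {v ∈ range n | mark v = 1} (filter_subset _ _) ⟨a, by simp [ha, hma]⟩ fun h => by
    have : b ∈ ({v ∈ range n | mark v = 1} : Finset ℕ) := by rw [h]; simpa using hb
    simp [hmb] at this
  have h0 : ∑ u ∈ range n with mark u = 1, ∑ v ∈ range n \ {v ∈ range n | mark v = 1}, cap u v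
      = 0 := by
    refine sum_eq_zero fun u hu => sum_eq_zero fun v hv => ?_
    simp only [mem_filter, mem_range, mem_sdiff] at hu hv
    by_contra hpos
    refine hne u v ⟨hu.1, hv.1, hu.2, ?_, by omega⟩
    rcases hmark v hv.1 with h1 | h1
    · exact absurd ⟨hv.1, h1⟩ hv.2
    · exact h1
  omega

/-- The marks show the vertices `ord 0, …, ord k`. -/
def Marked (n k : ℕ) (mark ord : ℕ → ℕ) : Prop :=
  ∀ v < n, (mark v = 1 ∧ ∃ i ≤ k, ord i = v) ∨ (mark v = 0 ∧ ∀ i ≤ k, ord i ≠ v)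

/-- The new vertex is unmarked, hence different from all earlier ones. Setting its parent and its
position leaves the earlier data intact, and for the new edge minimality is that of the search. -/
theorem isPrimPrefix_succ {len : ℕ → ℕ → ℝ} {mark ord par : ℕ → ℕ} {k u v : ℕ}
    (h : IsPrimPrefix n (k + 1) cap len ord par) (hm : Marked n k mark ord)
    (hL : Leaves n cap mark u v)
    (hmin : ∀ a b, Leaves n cap mark a b → len u v ≤ len a b) :
    IsPrimPrefix n (k + 2) cap len (Function.update ord (k + 1) v) (Function.update par v u) := by
  obtain ⟨hu, hv, hmu, hmv, hpos⟩ := hL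
  have hnew : ∀ i ≤ k, ord i ≠ v := by
    rcases hm v hv with h1 | h1
    · omega
    · exact h1.2
  obtain ⟨i₀, hi₀, hord⟩ : ∃ i ≤ k, ord i = u := by
    rcases hm u hu with h1 | h1
    · exact h1.2
    · omega
  have hold : ∀ i ≤ k, Function.update ord (k + 1) v i = ord i := fun i hi =>
    Function.update_of_ne (by omega) _ _
  have hpar : ∀ i ≤ k, Function.update par v u (ord i) = par (ord i) := fun i hi =>
    Function.update_of_ne (hnew i hi) _ _
  refine ⟨fun i hi => ?_, fun i hi j hj hij => ?_, fun i h0 hi => ?_, fun i h0 hi => ?_,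
    fun i h0 hi j hj w hw hwj hc => ?_⟩
  · rcases Nat.lt_succ_iff_lt_or_eq.1 hi with h1 | rfl
    · rw [hold i (by omega)]; exact h.ord_lt i h1
    · simpa using hv
  · rcases Nat.lt_succ_iff_lt_or_eq.1 hi with h1 | rfl <;>
      rcases Nat.lt_succ_iff_lt_or_eq.1 hj with h2 | rfl
    · rw [hold i (by omega), hold j (by omega)] at hij
      exact h.inj i h1 j h2 hij
    · rw [hold i (by omega), Function.update_self] at hij
      exact absurd hij (hnew i (by omega))
    · rw [hold j (by omega), Function.update_self] at hij
      exact absurd hij.symm (hnew j (by omega))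
    · rfl
  · rcases Nat.lt_succ_iff_lt_or_eq.1 hi with h1 | rfl
    · rw [hold i (by omega), hpar i (by omega)]
      obtain ⟨j, hj, e⟩ := h.par_mem i h0 h1
      exact ⟨j, hj, by rw [hold j (by omega), e]⟩
    · exact ⟨i₀, by omega, by simp [hold i₀ hi₀, hord]⟩
  · rcases Nat.lt_succ_iff_lt_or_eq.1 hi with h1 | rfl
    · rw [hold i (by omega), hpar i (by omega)]
      exact h.pos i h0 h1
    · simpa using hpos
  · have hwj' : ∀ l < i, ord l ≠ w := fun l hl => by
      rw [← hold l (by omega)]; exact hwj l hl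
    rw [hold j (by omega)] at hc ⊢
    rcases Nat.lt_succ_iff_lt_or_eq.1 hi with h1 | rfl
    · rw [hold i (by omega), hpar i (by omega)]
      exact h.min i h0 h1 j hj w hw hwj' hc
    · simp only [Function.update_self]
      have hjn := h.ord_lt j (by omega)
      refine hmin _ _ ⟨hjn, hw, ?_, ?_, hc⟩
      · rcases hm _ hjn with h1 | h1
        · exact h1.1
        · exact absurd rfl (h1.2 j (by omega))
      · rcases hm w hw with h1 | h1
        · obtain ⟨l, hl, e⟩ := h1.2
          exact absurd e (hwj' l (by omega))
        · exact h1.1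

theorem marked_succ {mark ord : ℕ → ℕ} {k v : ℕ} (hm : Marked n k mark ord) :
    Marked n (k + 1) (Function.update mark v 1) (Function.update ord (k + 1) v) := by
  intro w hw
  have hold : ∀ i ≤ k, Function.update ord (k + 1) v i = ord i := fun i hi =>
    Function.update_of_ne (by omega) _ _
  by_cases hwv : w = v
  · subst hwv
    exact .inl ⟨by simp, k + 1, le_rfl, by simp⟩
  · rw [Function.update_of_ne hwv]
    rcases hm w hw with ⟨h1, i, hi, e⟩ | ⟨h1, h2⟩
    · exact .inl ⟨h1, i, by omega, by rw [hold i hi, e]⟩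
    · refine .inr ⟨h1, fun i hi => ?_⟩
      rcases Nat.lt_succ_iff_lt_or_eq.1 (Nat.lt_succ_of_le hi) with h3 | rfl
      · rw [hold i (by omega)]; exact h2 i (by omega)
      · simpa using Ne.symm hwv

theorem isPrimTree_growTree {σ : HState} (hE : Env n r D cap p σ) (hn : 0 < n) {c : ℕ} (hc : 0 < c)
    (hcut : ∀ D ⊆ range n, D.Nonempty → D ≠ range n →
      c ≤ ∑ u ∈ D, ∑ v ∈ range n \ D, cap u v) :
    IsPrimTree n cap (fun u v => σ.ra 1 (u * n + v) / cap u v)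
      ((growTree.run σ).na 2) ((growTree.run σ).na 3) := by
  set len : ℕ → ℕ → ℝ := fun u v => σ.ra 1 (u * n + v) / cap u v with hlen
  have h0 := run_loop (x := 17) (y := 0) (c := .setA 1 (.var 17) (.lit 0)) (σ := σ)
    (fun k τ => ∀ v < k, τ.na 1 v = 0) (by simp) (fun k τ v h => h) fun k _ τ _ hτ h => by
      intro v hv
      simp only [Cmd.run, NExp.eval, HState.setA_na, hτ, true_and]
      split_ifs with h1
      · rfl
      · exact h v (by omega)
  rw [hE.nv_n] at h0
  set σ₁ := (Cmd.loop 17 0 (.setA 1 (.var 17) (.lit 0))).run σ with hσ₁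
  have hF₁ := frame_run (Cmd.loop 17 0 (.setA 1 (.var 17) (.lit 0))) σ
  rw [← hσ₁] at hF₁
  set σ₂ := (σ₁.setA 1 0 1).setA 2 0 0 with hσ₂
  have hE₂ : Env n r D cap p σ₂ := (hE.frame (by decide) hF₁).congr (fun i _ => rfl)
    (by funext; simp [hσ₂]) rfl rfl rfl
  have hY₂ : σ₂.ra 1 = σ.ra 1 := hF₁.ra 1 rfl
  set body : Cmd := .seq findEdge <| .seq (.setA 1 (.var 21) (.lit 1)) <|
    .seq (.setA 3 (.var 21) (.var 20)) <| .setA 2 (.add (.var 16) (.lit 1)) (.var 21) with hbody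
  change IsPrimTree n cap len (((Cmd.loop 16 9 body).run σ₂).na 2)
    (((Cmd.loop 16 9 body).run σ₂).na 3)
  have key := run_loop (x := 16) (y := 9) (c := body) (σ := σ₂)
    (fun k τ => IsPrimPrefix n (k + 1) cap len (τ.na 2) (τ.na 3) ∧ Marked n k (τ.na 1) (τ.na 2))
    ⟨⟨?_, ?_, ?_, ?_, ?_⟩, ?_⟩ (fun k τ v h => h) ?_
  · rw [hE₂.nv_pred, Nat.sub_add_cancel hn] at key
    exact key.1
  · intro k hk
    rw [show k = 0 by omega]
    simpa [hσ₂] using hn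
  · intro i hi j hj _
    omega
  · intro k h1 h2
    omega
  · intro k h1 h2
    omega
  · intro k h1 h2
    omega
  · intro v hv
    by_cases hv0 : v = 0
    · subst hv0
      exact .inl ⟨by simp [hσ₂], 0, le_rfl, by simp [hσ₂]⟩
    · refine .inr ⟨by simp [hσ₂, hv0, h0 v hv], fun i hi => ?_⟩
      rw [show i = 0 by omega]
      simpa [hσ₂] using Ne.symm hv0
  · intro k hk τ hF hτ ⟨hp, hm⟩
    rw [hE₂.nv_pred] at hk
    have hEτ : Env n r D cap p τ := hE₂.frame (by decide) hF
    have hYτ : τ.ra 1 = σ.ra 1 := (hF.ra 1 rfl).trans hY₂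
    have hf := found_findEdge hEτ
    rw [hYτ] at hf
    set ρ := findEdge.run τ with hρ
    have hFρ := frame_run findEdge τ
    rw [← hρ] at hFρ
    have hmark : ∀ v < n, τ.na 1 v = 1 ∨ τ.na 1 v = 0 := fun v hv => (hm v hv).imp And.left And.left
    -- Only k + 1 < n vertices have been reached, so they cannot cover `range n`.
    obtain ⟨b, hb, hmb⟩ : ∃ b < n, τ.na 1 b = 0 := by
      by_contra hne
      push Not at hne
      have hsub : range n ⊆ (range (k + 1)).image (τ.na 2) := by
        intro v hv
        rw [mem_range] at hv
        rcases hm v hv with ⟨-, i, hi, e⟩ | ⟨h1, -⟩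
        · exact mem_image.2 ⟨i, by simp; omega, e⟩
        · exact absurd h1 (hne v hv)
      have := (card_le_card hsub).trans card_image_le
      simp at this
      omega
    have ha : τ.na 1 (τ.na 2 0) = 1 := by
      rcases hm _ (hp.ord_lt 0 (by omega)) with h1 | h1
      · exact h1.1
      · exact absurd rfl (h1.2 0 (by omega))
    obtain ⟨u₀, v₀, hL₀⟩ := exists_leaves hc hcut hmark (hp.ord_lt 0 (by omega)) hb ha hmb
    have hrun : body.run τ = ((ρ.setA 1 (ρ.nv 21) 1).setA 3 (ρ.nv 21) (ρ.nv 20)).setA 2 (k + 1)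
        (ρ.nv 21) := by
      simp only [hbody, Cmd.run, NExp.eval, HState.setA_nv, ← hρ]
      rw [hFρ.nv 16 rfl, hτ]
    have e1 : (body.run τ).na 1 = Function.update (τ.na 1) (ρ.nv 21) 1 := by
      rw [hrun]; funext j
      simp [Function.update_apply, hFρ.na 1 rfl]
    have e2 : (body.run τ).na 2 = Function.update (τ.na 2) (k + 1) (ρ.nv 21) := by
      rw [hrun]; funext j
      simp [Function.update_apply, hFρ.na 2 rfl]
    have e3 : (body.run τ).na 3 = Function.update (τ.na 3) (ρ.nv 21) (ρ.nv 20) := by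
      rw [hrun]; funext j
      simp [Function.update_apply, hFρ.na 3 rfl]
    rcases hf with ⟨-, hf⟩ | ⟨-, hL, he, hmin⟩
    · exact absurd trivial (hf u₀ v₀ hL₀)
    · rw [e1, e2, e3]
      exact ⟨isPrimPrefix_succ hp hm hL fun a b hab => by
        have := hmin a b hab trivial
        rwa [he] at this, marked_succ hm⟩

/-- Uniqueness of quotient and remainder; used for matrix addresses and again for the codes of
labelings. -/
theorem entry_eq_iff {u v a b : ℕ} (hv : v < n) (hb : b < n) :
    a * n + b = u * n + v ↔ a = u ∧ b = v := by
  constructor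
  · intro h
    have h1 : (a * n + b) / n = (u * n + v) / n := by rw [h]
    have h2 : (a * n + b) % n = (u * n + v) % n := by rw [h]
    have hn : 0 < n := by omega
    rw [mul_comm a, mul_comm u, Nat.mul_add_div hn, Nat.mul_add_div hn, Nat.div_eq_of_lt hb,
      Nat.div_eq_of_lt hv] at h1
    rw [Nat.mul_add_mod', Nat.mul_add_mod', Nat.mod_eq_of_lt hb, Nat.mod_eq_of_lt hv] at h2
    exact ⟨by omega, h2⟩
  · rintro ⟨rfl, rfl⟩; rfl

theorem loadTree_eq {σ : HState} (hE : Env n r D cap p σ)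
    {len : ℕ → ℕ → ℝ} (hT : IsPrimTree n cap len (σ.na 2) (σ.na 3)) {Y : ℕ → ℕ → ℝ}
    (hY : ∀ u < n, ∀ v < n, σ.ra 1 (u * n + v) = Y u v) :
    ∀ u < n, ∀ v < n, (loadTree.run σ).ra 1 (u * n + v) =
      treeBump cap (σ.na 2) (σ.na 3) Y (n - 1) u v := by
  have key := run_loop (x := 16) (y := 9) (σ := σ) (c := .seq (.setN 18 (.get 2 (.add (.var 16)
    (.lit 1)))) <| .seq (.setN 17 (.get 3 (.var 18))) <|
    .seq (.setR 4 (.add (.cast (.lit 1)) (.div (.cast (.lit 1)) (.get 0 (entry 17 18))))) <|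
    .seq (.setRA 1 (entry 17 18) (.mul (.get 1 (entry 17 18)) (.var 4)))
      (.setRA 1 (entry 18 17) (.mul (.get 1 (entry 18 17)) (.var 4))))
    (fun k τ => ∀ u < n, ∀ v < n, τ.ra 1 (u * n + v) =
      treeBump cap (σ.na 2) (σ.na 3) Y k u v) hY (fun k τ v h => h) ?_
  · rwa [hE.nv_pred] at key
  intro k hk τ hF hτ h a ha b hb
  rw [hE.nv_pred] at hk
  have hEτ : Env n r D cap p τ := hE.frame (by decide) hF
  have e2 : τ.na 2 = σ.na 2 := hF.na 2 rfl
  have e3 : τ.na 3 = σ.na 3 := hF.na 3 rfl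
  set v := σ.na 2 (k + 1) with hv
  set u := σ.na 3 v with hu
  have hvn : v < n := hT.ord_lt (k + 1) (by omega)
  have hun : u < n := hT.par_lt (k := k + 1) (by omega) (by omega)
  have huv : u ≠ v := hT.par_ne (k := k + 1) (by omega) (by omega)
  have hab := h a ha b hb
  simp only [Cmd.run, NExp.eval, RExp.eval, eval_entry, HState.setN_nv, HState.setN_na,
    HState.setN_ra, HState.setN_rv, HState.setR_nv, HState.setR_na, HState.setR_ra,
    HState.setR_rv, HState.setRA_nv, HState.setRA_na, HState.setRA_rv, HState.setRA_ra, e2, e3,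
    hτ, ← hv, ← hu, hEτ.row u hun, hEτ.row v hvn, hEτ.mult u hun v hvn, entry_eq_iff hvn hb,
    entry_eq_iff hun hb, entry_eq_iff hvn hun, true_and, if_true, Nat.cast_one, treeBump, bump,
    (by norm_num : ¬ (18 : ℕ) = 17), if_false, hab]
  -- The two orders of the ends are different entries, so the second assignment does not multiply
  -- the first entry again.
  have hne : ¬ (v = u ∧ u = v) := fun h => huv h.2
  by_cases h1 : a = u ∧ b = v
  · obtain ⟨rfl, rfl⟩ := h1
    rw [if_neg fun h => huv h.1, if_pos ⟨rfl, rfl⟩, if_pos (.inl ⟨rfl, rfl⟩), hab]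
  · by_cases h2 : a = v ∧ b = u
    · rw [if_pos h2, if_neg hne, if_pos (Or.inr h2 : (a = u ∧ b = v) ∨ (a = v ∧ b = u))]
      obtain ⟨rfl, rfl⟩ := h2
      rw [hab]
    · rw [if_neg h2, if_neg h1, if_neg (by tauto)]

end RealRAM

/-! ### Enumeration of labelings along a tree -/

namespace RealRAM

variable {n r D : ℕ} {cap : ℕ → ℕ → ℕ} {p : ℝ}

/-- Several pairs may name the same vertex. It is enough to know that the stored label comes from
one of them. -/
theorem setChanges_spec {σ : HState} (hE : Env n r D cap p σ) : ∀ v < n,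
    (∃ i < D, σ.na 4 (i + i) = v ∧ (setChanges.run σ).na 5 v = σ.na 4 (i + i + 1)) ∨
      ((∀ i < D, σ.na 4 (i + i) ≠ v) ∧ (setChanges.run σ).na 5 v = r) := by
  have h0 := run_loop (x := 17) (y := 0) (c := .setA 5 (.var 17) (.var 3)) (σ := σ)
    (fun k τ => ∀ v < k, τ.na 5 v = r) (by simp) (fun k τ v h => h) fun k _ τ hF hτ h => by
      intro v hv
      simp only [Cmd.run, NExp.eval, HState.setA_na, hτ, true_and, hF.nv 3 rfl, hE.nv_r]
      split_ifs with h1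
      · rfl
      · exact h v (by omega)
  rw [hE.nv_n] at h0
  set σ₁ := (Cmd.loop 17 0 (.setA 5 (.var 17) (.var 3))).run σ with hσ₁
  have hF₁ := frame_run (Cmd.loop 17 0 (.setA 5 (.var 17) (.var 3))) σ
  rw [← hσ₁] at hF₁
  have key := run_loop (x := 16) (y := 4) (σ := σ₁) (c := .setA 5 (.get 4 (.add (.var 16)
      (.var 16))) (.get 4 (.add (.add (.var 16) (.var 16)) (.lit 1))))
    (fun k τ => ∀ v < n, (∃ i < k, σ.na 4 (i + i) = v ∧ τ.na 5 v = σ.na 4 (i + i + 1)) ∨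
      ((∀ i < k, σ.na 4 (i + i) ≠ v) ∧ τ.na 5 v = r)) (fun v hv => .inr ⟨by simp, h0 v hv⟩)
    (fun k τ v h => h) fun k hk τ hF hτ h => by
      intro v hv
      simp only [Cmd.run, NExp.eval, HState.setA_na, hτ, true_and, hF.na 4 rfl, hF₁.na 4 rfl]
      by_cases h1 : v = σ.na 4 (k + k)
      · exact .inl ⟨k, by omega, h1.symm, by rw [if_pos h1]⟩
      · rw [if_neg h1]
        rcases h v hv with ⟨i, hi, h2⟩ | ⟨h2, h3⟩
        · exact .inl ⟨i, by omega, h2⟩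
        · refine .inr ⟨fun i hi => ?_, h3⟩
          rcases Nat.lt_succ_iff_lt_or_eq.1 hi with h4 | rfl
          · exact h2 i h4
          · exact Ne.symm h1
  rwa [hF₁.nv 4 rfl, hE.nv_D] at key

/-- How the label changes `ch` determine the labels `F`. -/
def Labeled (r k : ℕ) (ord par ch F : ℕ → ℕ) : Prop :=
  ∀ i < k, F (ord i) = if ch (ord i) < r then ch (ord i) else if i = 0 then 0
    else F (par (ord i))

/-- Vertices in the order are distinct, so a label once set is final, and the label of the parent is
available when it is needed. -/
theorem setLabels_spec {σ : HState} (hE : Env n r D cap p σ) {len : ℕ → ℕ → ℝ}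
    (hT : IsPrimTree n cap len (σ.na 2) (σ.na 3)) :
    Labeled r n (σ.na 2) (σ.na 3) (σ.na 5) ((setLabels.run σ).na 6) := by
  have key := run_loop (x := 16) (y := 0) (σ := σ) (c := .seq (.setN 17 (.get 2 (.var 16))) <|
    .ite (.lt (.get 5 (.var 17)) (.var 3))
      (.setA 6 (.var 17) (.get 5 (.var 17)))
      (.ite (.eq (.var 16) (.lit 0))
        (.setA 6 (.var 17) (.lit 0))
        (.setA 6 (.var 17) (.get 6 (.get 3 (.var 17))))))
    (fun k τ => Labeled r k (σ.na 2) (σ.na 3) (σ.na 5) (τ.na 6)) (fun i hi => by omega)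
    (fun k τ v h => h) fun k hk τ hF hτ h => by
      rw [hE.nv_n] at hk
      simp only [Cmd.run, NExp.eval, Cond.Holds, HState.setN_nv, HState.setN_na, hτ, hF.na 2 rfl,
        hF.na 5 rfl, hF.na 3 rfl, hF.nv 3 rfl, hE.nv_r, if_true, (by norm_num : ¬ (3 : ℕ) = 17),
        (by norm_num : ¬ (16 : ℕ) = 17), if_false]
      set v := σ.na 2 k with hv
      have hval : ∀ z, ∀ i < k + 1, ((τ.setN 17 v).setA 6 v z).na 6 (σ.na 2 i) =
          if i = k then z else τ.na 6 (σ.na 2 i) := by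
        intro z i hi
        simp only [HState.setA_na, true_and, HState.setN_na]
        by_cases h1 : i = k
        · rw [if_pos h1, if_pos (by rw [h1])]
        · rw [if_neg h1, if_neg fun h2 => h1 (hT.inj i (by omega) k hk h2)]
      have hpar : ∀ z, ∀ i < k + 1, i ≠ 0 → ((τ.setN 17 v).setA 6 v z).na 6 (σ.na 3 (σ.na 2 i)) =
          τ.na 6 (σ.na 3 (σ.na 2 i)) := by
        intro z i hi hi0
        obtain ⟨j, hj, e⟩ := hT.par_mem i (by omega) (by omega)
        rw [e, hval z j (by omega), if_neg (by omega)]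
      have step : ∀ z, z = (if σ.na 5 v < r then σ.na 5 v else if k = 0 then 0 else
          τ.na 6 (σ.na 3 v)) →
          Labeled r (k + 1) (σ.na 2) (σ.na 3) (σ.na 5) (((τ.setN 17 v).setA 6 v z).na 6) := by
        intro z hz i hi
        rw [hval z i hi]
        by_cases h1 : i = k
        · subst h1
          rw [if_pos rfl, hz]
          split_ifs with h2 h3
          · rfl
          · rfl
          · exact (hpar _ i hi h3).symm
        · rw [if_neg h1, h i (by omega)]
          split_ifs with h2 h3
          · rfl
          · rfl
          · exact (hpar _ i hi h3).symm
      split_ifs with h1 h2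
      · exact step _ (by rw [if_pos h1])
      · exact step _ (by rw [if_neg h1, if_pos h2])
      · exact step _ (by rw [if_neg h1, if_neg h2])
  rwa [hE.nv_n] at key

theorem exists_ord_eq {len : ℕ → ℕ → ℝ} {ord par : ℕ → ℕ} (hT : IsPrimTree n cap len ord par)
    {v : ℕ} (hv : v < n) : ∃ k < n, ord k = v := by
  have h1 : (range n).image ord = range n := by
    refine eq_of_subset_of_card_le ?_ ?_
    · intro a ha
      obtain ⟨k, hk, rfl⟩ := mem_image.1 ha
      exact mem_range.2 (hT.ord_lt k (mem_range.1 hk))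
    · rw [card_image_of_injOn]
      intro i hi j hj h
      exact hT.inj i (by simpa using hi) j (by simpa using hj) h
  have h2 : v ∈ (range n).image ord := by rw [h1]; exact mem_range.2 hv
  obtain ⟨k, hk, h⟩ := mem_image.1 h2
  exact ⟨k, mem_range.1 hk, h⟩

theorem Labeled.lt {len : ℕ → ℕ → ℝ} {ord par ch F : ℕ → ℕ} (h : Labeled r n ord par ch F)
    (hT : IsPrimTree n cap len ord par) (hr : 0 < r) : ∀ v < n, F v < r := by
  have key : ∀ k < n, F (ord k) < r := by
    intro k
    induction k using Nat.strong_induction_on with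
    | _ k ih =>
      intro hk
      rw [h k hk]
      split_ifs with h1 h2
      · exact h1
      · exact hr
      · obtain ⟨j, hj, e⟩ := hT.par_mem k (by omega) hk
        rw [e]
        exact ih j hj (by omega)
  intro v hv
  obtain ⟨k, hk, rfl⟩ := exists_ord_eq hT hv
  exact key k hk

/-- By induction along the order: a label is either given directly or inherited over a tree edge
that f does not cut. The root has no parent to inherit from and must be given directly. -/
theorem Labeled.eq {len : ℕ → ℕ → ℝ} {ord par ch F f : ℕ → ℕ} (h : Labeled r n ord par ch F)
    (hT : IsPrimTree n cap len ord par) (hf : ∀ v < n, f v < r)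
    (hch : ∀ k < n, ch (ord k) = f (ord k) ∨
      (ch (ord k) = r ∧ k ≠ 0 ∧ f (par (ord k)) = f (ord k))) : ∀ v < n, F v = f v := by
  have key : ∀ k < n, F (ord k) = f (ord k) := by
    intro k
    induction k using Nat.strong_induction_on with
    | _ k ih =>
      intro hk
      rw [h k hk]
      rcases hch k hk with h1 | ⟨h1, h2, h3⟩
      · rw [h1, if_pos (hf _ (hT.ord_lt k hk))]
      · obtain ⟨j, hj, e⟩ := hT.par_mem k (by omega) hk
        rw [if_neg (by omega), if_neg h2, ← h3, e]
        exact ih j hj (by omega)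
  intro v hv
  obtain ⟨k, hk, rfl⟩ := exists_ord_eq hT hv
  exact key k hk

/-- Digits that make `setChanges` and `setLabels` produce a given labeling. -/
theorem exists_digits {len : ℕ → ℕ → ℝ} {ord par f : ℕ → ℕ} (hT : IsPrimTree n cap len ord par)
    (hn : 0 < n) (hf : ∀ v < n, f v < r) (hD : treeCrossings n ord par f < D) :
    ∃ t < (n + r) ^ (D + D), ∀ g ch F : ℕ → ℕ,
      (∀ i < D + D, g i = t / (n + r) ^ i % (n + r)) →
      (∀ v < n, (∃ i < D, g (i + i) = v ∧ ch v = g (i + i + 1)) ∨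
        ((∀ i < D, g (i + i) ≠ v) ∧ ch v = r)) →
      Labeled r n ord par ch F → ∀ v < n, F v = f v := by
  have hr : 0 < r := (Nat.zero_le _).trans_lt (hf 0 hn)
  -- The positions whose labels have to be given: the root and the later ends of the cut tree edges.
  -- The strict inequality in `hD` leaves room for the root.
  set S : Finset ℕ := insert 0 {k ∈ Ico 1 n | f (par (ord k)) ≠ f (ord k)} with hS
  have hScard : #S ≤ D := (card_insert_le _ _).trans hD
  have hSn : ∀ k ∈ S, k < n := by
    intro k hk
    rcases mem_insert.1 hk with rfl | h
    · exact hn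
    · exact (mem_Ico.1 (mem_filter.1 h).1).2
  obtain ⟨e, he, hes⟩ : ∃ e : ℕ → ℕ, (∀ i < #S, e i ∈ S) ∧ ∀ k ∈ S, ∃ i < #S, e i = k := by
    refine ⟨fun i => if h : i < #S then S.equivFin.symm ⟨i, h⟩ else 0, fun i hi => ?_,
      fun k hk => ⟨S.equivFin ⟨k, hk⟩, (S.equivFin ⟨k, hk⟩).isLt, ?_⟩⟩
    · simp only [hi, dif_pos]
      exact coe_mem _
    · simp
  -- Even digits are vertices and odd digits their labels. Unused pairs get n, which names no
  -- vertex.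
  set G : ℕ → ℕ := fun i => if i / 2 < #S then
    if i % 2 = 0 then ord (e (i / 2)) else f (ord (e (i / 2))) else
    if i % 2 = 0 then n else r with hG
  have hGlt : ∀ i, G i < n + r := by
    intro i
    simp only [hG]
    split_ifs with h1 h2 h2
    · have := hT.ord_lt _ (hSn _ (he _ h1)); omega
    · have := hf _ (hT.ord_lt _ (hSn _ (he _ h1))); omega
    · omega
    · omega
  set T := finFunctionFinEquiv (fun i : Fin (D + D) => (⟨G i, hGlt i⟩ : Fin (n + r))) with hT'
  have hdig : ∀ i < D + D, (T : ℕ) / (n + r) ^ i % (n + r) = G i := by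
    intro i hi
    have h1 := finFunctionFinEquiv_symm_apply_val T ⟨i, hi⟩
    rw [hT', Equiv.symm_apply_apply] at h1
    exact h1.symm
  refine ⟨T, T.isLt, fun g ch F hg hch hF => hF.eq hT hf fun k hk => ?_⟩
  have hg0 : ∀ i < D, g (i + i) = if i < #S then ord (e i) else n := by
    intro i hi
    rw [hg _ (by omega), hdig _ (by omega)]
    simp only [hG, show (i + i) / 2 = i by omega, show (i + i) % 2 = 0 by omega, if_true]
  have hg1 : ∀ i < D, i < #S → g (i + i + 1) = f (ord (e i)) := by
    intro i hi hi'
    rw [hg _ (by omega), hdig _ (by omega)]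
    simp only [hG, show (i + i + 1) / 2 = i by omega, show (i + i + 1) % 2 = 1 by omega]
    simp [hi']
  rcases hch (ord k) (hT.ord_lt k hk) with ⟨i, hi, h1, h2⟩ | ⟨h1, h2⟩
  · rw [hg0 i hi] at h1
    split_ifs at h1 with h3
    · left
      rw [h2, hg1 i hi h3, h1]
    · have := hT.ord_lt k hk
      omega
  · right
    have hkS : k ∉ S := by
      intro hkS
      obtain ⟨i, hi, h3⟩ := hes k hkS
      refine h1 i (by omega) ?_
      rw [hg0 i (by omega), if_pos hi, h3]
    simp only [hS, mem_insert, mem_filter, mem_Ico, not_or, not_and, not_not] at hkS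
    exact ⟨h2, hkS.1, hkS.2 ⟨by omega, hk⟩⟩

/-- The carry into position k is 1 exactly when B^k divides t + 1, where B is the base; this is the
invariant that turns the digits of t into those of t + 1. -/
theorem nextDigits_spec {σ : HState} (hE : Env n r D cap p σ) (hB : 0 < n + r) {t : ℕ}
    (h : ∀ i < D + D, σ.na 4 i = t / (n + r) ^ i % (n + r)) :
    ∀ i < D + D, (nextDigits.run σ).na 4 i = (t + 1) / (n + r) ^ i % (n + r) := by
  set B := n + r with hBdef
  have key := run_loop (x := 16) (y := 5) (σ := σ.setN 19 1)
    (c := .seq (.setN 20 (.add (.get 4 (.var 16)) (.var 19))) <|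
      .ite (.eq (.var 20) (.var 7))
        (.setA 4 (.var 16) (.lit 0))
        (.seq (.setA 4 (.var 16) (.var 20)) (.setN 19 (.lit 0))))
    (fun k τ => (∀ i < k, τ.na 4 i = (t + 1) / B ^ i % B) ∧
      (∀ i < D + D, k ≤ i → τ.na 4 i = t / B ^ i % B) ∧
      τ.nv 19 = if B ^ k ∣ t + 1 then 1 else 0) ⟨by simp, fun i hi _ => by simpa using h i hi,
        by simp⟩
    (fun k τ v h => ⟨h.1, h.2.1, by simpa using h.2.2⟩) fun k hk τ hF hτ ⟨h1, h2, h3⟩ => by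
      have hk' : k < D + D := by simpa [hE.nv_digits] using hk
      have e7 : τ.nv 7 = B := by rw [hF.nv 7 rfl]; simpa using hE.nv_base
      have hdiv : (t + 1) / B ^ k = t / B ^ k + if B ^ k ∣ t + 1 then 1 else 0 := Nat.succ_div
      have hlt := Nat.mod_lt (t / B ^ k) hB
      have hnew : (t + 1) / B ^ k % B = if t / B ^ k % B + τ.nv 19 = B then 0 else
          t / B ^ k % B + τ.nv 19 := by
        rw [hdiv, ← h3, Nat.add_mod]
        have h19 : τ.nv 19 ≤ 1 := by rw [h3]; split_ifs <;> omega
        rcases Nat.lt_or_ge 1 B with hB1 | hB1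
        · rw [Nat.mod_eq_of_lt (by omega : τ.nv 19 < B)]
          split_ifs with h4
          · rw [h4, Nat.mod_self]
          · exact Nat.mod_eq_of_lt (by omega)
        -- In base 1 all digits are 0, and each of them passes the carry on.
        · have hB1' : B = 1 := by omega
          rw [hB1', Nat.mod_one, Nat.mod_one]
          split_ifs <;> omega
      have hcarry : (B ^ (k + 1) ∣ t + 1) ↔ (B ^ k ∣ t + 1 ∧ t / B ^ k % B + τ.nv 19 = B) := by
        constructor
        · intro h4
          have h5 : B ^ k ∣ t + 1 := (pow_dvd_pow B (Nat.le_succ k)).trans h4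
          refine ⟨h5, ?_⟩
          obtain ⟨q, hq⟩ := h4
          have h6 : (t + 1) / B ^ k % B = 0 := by
            rw [hq, pow_succ, mul_assoc, Nat.mul_div_cancel_left _ (pow_pos hB k),
              Nat.mul_mod_right]
          rw [hnew] at h6
          rw [h3, if_pos h5] at h6 ⊢
          split_ifs at h6 with h7
          · exact h7
        · rintro ⟨h5, h6⟩
          rw [if_pos h6] at hnew
          obtain ⟨q, hq⟩ := h5
          rw [hq, Nat.mul_div_cancel_left _ (pow_pos hB k)] at hnew
          rw [hq, pow_succ]
          exact Nat.mul_dvd_mul_left _ (Nat.dvd_of_mod_eq_zero hnew)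
      simp only [Cmd.run, NExp.eval, Cond.Holds, HState.setN_nv, hτ, if_true, e7,
        (by norm_num : ¬ (7 : ℕ) = 20), (by norm_num : ¬ (16 : ℕ) = 20), if_false,
        h2 k hk' le_rfl]
      by_cases h4 : t / B ^ k % B + τ.nv 19 = B
      · rw [if_pos h4]
        refine ⟨fun i hi => ?_, fun i hi hki => ?_, ?_⟩
        · simp only [HState.setA_na, true_and]
          split_ifs with h5
          · subst h5; rw [hnew, if_pos h4]
          · exact h1 i (by omega)
        · simp only [HState.setA_na, true_and]
          rw [if_neg (by omega)]
          exact h2 i hi (by omega)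
        · simp only [HState.setA_nv, HState.setN_nv, (by norm_num : ¬ (19 : ℕ) = 20), if_false]
          have h5 : B ^ k ∣ t + 1 := by
            by_contra h5
            rw [h3, if_neg h5] at h4
            omega
          rw [h3, if_pos h5, if_pos (hcarry.2 ⟨h5, h4⟩)]
      · rw [if_neg h4]
        refine ⟨fun i hi => ?_, fun i hi hki => ?_, ?_⟩
        · simp only [HState.setN_na, HState.setA_na, true_and]
          split_ifs with h5
          · subst h5; rw [hnew, if_neg h4]
          · exact h1 i (by omega)
        · simp only [HState.setN_na, HState.setA_na, true_and]
          rw [if_neg (by omega)]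
          exact h2 i hi (by omega)
        · rw [if_neg fun h => h4 (hcarry.1 h).2]
          simp
  have e5 : (σ.setN 19 1).nv 5 = D + D := by simpa using hE.nv_digits
  rw [e5] at key
  exact key.1

end RealRAM

/-! ### Counting every labeling once -/

namespace RealRAM

variable {n m r D : ℕ} {cap : ℕ → ℕ → ℕ} {p : ℝ}

/-- The number with the digits `F 0, …, F (k - 1)` in base `r`. -/
def code (r : ℕ) (F : ℕ → ℕ) : ℕ → ℕ
  | 0 => 0
  | k + 1 => code r F k * r + F k

theorem code_inj {F F' : ℕ → ℕ} {k : ℕ} (hF : ∀ v < k, F v < r) (hF' : ∀ v < k, F' v < r) :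
    code r F k = code r F' k ↔ ∀ v < k, F v = F' v := by
  induction k with
  | zero => simp [code]
  | succ k ih =>
    have ih := ih (fun v hv => hF v (by omega)) (fun v hv => hF' v (by omega))
    simp only [code]
    rw [entry_eq_iff (hF' k (by omega)) (hF k (by omega)), ih]
    exact ⟨fun h v hv => (Nat.lt_succ_iff_lt_or_eq.1 hv).elim (h.1 v) fun e => e ▸ h.2,
      fun h => ⟨fun v hv => h v (by omega), h k (by omega)⟩⟩

theorem encode_spec {σ : HState} (hE : Env n r D cap p σ) :
    (encode.run σ).nv 19 = code r (σ.na 6) n ∧ (encode.run σ).nv 20 = (range n).sup (σ.na 6) := by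
  have key := run_loop (x := 17) (y := 0) (σ := (σ.setN 19 0).setN 20 0)
    (c := .seq (mulCmd 21 19 16 3) <|
      .seq (.setN 19 (.add (.var 21) (.get 6 (.var 17)))) <|
      .ite (.lt (.var 20) (.get 6 (.var 17))) (.setN 20 (.get 6 (.var 17))) .skip)
    (fun k τ => τ.nv 19 = code r (σ.na 6) k ∧ τ.nv 20 = (range k).sup (σ.na 6))
    (by simp [code]) (fun k τ v h => by simpa using h) fun k hk τ hF hτ ⟨h1, h2⟩ => by
      have hm := run_mulCmd (z := 21) (x := 19) (c := 16) (y := 3) τ (by norm_num) (by norm_num)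
        (by norm_num) (by norm_num)
      have hG := frame_run (mulCmd 21 19 16 3) τ
      set ρ := (mulCmd 21 19 16 3).run τ with hρ
      have e3 : τ.nv 3 = r := by rw [hF.nv 3 rfl]; simpa using hE.nv_r
      have e6 : τ.na 6 = σ.na 6 := hF.na 6 rfl
      rw [h1, e3] at hm
      simp only [Cmd.run, NExp.eval, Cond.Holds, ← hρ, HState.setN_nv, HState.setN_na, hm,
        hG.nv 17 rfl, hτ, hG.nv 20 rfl, hG.na 6 rfl, e6, h2, (by norm_num : ¬ (17 : ℕ) = 19),
        (by norm_num : ¬ (20 : ℕ) = 19), if_false]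
      rw [range_add_one, sup_insert]
      split_ifs with h
      · simp [code, h.le]
      · simp only [not_lt] at h
        simp [code, hG.nv 20 rfl, h2, h]
  have e0 : ((σ.setN 19 0).setN 20 0).nv 0 = n := by simpa using hE.nv_n
  rw [e0] at key
  exact key

/-- The ends of a cut edge have different labels, hence are different, and so exactly one order of
them is increasing. -/
theorem _root_.Network.sum_multiplicity_lt (G : Network n m) (f : ℕ → ℕ) :
    ∑ x ∈ range n ×ˢ range n, (if x.1 < x.2 ∧ f x.1 ≠ f x.2 then G.multiplicity x.1 x.2 else 0) =
      #(G.cutEdges fun v => f v) := by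
  rw [← sum_filter, G.sum_multiplicity, ← card_union_of_disjoint]
  · congr 1
    ext e
    simp only [mem_union, mem_filter, mem_univ, true_and, mem_product, mem_range, Fin.is_lt,
      Network.cutEdges]
    have : f (G.ends e).1 ≠ f (G.ends e).2 → ((G.ends e).1 : ℕ) ≠ (G.ends e).2 := by
      intro h h'
      rw [h'] at h
      exact h rfl
    constructor
    · rintro (h | h)
      · exact h.2
      · exact h.2.symm
    · intro h
      rcases lt_or_gt_of_ne (this h) with h1 | h1
      · exact .inl ⟨h1, h⟩
      · exact .inr ⟨h1, Ne.symm h⟩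
  · rw [disjoint_left]
    intro e h1 h2
    simp only [mem_filter, mem_univ, true_and] at h1 h2
    omega

theorem cutProbability_spec (G : Network n m) {σ : HState}
    (hE : Env n r D G.multiplicity p σ) :
    (cutProbability.run σ).rv 4 = p ^ #(G.cutEdges fun v => σ.na 6 v) := by
  set F := σ.na 6 with hF6
  -- Pairs that the program skips get exponent 0, so that the invariants are full products over
  -- ranges.
  set w : ℕ → ℕ → ℝ := fun a b =>
    p ^ (if a < b ∧ F a ≠ F b then G.multiplicity a b else 0) with hw
  have key := run_loop (x := 17) (y := 0) (σ := σ.setR 4 1) (c := .loop 18 0 <|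
    .ite (.lt (.var 17) (.var 18))
      (.ite (.eq (.get 6 (.var 17)) (.get 6 (.var 18))) .skip
        (.setR 4 (.mul (.var 4) (.get 2 (entry 17 18)))))
      .skip)
    (fun k τ => τ.rv 4 = ∏ a ∈ range k, ∏ b ∈ range n, w a b) (by simp) (fun k τ v h => h) ?_
  · have e0 : (σ.setR 4 1).nv 0 = n := hE.nv_n
    rw [e0] at key
    have e : cutProbability.run σ = (Cmd.loop 17 0 (.loop 18 0 <|
      .ite (.lt (.var 17) (.var 18))
        (.ite (.eq (.get 6 (.var 17)) (.get 6 (.var 18))) .skip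
          (.setR 4 (.mul (.var 4) (.get 2 (entry 17 18)))))
        .skip)).run (σ.setR 4 1) := by
      simp [cutProbability, Cmd.run, RExp.eval, NExp.eval]
    rw [e, key, ← prod_product', hw]
    simp only
    rw [prod_pow_eq_pow_sum, G.sum_multiplicity_lt]
  intro u hu τ hF hτ h
  have hEτ : Env n r D G.multiplicity p τ :=
    (hE.congr (fun _ _ => rfl) rfl rfl rfl rfl : Env n r D G.multiplicity p (σ.setR 4 1)).frame
      (by decide) hF
  have hun : u < n := by simpa [hE.nv_n] using hu
  have key2 := run_loop (x := 18) (y := 0) (σ := τ) (c :=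
    .ite (.lt (.var 17) (.var 18))
      (.ite (.eq (.get 6 (.var 17)) (.get 6 (.var 18))) .skip
        (.setR 4 (.mul (.var 4) (.get 2 (entry 17 18)))))
      .skip)
    (fun k τ => τ.rv 4 = (∏ a ∈ range u, ∏ b ∈ range n, w a b) * ∏ b ∈ range k, w u b)
    (by simpa using h) (fun k τ v h => h) ?_
  · rw [hEτ.nv_n] at key2
    rw [key2, prod_range_succ]
  intro v hv ρ hG hρ h'
  have hvn : v < n := by simpa [hEτ.nv_n] using hv
  have hEρ := hEτ.frame (by decide) hG
  have e6 : ρ.na 6 = F := (hG.na 6 rfl).trans (hF.na 6 rfl)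
  have e17 : ρ.nv 17 = u := (hG.nv 17 rfl).trans hτ
  simp only [Cmd.run, NExp.eval, RExp.eval, Cond.Holds, eval_entry, e6, e17, hρ, hEρ.row u hun,
    hEρ.pow u hun v hvn]
  rw [prod_range_succ, ← mul_assoc, ← h']
  simp only [hw]
  split_ifs with h1 h2 h3 h4 h5
  all_goals first | (exact absurd h2 (by tauto)) | simp | tauto

/-- The labelings in `S` have been taken into account. -/
structure Seen (G : Network n m) (r : ℕ) (p : ℝ) (S : Finset (Fin n → ℕ)) (σ : HState) : Prop where
  sub : S ⊆ Network.labelings n r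
  mark : ∀ c, σ.na 7 c ≠ 0 ↔ ∃ F : ℕ → ℕ, (fun v : Fin n => F v) ∈ S ∧ code r F n = c
  acc : σ.rv 3 = ∑ f ∈ S, labelWeight r (univ.sup f) * p ^ #(G.cutEdges f)

theorem Seen.congr {G : Network n m} {S : Finset (Fin n → ℕ)} {σ τ : HState} (h : Seen G r p S σ)
    (h7 : τ.na 7 = σ.na 7) (h3 : τ.rv 3 = σ.rv 3) : Seen G r p S τ :=
  ⟨h.sub, by rw [h7]; exact h.mark, by rw [h3]; exact h.acc⟩

theorem sup_univ_eq (F : ℕ → ℕ) : univ.sup (fun v : Fin n => F v) = (range n).sup F := by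
  refine le_antisymm (Finset.sup_le fun v _ => Finset.le_sup (f := F) (mem_range.2 v.isLt))
    (Finset.sup_le fun v hv => ?_)
  exact Finset.le_sup (f := fun v : Fin n => F v) (mem_univ ⟨v, mem_range.1 hv⟩)

theorem labelWeight_eq {M : ℕ} (hM : M ≤ r) : labelWeight r M =
    ∑ j ∈ Icc 1 r, extrapolationCoeff r j - ∑ j ∈ Icc 1 M, extrapolationCoeff r j := by
  rw [eq_sub_iff_add_eq, add_comm, labelWeight, ← sum_union]
  · congr 1
    ext j
    simp only [mem_union, mem_Icc, mem_Ioc]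
    omega
  · rw [disjoint_left]
    intro j h1 h2
    simp only [mem_Icc, mem_Ioc] at h1 h2
    omega

/-- Labels are below r, so equal codes mean equal labelings. A nonzero mark thus shows that this
very labeling has been counted, and then the insertion changes nothing. -/
theorem account_spec {G : Network n m} {σ : HState} (hE : Env n r D G.multiplicity p σ)
    {S : Finset (Fin n → ℕ)} (h : Seen G r p S σ) (hF : ∀ v < n, σ.na 6 v < r)
    (hc : σ.nv 19 = code r (σ.na 6) n) (hM : σ.nv 20 = (range n).sup (σ.na 6)) :
    Seen G r p (insert (fun v : Fin n => σ.na 6 v) S) (account.run σ) := by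
  set F := σ.na 6 with hF6
  rw [account, Cmd.run]
  by_cases h0 : σ.na 7 (σ.nv 19) = 0
  · rw [if_pos (show Cond.Holds σ (.eq (.get 7 (.var 19)) (.lit 0)) from h0)]
    simp only [Cmd.run, NExp.eval]
    have hFS : (fun v : Fin n => F v) ∉ S := fun hFS =>
      (h.mark (σ.nv 19)).2 ⟨F, hFS, hc.symm⟩ h0
    have hE' : Env n r D G.multiplicity p (σ.setA 7 (σ.nv 19) 1) :=
      hE.congr (fun _ _ => rfl) (by funext; simp) rfl rfl rfl
    have hfr := frame_run cutProbability (σ.setA 7 (σ.nv 19) 1)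
    have hp := cutProbability_spec G hE'
    have hEρ := hE'.run (c := cutProbability) (by decide)
    have h6 : (σ.setA 7 (σ.nv 19) 1).na 6 = F := by funext; simp [hF6]
    rw [h6] at hp
    set ρ := cutProbability.run (σ.setA 7 (σ.nv 19) 1) with hρ
    have hMr : (range n).sup F ≤ r :=
      Finset.sup_le fun v hv => (hF v (mem_range.1 hv)).le
    refine ⟨?_, fun c => ?_, ?_⟩
    · rw [insert_subset_iff, Network.mem_labelings]
      exact ⟨fun v => hF v v.isLt, h.sub⟩
    · simp only [HState.setR_na, hfr.na 7 rfl, HState.setA_na, true_and, mem_insert]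
      split_ifs with h1
      · simp only [ne_eq, one_ne_zero, not_false_eq_true, true_iff]
        exact ⟨F, .inl rfl, by rw [h1, hc]⟩
      · rw [h.mark]
        refine exists_congr fun F' => and_congr_left fun h2 => ?_
        refine ⟨.inr, fun h3 => h3.resolve_left fun h4 => h1 ?_⟩
        rw [← h2, hc]
        have : ∀ v < n, F' v = F v := fun v hv => congrFun h4 ⟨v, hv⟩
        exact (code_inj (fun v hv => by rw [this v hv]; exact hF v hv) hF).2 this
    · rw [sum_insert hFS, sup_univ_eq, labelWeight_eq hMr, ← h.acc]
      have e3 : ρ.nv 3 = r := hEρ.nv_r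
      have e20 : ρ.nv 20 = (range n).sup F := (hfr.nv 20 rfl).trans hM
      have er : ρ.rv 3 = σ.rv 3 := hfr.rv 3 rfl
      simp only [RExp.eval, NExp.eval, HState.setR_rv, if_true, e3, e20, er, hp,
        hEρ.coeff _ le_rfl, hEρ.coeff _ hMr]
      ring
  · rw [if_neg (show ¬ Cond.Holds σ (.eq (.get 7 (.var 19)) (.lit 0)) from h0)]
    obtain ⟨F', h1, h2⟩ := (h.mark _).1 h0
    have hF' := Network.mem_labelings.1 (h.sub h1)
    have h3 := (code_inj (fun v hv => hF' ⟨v, hv⟩) hF).1 (h2.trans hc)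
    have h4 : (fun v : Fin n => F v) = fun v : Fin n => F' v := by
      funext v
      exact (h3 v v.isLt).symm
    rw [h4, insert_eq_self.2 h1]
    exact h

theorem tryLabelings_spec {G : Network n m} {σ : HState} (hE : Env n r D G.multiplicity p σ)
    (hn : 0 < n) (hr : 0 < r) {len : ℕ → ℕ → ℝ}
    (hT : IsPrimTree n G.multiplicity len (σ.na 2) (σ.na 3)) {S : Finset (Fin n → ℕ)}
    (h : Seen G r p S σ) :
    ∃ S', S ⊆ S' ∧ Seen G r p S' (tryLabelings.run σ) ∧ ∀ f : ℕ → ℕ, (∀ v < n, f v < r) →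
      treeCrossings n (σ.na 2) (σ.na 3) f < D → (fun v : Fin n => f v) ∈ S' := by
  have h0 := run_loop (x := 16) (y := 5) (c := .setA 4 (.var 16) (.lit 0)) (σ := σ)
    (fun k τ => ∀ i < k, τ.na 4 i = 0) (by simp) (fun k τ v h => h) fun k _ τ _ hτ h => by
      intro v hv
      simp only [Cmd.run, NExp.eval, HState.setA_na, hτ, true_and]
      split_ifs with h1
      · rfl
      · exact h v (by omega)
  rw [hE.nv_digits] at h0
  set σ₁ := (Cmd.loop 16 5 (.setA 4 (.var 16) (.lit 0))).run σ with hσ₁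
  have hF₁ := frame_run (Cmd.loop 16 5 (.setA 4 (.var 16) (.lit 0))) σ
  rw [← hσ₁] at hF₁
  have hE₁ : Env n r D G.multiplicity p σ₁ := hE.frame (by decide) hF₁
  -- After k sequences the array holds the digits of k. Coverage is stated as in `exists_digits`: a
  -- labeling is in S' once some t < k has digits that can only produce that labeling.
  have key := run_loop (x := 15) (y := 8) (σ := σ₁)
    (c := .seq setChanges <| .seq setLabels <| .seq encode <| .seq account nextDigits)
    (fun k τ => (∀ i < D + D, τ.na 4 i = k / (n + r) ^ i % (n + r)) ∧
      ∃ S', S ⊆ S' ∧ Seen G r p S' τ ∧ ∀ f : ℕ → ℕ, ∀ t < k, (∀ g ch F : ℕ → ℕ,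
        (∀ i < D + D, g i = t / (n + r) ^ i % (n + r)) →
        (∀ v < n, (∃ i < D, g (i + i) = v ∧ ch v = g (i + i + 1)) ∨
          ((∀ i < D, g (i + i) ≠ v) ∧ ch v = r)) →
        Labeled r n (σ.na 2) (σ.na 3) ch F → ∀ v < n, F v = f v) →
        (fun v : Fin n => f v) ∈ S')
    ⟨fun i hi => by simp [h0 i hi], S, Subset.rfl, h.congr (hF₁.na 7 rfl) (hF₁.rv 3 rfl),
      by simp⟩ (fun k τ v h => ⟨h.1, h.2.imp fun S' h' => ⟨h'.1, h'.2.1.congr rfl rfl, h'.2.2⟩⟩) ?_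
  · obtain ⟨-, S', h1, h2, h3⟩ := key
    refine ⟨S', h1, h2, fun f hf hfD => ?_⟩
    obtain ⟨t, ht, h4⟩ := exists_digits hT hn hf hfD
    exact h3 f t (by rw [hE₁.nv_count]; exact ht) h4
  intro k hk τ hF hτ ⟨hd, S', hS, hseen, hcov⟩
  have hEτ := hE₁.frame (by decide) hF
  have e2 : τ.na 2 = σ.na 2 := (hF.na 2 rfl).trans (hF₁.na 2 rfl)
  have e3 : τ.na 3 = σ.na 3 := (hF.na 3 rfl).trans (hF₁.na 3 rfl)
  simp only [Cmd.run]
  have hchg := setChanges_spec hEτ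
  have fA := frame_run setChanges τ
  have EA := hEτ.run (c := setChanges) (by decide)
  set τA := setChanges.run τ
  have a2 : τA.na 2 = σ.na 2 := (fA.na 2 rfl).trans e2
  have a3 : τA.na 3 = σ.na 3 := (fA.na 3 rfl).trans e3
  have hlab := setLabels_spec EA (len := len) (by rw [a2, a3]; exact hT)
  have fB := frame_run setLabels τA
  have EB := EA.run (c := setLabels) (by decide)
  set τB := setLabels.run τA
  obtain ⟨hcode, hsup⟩ := encode_spec EB
  have fC := frame_run encode τB
  have EC := EB.run (c := encode) (by decide)
  set τC := encode.run τB
  have hC6 : τC.na 6 = τB.na 6 := fC.na 6 rfl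
  rw [a2, a3] at hlab
  have hlt := hlab.lt hT hr
  have hseenC : Seen G r p S' τC := hseen.congr
    ((fC.na 7 rfl).trans ((fB.na 7 rfl).trans (fA.na 7 rfl)))
    ((fC.rv 3 rfl).trans ((fB.rv 3 rfl).trans (fA.rv 3 rfl)))
  have hacc := account_spec EC hseenC (by rw [hC6]; exact hlt) (by rw [hC6, hcode])
    (by rw [hC6, hsup])
  have fD := frame_run account τC
  have ED := EC.run (c := account) (by decide)
  set τD := account.run τC
  have hD4 : τD.na 4 = τ.na 4 :=
    (fD.na 4 rfl).trans ((fC.na 4 rfl).trans ((fB.na 4 rfl).trans (fA.na 4 rfl)))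
  have hnext := nextDigits_spec ED (t := k) (by omega) (by rw [hD4]; exact hd)
  have fE := frame_run nextDigits τD
  refine ⟨hnext, _, hS.trans (subset_insert _ _), hacc.congr (fE.na 7 rfl) (fE.rv 3 rfl),
    fun f t ht hft => ?_⟩
  rcases Nat.lt_succ_iff_lt_or_eq.1 ht with h1 | rfl
  · exact mem_insert_of_mem (hcov f t h1 hft)
  · have := hft (τ.na 4) (τA.na 5) (τB.na 6) hd hchg hlab
    rw [hC6, show (fun v : Fin n => τB.na 6 v) = fun v : Fin n => f v from
      funext fun v => this v v.isLt]
    exact mem_insert_self _ _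

end RealRAM

/-! ### All labelings with few cut edges are found -/

theorem totalLength_congr {n : ℕ} {cap : ℕ → ℕ → ℕ} {Y Y' : ℕ → ℕ → ℝ}
    (h : ∀ u < n, ∀ v < n, Y u v = Y' u v) : totalLength n cap Y = totalLength n cap Y' := by
  refine sum_congr rfl fun x hx => ?_
  simp only [mem_product, mem_range] at hx
  rw [h _ hx.1 _ hx.2]

theorem cutPotential_congr {n : ℕ} {cap : ℕ → ℕ → ℕ} {f : ℕ → ℕ} {Y Y' : ℕ → ℕ → ℝ}
    (h : ∀ u < n, ∀ v < n, Y u v = Y' u v) : cutPotential n cap f Y = cutPotential n cap f Y' := by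
  refine sum_congr rfl fun x hx => ?_
  simp only [mem_product, mem_range] at hx
  rw [h _ hx.1 _ hx.2]

/-- The set {0} is a cut, so vertex 0 has an edge of positive multiplicity to another vertex. -/
theorem totalLength_pos {n c : ℕ} {cap : ℕ → ℕ → ℕ} {Y : ℕ → ℕ → ℝ} (hn : 2 ≤ n) (hc : 0 < c)
    (hcut : ∀ D ⊆ range n, D.Nonempty → D ≠ range n →
      c ≤ ∑ u ∈ D, ∑ v ∈ range n \ D, cap u v)
    (hY : ∀ u < n, ∀ v < n, 0 < Y u v) : 0 < totalLength n cap Y := by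
  have h1 := hcut {0} (by simp; omega) (singleton_nonempty 0) fun h => by
    have : #({0} : Finset ℕ) = n := by rw [h]; simp
    simp at this
    omega
  rw [sum_singleton] at h1
  obtain ⟨v, hv, h2⟩ : ∃ v ∈ range n \ {0}, cap 0 v ≠ 0 := by
    by_contra hne
    push Not at hne
    rw [sum_eq_zero hne] at h1
    omega
  have hvn : v < n := by simpa using (mem_sdiff.1 hv).1
  have hnn : ∀ x ∈ range n ×ˢ range n, 0 ≤ (cap x.1 x.2 : ℝ) * (Y x.1 x.2 / cap x.1 x.2) := by
    intro x hx
    simp only [mem_product, mem_range] at hx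
    have := hY _ hx.1 _ hx.2
    positivity
  refine lt_of_lt_of_le ?_ (single_le_sum hnn (a := (0, v)) (by simp; omega))
  have h3 : (0 : ℝ) < cap 0 v := by exact_mod_cast Nat.pos_of_ne_zero h2
  have h4 := hY 0 (by omega) v hvn
  positivity

namespace RealRAM

variable {n m r D : ℕ} {cap : ℕ → ℕ → ℕ} {p : ℝ}

/-- The invariant says that a labeling not yet seen was cut at least 4α times by every tree so far,
expressed as a lower bound for its potential. After more than 4cn rounds this excludes labelings
with at most αc cut edges. -/
theorem rounds_spec {G : Network n m} {σ : HState} {α : ℕ} (hE : Env n r (4 * α) G.multiplicity p σ)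
    (hn : 2 ≤ n) (hc : 0 < G.minCut) (hα : 0 < α) (hr : 0 < r)
    (hN : 4 * (G.minCut * n) < σ.nv 6) (hY : ∀ u < n, ∀ v < n, σ.ra 1 (u * n + v) = 1)
    (h : Seen G r p ∅ σ) :
    ∃ S, Seen G r p S (rounds.run σ) ∧
      ∀ f ∈ Network.labelings n r, #(G.cutEdges f) ≤ α * G.minCut → f ∈ S := by
  have hcap := G.multiplicity_comm
  have hcut := G.minCut_le_sum_multiplicity
  set c := G.minCut with hcdef
  set Y : HState → ℕ → ℕ → ℝ := fun τ u v => τ.ra 1 (u * n + v) with hYdef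
  have key := run_loop (x := 14) (y := 6) (σ := σ)
    (c := .seq growTree (.seq loadTree tryLabelings))
    (fun k τ => (∀ u < n, ∀ v < n, 0 < Y τ u v) ∧ (∀ u < n, ∀ v < n, Y τ u v = Y τ v u) ∧
      totalLength n G.multiplicity (Y τ) ≤ (n : ℝ) ^ 2 * (1 + 2 / (c : ℝ)) ^ k ∧
      ∃ S, Seen G r p S τ ∧ ∀ f : ℕ → ℕ, (∀ v < n, f v < r) → (fun v : Fin n => f v) ∈ S ∨
        2 * Real.log 2 * (4 * α) * k ≤ cutPotential n G.multiplicity f (Y τ))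
    ⟨?_, ?_, ?_, ∅, h, fun f _ => .inr ?_⟩ (fun k τ v h => ⟨h.1, h.2.1, h.2.2.1,
      h.2.2.2.imp fun S hS => ⟨hS.1.congr rfl rfl, hS.2⟩⟩) ?_
  · obtain ⟨h1, -, h3, S, hS, h4⟩ := key
    refine ⟨S, hS, fun f hf hfc => ?_⟩
    -- The packing speaks of labelings of all natural numbers; the values outside the vertices are
    -- immaterial.
    set F : ℕ → ℕ := fun v => if h : v < n then f ⟨v, h⟩ else 0 with hF
    have hFf : (fun v : Fin n => F v) = f := by
      funext v
      simp [hF]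
    rw [Network.mem_labelings] at hf
    rcases h4 F (fun v hv => by simpa [hF, hv] using hf ⟨v, hv⟩) with h5 | h5
    · rwa [hFf] at h5
    · have h6 := lt_sum_cap_of_potential (by omega) hc hα h1 F
        (totalLength_pos hn hc hcut h1) h3 h5 hN
      rw [G.sum_multiplicity_cut, hFf] at h6
      omega
  · intro u hu v hv
    simp only [hYdef, hY u hu v hv]
    norm_num
  · intro u hu v hv
    simp only [hYdef, hY u hu v hv, hY v hv u hu]
  · rw [totalLength_congr (Y' := fun _ _ => 1) fun u hu v hv => hY u hu v hv]
    -- Each summand is cap / cap, which is 1, or 0 where there is no edge.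
    calc totalLength n G.multiplicity (fun _ _ => 1)
        ≤ ∑ x ∈ range n ×ˢ range n, (1 : ℝ) := by
          refine sum_le_sum fun x _ => ?_
          rw [mul_one_div]
          exact div_self_le_one _
      _ = (n : ℝ) ^ 2 * (1 + 2 / (c : ℝ)) ^ 0 := by simp [sq]
  · rw [cutPotential_congr (Y' := fun _ _ => 1) fun u hu v hv => hY u hu v hv]
    simp [cutPotential]
  intro k hk τ hF hτ ⟨hpos, hsymm, hlen, S, hS, hcov⟩
  have hEτ := hE.frame (by decide) hF
  simp only [Cmd.run]
  have hT := isPrimTree_growTree hEτ (by omega) hc hcut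
  have fA := frame_run growTree τ
  have EA := hEτ.run (c := growTree) (by decide)
  set τA := growTree.run τ
  have hA1 : τA.ra 1 = τ.ra 1 := fA.ra 1 rfl
  have hYB := loadTree_eq EA hT (Y := Y τ) fun u _ v _ => by rw [hA1]
  have fB := frame_run loadTree τA
  have EB := EA.run (c := loadTree) (by decide)
  set τB := loadTree.run τA
  have b2 : τB.na 2 = τA.na 2 := fB.na 2 rfl
  have b3 : τB.na 3 = τA.na 3 := fB.na 3 rfl
  obtain ⟨S', h1, h2, h3⟩ := tryLabelings_spec EB (by omega) hr (by rw [b2, b3]; exact hT)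
    (hS.congr ((fB.na 7 rfl).trans (fA.na 7 rfl)) ((fB.rv 3 rfl).trans (fA.rv 3 rfl)))
  have fC := frame_run tryLabelings τB
  set τC := tryLabelings.run τB
  have hYC : ∀ u < n, ∀ v < n, Y τC u v =
      treeBump G.multiplicity (τA.na 2) (τA.na 3) (Y τ) (n - 1) u v := by
    intro u hu v hv
    rw [← hYB u hu v hv, hYdef]
    simp only [fC.ra 1 rfl]
  refine ⟨fun u hu v hv => ?_, fun u hu v hv => ?_, ?_, S', h2, fun f hf => ?_⟩
  · rw [hYC u hu v hv]
    exact treeBump_pos hpos _ u hu v hv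
  · rw [hYC u hu v hv, hYC v hv u hu]
    exact treeBump_symm hsymm _ u hu v hv
  · rw [totalLength_congr hYC, pow_succ (1 + 2 / (c : ℝ)) k, ← mul_assoc]
    refine (hT.totalLength_round hcap (by omega) hc hcut hpos hsymm).trans ?_
    gcongr
  · by_cases h4 : treeCrossings n (τA.na 2) (τA.na 3) f < 4 * α
    · left
      rw [b2, b3] at h3
      exact h3 f hf h4
    · rcases hcov f hf with h5 | h5
      · exact .inl (h1 h5)
      · right
        rw [cutPotential_congr hYC]
        refine le_trans ?_ (hT.cutPotential_treeBump hcap hpos f (k := n - 1) (by omega))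
        rw [Nat.sub_add_cancel (by omega : 1 ≤ n)]
        have h6 : (4 * α : ℝ) ≤ treeCrossings n (τA.na 2) (τA.na 3) f := by
          exact_mod_cast not_lt.1 h4
        have h7 := Real.log_pos (by norm_num : (1 : ℝ) < 2)
        push_cast
        have h8 : 2 * Real.log 2 * (4 * α) ≤
            2 * Real.log 2 * treeCrossings n (τA.na 2) (τA.na 3) f := by gcongr
        linarith

end RealRAM

/-! ### The tables computed in advance -/

namespace RealRAM

variable {n m r : ℕ} {p : ℝ}

theorem rowTable_spec {σ : HState} (hn : σ.nv 0 = n) :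
    ∀ u < n, (rowTable.run σ).na 0 u = u * n := by
  have key := run_loop (x := 11) (y := 0) (σ := σ.setN 13 0)
    (c := .seq (.setA 0 (.var 11) (.var 13)) (.setN 13 (.add (.var 13) (.var 0))))
    (fun k τ => (∀ u < k, τ.na 0 u = u * n) ∧ τ.nv 13 = k * n) (by simp)
    (fun k τ v h => by simpa using h) fun k hk τ hF hτ ⟨h1, h2⟩ => by
      have e0 : τ.nv 0 = n := by rw [hF.nv 0 rfl]; simpa using hn
      refine ⟨fun u hu => ?_, ?_⟩
      · simp only [Cmd.run, NExp.eval, HState.setN_na, HState.setA_na, hτ, true_and, h2]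
        split_ifs with h
        · rw [h]
        · exact h1 u (by omega)
      · simp [Cmd.run, NExp.eval, h2, e0, Nat.succ_mul]
  have e0 : (σ.setN 13 0).nv 0 = n := by simpa using hn
  rw [e0] at key
  exact key.1

theorem fillOnes_spec (σ : HState) :
    ∀ j < σ.nv 10, (fillOnes.run σ).ra 1 j = 1 ∧ (fillOnes.run σ).ra 2 j = 1 :=
  run_loop (x := 11) (y := 10) (σ := σ)
    (c := .seq (.setRA 1 (.var 11) (.cast (.lit 1))) (.setRA 2 (.var 11) (.cast (.lit 1))))
    (fun k τ => ∀ j < k, τ.ra 1 j = 1 ∧ τ.ra 2 j = 1) (by simp) (fun k τ v h => h)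
    fun k hk τ hF hτ h j hj => by
      simp only [Cmd.run, NExp.eval, RExp.eval, HState.setRA_ra, HState.setRA_nv, hτ, true_and,
        Nat.cast_one]
      by_cases h1 : j = k
      · simp [h1]
      · simpa [h1] using h j (by omega)

theorem coefficients_spec {σ : HState} (hr : σ.nv 3 = r) (h0 : σ.ra 3 0 = 0) :
    ∀ M ≤ r, (coefficients.run σ).ra 3 M = ∑ j ∈ Icc 1 M, extrapolationCoeff r j := by
  have key := run_loop (x := 11) (y := 3) (σ := (σ.setR 4 ((1 : ℕ) : ℝ)).setR 5 ((1 : ℕ) : ℝ))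
    (c := .seq (.setR 4 (.div (.mul (.var 4) (.cast (.sub (.var 3) (.var 11))))
      (.cast (.add (.var 11) (.lit 1))))) <|
    .seq (.setRA 3 (.add (.var 11) (.lit 1)) (.add (.get 3 (.var 11))
      (.div (.mul (.var 5) (.var 4)) (.cast (.add (.var 11) (.lit 1)))))) <|
    .setR 5 (.sub (.cast (.lit 0)) (.var 5)))
    (fun k τ => (∀ M ≤ k, τ.ra 3 M = ∑ j ∈ Icc 1 M, extrapolationCoeff r j) ∧
      τ.rv 4 = r.choose k ∧ τ.rv 5 = (-1) ^ k)
    ⟨fun M hM => by rw [Nat.le_zero.1 hM]; simpa using h0, by simp, by simp⟩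
    (fun k τ v h => h) fun k hk τ hF hτ ⟨h1, h2, h3⟩ => by
      have e3 : τ.nv 3 = r := (hF.nv 3 rfl).trans hr
      have hkr : k < r := by simpa [hr] using hk
      have hch : (r.choose k : ℝ) * ((r - k : ℕ) : ℝ) / ((k + 1 : ℕ) : ℝ) = r.choose (k + 1) := by
        rw [div_eq_iff (by positivity)]
        exact_mod_cast (Nat.choose_succ_right_eq r k).symm
      simp only [Cmd.run, NExp.eval, RExp.eval, HState.setR_nv, HState.setR_rv, HState.setR_ra,
        HState.setRA_ra, HState.setRA_rv, hτ, e3, h2, h3, true_and, hch, if_true,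
        (by norm_num : ¬ (5 : ℕ) = 4), (by norm_num : ¬ (4 : ℕ) = 5), if_false, h1 k le_rfl]
      refine ⟨fun M hM => ?_, by rw [pow_succ]; simp⟩
      split_ifs with h4
      · rw [h4, sum_Icc_succ_top (by omega)]
        simp [extrapolationCoeff]
      · exact h1 M (by omega)
  have e3 : ((σ.setR 4 ((1 : ℕ) : ℝ)).setR 5 ((1 : ℕ) : ℝ)).nv 3 = r := hr
  rw [e3] at key
  exact key.1

/-- The ends of the listed edges are to be found in the input. -/
def HasInput (G : Network n m) (σ : HState) : Prop :=
  ∀ e : Fin m, σ.inp (e + e) = (G.ends e).1 ∧ σ.inp (e + e + 1) = (G.ends e).2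

theorem multiplicity_eq_sum {G : Network n m} {σ : HState} (h : HasInput G σ) (u v : ℕ) :
    G.multiplicity u v = ∑ i ∈ range m,
      ((if u = σ.inp (i + i) ∧ v = σ.inp (i + i + 1) then 1 else 0) +
        if u = σ.inp (i + i + 1) ∧ v = σ.inp (i + i) then 1 else 0) := by
  rw [Network.multiplicity, card_filter, card_filter, ← sum_add_distrib, ← Fin.sum_univ_eq_sum_range
    fun i => ((if u = σ.inp (i + i) ∧ v = σ.inp (i + i + 1) then 1 else 0) +
        if u = σ.inp (i + i + 1) ∧ v = σ.inp (i + i) then 1 else 0)]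
  refine sum_congr rfl fun e _ => ?_
  simp only [(h e).1, (h e).2, Prod.mk.injEq, eq_comm]

/-- The multiplicity and the corresponding power of p are maintained together, whence a common count
M. A loop passes here twice with the same entry, in agreement with `multiplicity`. -/
theorem run_countEdge {σ : HState} {x y a b : ℕ} (hx : σ.nv x = a) (hy : σ.nv y = b)
    (ha : a < n) (hb : b < n) (hrow : ∀ u < n, σ.na 0 u = u * n) (hp : σ.rv 0 = p)
    {M : ℕ → ℕ → ℕ}
    (hM : ∀ u < n, ∀ v < n, σ.ra 0 (u * n + v) = M u v ∧ σ.ra 2 (u * n + v) = p ^ M u v) :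
    ∀ u < n, ∀ v < n,
      ((countEdge x y).run σ).ra 0 (u * n + v) =
        (M u v + if u = a ∧ v = b then 1 else 0 : ℕ) ∧
      ((countEdge x y).run σ).ra 2 (u * n + v) = p ^ (M u v + if u = a ∧ v = b then 1 else 0) := by
  intro u hu v hv
  simp only [countEdge, Cmd.run, NExp.eval, RExp.eval, eval_entry, HState.setRA_ra,
    HState.setRA_nv, HState.setRA_na, HState.setRA_rv, hx, hy, hrow a ha, hp,
    entry_eq_iff hb hv, true_and, Nat.cast_one]
  by_cases h : u = a ∧ v = b
  · obtain ⟨rfl, rfl⟩ := h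
    simp [hM u hu v hv, pow_succ]
  · simp [h, hM u hu v hv]

theorem readEdges_spec {G : Network n m} {σ : HState} (hm : σ.nv 1 = m) (hI : HasInput G σ)
    (hrow : ∀ u < n, σ.na 0 u = u * n) (hp : σ.rv 0 = p)
    (h0 : ∀ u < n, ∀ v < n, σ.ra 0 (u * n + v) = 0 ∧ σ.ra 2 (u * n + v) = 1) :
    ∀ u < n, ∀ v < n, (readEdges.run σ).ra 0 (u * n + v) = G.multiplicity u v ∧
      (readEdges.run σ).ra 2 (u * n + v) = p ^ G.multiplicity u v := by
  set M : ℕ → ℕ → ℕ → ℕ := fun k u v => ∑ i ∈ range k,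
      ((if u = σ.inp (i + i) ∧ v = σ.inp (i + i + 1) then 1 else 0) +
        if u = σ.inp (i + i + 1) ∧ v = σ.inp (i + i) then 1 else 0) with hM
  have key := run_loop (x := 11) (y := 1) (σ := σ)
    (c := .seq (.setN 13 (.inp (.add (.var 11) (.var 11)))) <|
    .seq (.setN 14 (.inp (.add (.add (.var 11) (.var 11)) (.lit 1)))) <|
    .seq (countEdge 13 14) (countEdge 14 13))
    (fun k τ => ∀ u < n, ∀ v < n, τ.ra 0 (u * n + v) = M k u v ∧
      τ.ra 2 (u * n + v) = p ^ M k u v)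
    (fun u hu v hv => by simpa [hM] using h0 u hu v hv) (fun k τ v h => h) ?_
  · intro u hu v hv
    rw [multiplicity_eq_sum hI]
    have := key u hu v hv
    rwa [hm] at this
  intro k hk τ hF hτ h u hu v hv
  rw [hm] at hk
  set a := σ.inp (k + k) with ha
  set b := σ.inp (k + k + 1) with hb
  have han : a < n := by rw [ha, (hI ⟨k, hk⟩).1]; exact Fin.is_lt _
  have hbn : b < n := by rw [hb, (hI ⟨k, hk⟩).2]; exact Fin.is_lt _
  have hrowτ : ∀ u < n, τ.na 0 u = u * n := by rw [hF.na 0 rfl]; exact hrow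
  have hpτ : τ.rv 0 = p := (hF.rv 0 rfl).trans hp
  set ρ := (τ.setN 13 a).setN 14 b with hρ
  have hrun : (Cmd.seq (.setN 13 (.inp (.add (.var 11) (.var 11)))) <|
    .seq (.setN 14 (.inp (.add (.add (.var 11) (.var 11)) (.lit 1)))) <|
    .seq (countEdge 13 14) (countEdge 14 13)).run τ =
      (countEdge 14 13).run ((countEdge 13 14).run ρ) := by
    simp [Cmd.run, NExp.eval, hτ, hF.inp, hρ, ha, hb]
  rw [hrun]
  have h1 := run_countEdge (σ := ρ) (x := 13) (y := 14) (by simp [hρ]) (by simp [hρ]) han hbn hrowτ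
    hpτ h
  have fA := frame_run (countEdge 13 14) ρ
  have h2 := run_countEdge (σ := (countEdge 13 14).run ρ) (x := 14) (y := 13)
    (by rw [fA.nv 14 rfl]; simp [hρ]) (by rw [fA.nv 13 rfl]; simp [hρ]) hbn han
    (by rw [fA.na 0 rfl]; exact hrowτ) ((fA.rv 0 rfl).trans hpτ) h1 u hu v hv
  have h3 : M (k + 1) u v = M k u v + (if u = a ∧ v = b then 1 else 0) +
      if u = b ∧ v = a then 1 else 0 := by
    simp only [hM, sum_range_succ, add_assoc, ha, hb]
  rw [h3]
  exact h2

end RealRAM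

/-! ### Correctness of the whole computation -/

namespace RealRAM

variable {n m r D : ℕ} {p : ℝ}

theorem countSequences_spec {σ : HState} {K B : ℕ} (h0 : σ.nv 0 = n) (h5 : σ.nv 5 = K)
    (h7 : σ.nv 7 = B) :
    (countSequences.run σ).nv 10 = n * n ∧ (countSequences.run σ).nv 8 = B ^ K := by
  have hm := run_mulCmd (z := 10) (x := 0) (c := 11) (y := 0) σ (by norm_num) (by norm_num)
    (by norm_num) (by norm_num)
  have fA := frame_run (mulCmd 10 0 11 0) σ
  rw [h0] at hm
  set σ₁ := (mulCmd 10 0 11 0).run σ with hσ₁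
  have key := run_loop (x := 11) (y := 5) (σ := σ₁.setN 8 1)
    (c := .seq (mulCmd 13 8 12 7) (.setN 8 (.var 13)))
    (fun k τ => τ.nv 8 = B ^ k) (by simp) (fun k τ v h => by simpa using h) fun k _ τ hF hτ h => by
      have h1 := run_mulCmd (z := 13) (x := 8) (c := 12) (y := 7) τ (by norm_num) (by norm_num)
        (by norm_num) (by norm_num)
      have e7 : τ.nv 7 = B := by
        rw [hF.nv 7 rfl]
        simpa [fA.nv 7 rfl] using h7
      simp [Cmd.run, NExp.eval, h1, h, e7, pow_succ]
  have e5 : (σ₁.setN 8 1).nv 5 = K := by simpa [fA.nv 5 rfl] using h5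
  rw [e5] at key
  refine ⟨?_, key⟩
  have fB := frame_run (.loop 11 5 (.seq (mulCmd 13 8 12 7) (.setN 8 (.var 13)))) (σ₁.setN 8 1)
  exact (fB.nv 10 rfl).trans (by simpa using hm)

/-- The state in which the estimation begins. -/
structure Ready (G : Network n m) (r α : ℕ) (p : ℝ) (σ : HState) : Prop where
  nv_n : σ.nv 0 = n
  nv_m : σ.nv 1 = m
  nv_r : σ.nv 3 = r
  nv_D : σ.nv 4 = 4 * α
  nv_digits : σ.nv 5 = 4 * α + 4 * α
  nv_rounds : σ.nv 6 = 8 * m + 1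
  nv_base : σ.nv 7 = n + r
  nv_count : σ.nv 8 = (n + r) ^ (4 * α + 4 * α)
  nv_pred : σ.nv 9 = n - 1
  nv_square : σ.nv 10 = n * n
  hasInput : HasInput G σ
  prob : σ.rv 0 = p
  acc : σ.rv 3 = 0
  mult : ∀ i, σ.ra 0 i = 0
  coeff : σ.ra 3 0 = 0
  mark : ∀ i, σ.na 7 i = 0

theorem preparation_spec {G : Network n m} {α : ℕ} {σ : HState} (h : Ready G r α p σ) :
    Env n r (4 * α) G.multiplicity p (preparation.run σ) ∧
      ∀ u < n, ∀ v < n, (preparation.run σ).ra 1 (u * n + v) = 1 := by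
  have hlt : ∀ u < n, ∀ v < n, u * n + v < n * n := fun u hu v hv => by
    calc u * n + v < u * n + n := by omega
      _ = (u + 1) * n := by ring
      _ ≤ n * n := Nat.mul_le_mul_right n hu
  have hA := rowTable_spec h.nv_n
  have fA := frame_run rowTable σ
  set σA := rowTable.run σ with hσA
  have hB := fillOnes_spec σA
  rw [fA.nv 10 rfl, h.nv_square] at hB
  have fB := frame_run fillOnes σA
  set σB := fillOnes.run σA with hσB
  have rowB : ∀ u < n, σB.na 0 u = u * n := by rw [fB.na 0 rfl]; exact hA
  have hC := readEdges_spec (G := G) (σ := σB) (p := p)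
    ((fB.nv 1 rfl).trans ((fA.nv 1 rfl).trans h.nv_m))
    (by unfold HasInput; rw [fB.inp, fA.inp]; exact h.hasInput) rowB
    ((fB.rv 0 rfl).trans ((fA.rv 0 rfl).trans h.prob)) fun u hu v hv =>
      ⟨by rw [fB.ra 0 rfl, fA.ra 0 rfl, h.mult], (hB _ (hlt u hu v hv)).2⟩
  have fC := frame_run readEdges σB
  set σC := readEdges.run σB with hσC
  have hD := coefficients_spec (r := r) (σ := σC)
    ((fC.nv 3 rfl).trans ((fB.nv 3 rfl).trans ((fA.nv 3 rfl).trans h.nv_r)))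
    (by rw [fC.ra 3 rfl, fB.ra 3 rfl, fA.ra 3 rfl, h.coeff])
  have fD := frame_run coefficients σC
  have hrun : preparation.run σ = coefficients.run σC := rfl
  have fP := frame_run preparation σ
  rw [hrun] at fP ⊢
  set σD := coefficients.run σC with hσD
  refine ⟨⟨(fP.nv 0 rfl).trans h.nv_n, (fP.nv 3 rfl).trans h.nv_r, (fP.nv 4 rfl).trans h.nv_D,
    (fP.nv 5 rfl).trans h.nv_digits, (fP.nv 7 rfl).trans h.nv_base,
    (fP.nv 8 rfl).trans h.nv_count, (fP.nv 9 rfl).trans h.nv_pred, ?_, ?_, ?_, hD⟩, ?_⟩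
  · rw [fD.na 0 rfl, fC.na 0 rfl]; exact rowB
  · rw [fD.ra 0 rfl]; exact fun u hu v hv => (hC u hu v hv).1
  · rw [fD.ra 2 rfl]; exact fun u hu v hv => (hC u hu v hv).2
  · rw [fD.ra 1 rfl, fC.ra 1 rfl]; exact fun u hu v hv => (hB _ (hlt u hu v hv)).1

theorem estimate_spec {G : Network n m} {α : ℕ} {σ : HState} (h : Ready G r α p σ) (hn : 2 ≤ n)
    (hc : 0 < G.minCut) (hα : 0 < α) (hr : 0 < r) :
    ∃ S ⊆ Network.labelings n r,
      (∀ f ∈ Network.labelings n r, #(G.cutEdges f) ≤ α * G.minCut → f ∈ S) ∧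
      (estimate.run σ).rv 0 =
        1 - ∑ f ∈ S, labelWeight r (univ.sup f) * p ^ #(G.cutEdges f) := by
  obtain ⟨hE, hY⟩ := preparation_spec h
  have fP := frame_run preparation σ
  obtain ⟨S, hS, hcov⟩ := rounds_spec hE hn hc hα hr
    -- From cn ≤ 2m follows 4cn ≤ 8m < 8m + 1.
    (by rw [fP.nv 6 rfl, h.nv_rounds]; have := G.minCut_mul_le hn; omega) hY
    ⟨empty_subset _, fun c => by simp [fP.na 7 rfl, h.mark c], by simp [fP.rv 3 rfl, h.acc]⟩
  refine ⟨S, hS.sub, hcov, ?_⟩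
  rw [← hS.acc]
  simp [estimate, Cmd.run, RExp.eval, NExp.eval]

/-- The state that represents the input. -/
noncomputable def inputState (G : Network n m) (p ε : ℝ) : HState where
  inp := (input G p ε).nmem
  nv i := if i = 0 then n else if i = 1 then m else 0
  na _ _ := 0
  rv i := if i = 0 then p else if i = 1 then ε else 0
  ra _ _ := 0

theorem hasInput_inputState (G : Network n m) (p ε : ℝ) : HasInput G (inputState G p ε) := by
  intro e
  have h1 : ((e : ℕ) + e) / 2 = e := by omega
  have h2 : ((e : ℕ) + e + 1) / 2 = e := by omega
  constructor
  · simp only [inputState, input, h1, e.isLt, dif_pos, show ((e : ℕ) + e) % 2 = 0 by omega, if_true]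
  · simp only [inputState, input, h2, e.isLt, dif_pos, show ((e : ℕ) + e + 1) % 2 = 1 by omega,
      one_ne_zero, if_false]

theorem ready_run (G : Network n m) (p ε : ℝ) (C d L : ℕ) (x : ℝ) :
    Ready G (C * (L + 1)) (1 + d * (4 * (C * (L + 1)) + 3)) p
      (countSequences.run ((parameters C d).run (((inputState G p ε).setN 2 L).setR 2 x))) := by
  set σ := ((inputState G p ε).setN 2 L).setR 2 x with hσ
  have f : Frame (parameters C d) σ ((parameters C d).run σ) := frame_run _ _
  set ρ := (parameters C d).run σ with hρ
  have v0 : ρ.nv 0 = n := (f.nv 0 rfl).trans (by simp [hσ, inputState])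
  have v1 : ρ.nv 1 = m := (f.nv 1 rfl).trans (by simp [hσ, inputState])
  have v3 : ρ.nv 3 = C * (L + 1) := by
    simp [hρ, parameters, Cmd.run, NExp.eval, hσ]
  have v4 : ρ.nv 4 = 4 * (1 + d * (4 * (C * (L + 1)) + 3)) := by
    simp [hρ, parameters, Cmd.run, NExp.eval, hσ]
  have v5 : ρ.nv 5 = 4 * (1 + d * (4 * (C * (L + 1)) + 3)) +
      4 * (1 + d * (4 * (C * (L + 1)) + 3)) := by
    simp [hρ, parameters, Cmd.run, NExp.eval, hσ]
  have v6 : ρ.nv 6 = 8 * m + 1 := by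
    simp [hρ, parameters, Cmd.run, NExp.eval, hσ, inputState]
  have v7 : ρ.nv 7 = n + C * (L + 1) := by
    simp [hρ, parameters, Cmd.run, NExp.eval, hσ, inputState]
  have v9 : ρ.nv 9 = n - 1 := by
    simp [hρ, parameters, Cmd.run, NExp.eval, hσ, inputState]
  obtain ⟨h10, h8⟩ := countSequences_spec v0 v5 v7
  have g := frame_run countSequences ρ
  refine ⟨(g.nv 0 rfl).trans v0, (g.nv 1 rfl).trans v1, (g.nv 3 rfl).trans v3,
    (g.nv 4 rfl).trans v4, (g.nv 5 rfl).trans v5, (g.nv 6 rfl).trans v6, (g.nv 7 rfl).trans v7, h8,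
    (g.nv 9 rfl).trans v9, h10, ?_, (g.rv 0 rfl).trans ((f.rv 0 rfl).trans ?_),
    (g.rv 3 rfl).trans ((f.rv 3 rfl).trans ?_), ?_, ?_, ?_⟩
  · unfold HasInput
    rw [g.inp, f.inp]
    exact hasInput_inputState G p ε
  · simp [hσ, inputState]
  · simp [hσ, inputState]
  · rw [g.ra 0 rfl, f.ra 0 rfl]; exact fun _ => rfl
  · rw [g.ra 3 rfl, f.ra 3 rfl]; rfl
  · rw [g.na 7 rfl, f.na 7 rfl]; exact fun _ => rfl

end RealRAM

/-! ### The number of steps -/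

namespace RealRAM

variable {n m : ℕ}

namespace Cmd

/-- The variables that bound loops. -/
def boundVars : Cmd → List ℕ
  | seq c d => c.boundVars ++ d.boundVars
  | ite _ c d => c.boundVars ++ d.boundVars
  | loop _ y c => y :: c.boundVars
  | _ => []

/-- How many loops with bounds of the class `k` are nested. -/
def degree (cls : ℕ → Fin 3) (k : Fin 3) : Cmd → ℕ
  | seq c d => max (c.degree cls k) (d.degree cls k)
  | ite _ c d => max (c.degree cls k) (d.degree cls k)
  | loop _ y c => (if cls y = k then 1 else 0) + c.degree cls k
  | _ => 0

/-- The number of steps when every loop is run once, roughly. -/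
def weight : Cmd → ℕ
  | seq c d => c.weight + d.weight
  | ite b c d => b.cost + (c.weight + d.weight)
  | loop _ _ c => c.weight + 5
  | c => c.bound fun _ => 0

/-- Nesting multiplies by the bound of the class of the loop. Consecutive commands and branches are
covered by the greater degree, as all bounds are at least 1. The 5 added for each loop absorbs its
overhead. -/
theorem bound_le {cls : ℕ → Fin 3} {b : Fin 3 → ℕ} (hb : ∀ k, 1 ≤ b k) {ν : ℕ → ℕ} {c : Cmd}
    (h : ∀ y ∈ c.boundVars, ν y ≤ b (cls y)) :
    c.bound ν ≤ c.weight * ∏ k, b k ^ c.degree cls k := by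
  have hpos : ∀ c : Cmd, 1 ≤ ∏ k, b k ^ c.degree cls k := fun c =>
    Finset.one_le_prod' fun k _ => Nat.one_le_pow _ _ (hb k)
  have hmax : ∀ {c c' : Cmd}, (∀ k, c.degree cls k ≤ c'.degree cls k) →
      ∏ k, b k ^ c.degree cls k ≤ ∏ k, b k ^ c'.degree cls k := fun h =>
    Finset.prod_le_prod' fun k _ => Nat.pow_le_pow_right (hb k) (h k)
  induction c with
  | skip | setN | setA | setR | setRA => simp [bound, weight, degree]
  | seq c d hc hd =>
    simp only [boundVars, List.mem_append] at h
    have h1 := hc fun y hy => h y (.inl hy)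
    have h2 := hd fun y hy => h y (.inr hy)
    have h3 := Nat.mul_le_mul_left c.weight (hmax (c := c) (c' := c.seq d) fun k => le_max_left _ _)
    have h4 := Nat.mul_le_mul_left d.weight (hmax (c := d) (c' := c.seq d) fun k =>
      le_max_right _ _)
    simp only [bound, weight, add_mul]
    omega
  | ite q c d hc hd =>
    simp only [boundVars, List.mem_append] at h
    have h1 := hc fun y hy => h y (.inl hy)
    have h2 := hd fun y hy => h y (.inr hy)
    have h3 := Nat.mul_le_mul_left c.weight (hmax (c := c) (c' := ite q c d) fun k =>
      le_max_left _ _)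
    have h4 := Nat.mul_le_mul_left d.weight (hmax (c := d) (c' := ite q c d) fun k =>
      le_max_right _ _)
    have h5 := Nat.mul_le_mul_left q.cost (hpos (ite q c d))
    simp only [bound, weight, add_mul]
    omega
  | loop x y c hc =>
    simp only [boundVars, List.mem_cons, forall_eq_or_imp] at h
    have h1 := hc h.2
    have h2 : ∏ k, b k ^ (loop x y c).degree cls k =
        b (cls y) * ∏ k, b k ^ c.degree cls k := by
      simp only [degree, pow_add, prod_mul_distrib]
      congr 1
      simp [pow_ite]
    rw [h2]
    have h3 := hpos c
    set X := ∏ k, b k ^ c.degree cls k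
    simp only [bound, weight]
    have h4 := hb (cls y)
    calc ν y * (c.bound ν + 3) + 2 ≤ b (cls y) * (c.weight * X + 3 * X) + 2 * (b (cls y) * X) := by
          have := Nat.mul_le_mul h4 h3
          gcongr
          · exact h.1
          · omega
          · omega
      _ = (c.weight + 5) * (b (cls y) * X) := by ring

end Cmd

/-- The classes of the loop bounds of the program: numbers of edges, of digit sequences, and small
numbers. -/
def boundClass (y : ℕ) : Fin 3 := if y = 1 ∨ y = 6 then 0 else if y = 8 then 1 else 2

/-- The first three operations move m and ε to the registers of variables and store the first
address 2m after the input in register 1; register 3 still holds 0. The search for L is a loop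
without a bound known in advance, so it is written for the machine itself. -/
def program (C d : ℕ) : Program :=
  .seq (.op (.add 2 1 3)) <| .seq (.op (.add 1 1 1)) <| .seq (.op (.radd 2 1 3)) <|
  .seq (Cmd.setR 2 (.cast (.lit 1))).compile <|
  .seq (.loop (.rlt 2 4) precisionStep.compile) <|
  .seq (parameters C d).compile <| .seq countSequences.compile estimate.compile

theorem rep_preamble (G : Network n m) (p ε : ℝ) :
    Rep (m + m) (inputState G p ε) ((Op.radd 2 1 3).apply ((Op.add 1 1 1).apply
      ((Op.add 2 1 3).apply (input G p ε)))) where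
  base := by simp [Op.apply, input]
  nv i := by
    simp only [Op.apply, input, inputState, Function.update_apply]
    rcases i with _ | _ | i
    · simp
    · simp
    · simp
  inp _ _ := rfl
  inp_zero a ha := by
    simp only [inputState, input]
    rw [dif_neg (by omega)]
  na a i := by
    simp only [inputState, input, Op.apply]
    rw [dif_neg (by omega)]
  rv i := by
    simp only [Op.apply, input, inputState, Function.update_apply]
    rcases i with _ | _ | i
    · simp
    · simp
    · simp
  ra _ _ := rfl

theorem Cmd.runs_self {b : ℕ} (c : Cmd) (hwf : c.wf c.modN = true) {σ : HState} {s : State}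
    (hs : Rep b σ s) : Runs c.compile s (c.bound σ.nv) (Rep b (c.run σ)) :=
  c.runs (W := c.modN) (fun _ h => h) hwf hs

/-- The number of steps of the program, apart from a constant, in terms of the number `r` of labels
and the number `D` of label changes. -/
def stepBound (n m r D : ℕ) : ℕ := m * (n + r) ^ (D + D) * (n * n + n + r + D + D) ^ 4

theorem pow_le_stepBound {n m r α : ℕ} (hn : 2 ≤ n) (hm : 1 ≤ m) {i : ℕ} (hi : i ≤ 4) :
    (n * n + n + r + 4 * α + 4 * α) ^ i ≤ stepBound n m r (4 * α) :=
  (Nat.pow_le_pow_right (by omega) hi).trans <| Nat.le_mul_of_pos_left _ <|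
    Nat.mul_pos hm <| Nat.one_le_pow _ _ (by omega)

theorem bound_countSequences_le {n m r α : ℕ} {ν : ℕ → ℕ} (hn : 2 ≤ n) (h0 : ν 0 = n)
    (h5 : ν 5 = 4 * α + 4 * α) (h7 : ν 7 = n + r) (hm : 1 ≤ m) :
    countSequences.bound ν ≤ countSequences.weight * stepBound n m r (4 * α) := by
  set V := n * n + n + r + 4 * α + 4 * α with hV
  refine (Cmd.bound_le (cls := boundClass) (b := fun k => if k = 2 then V else 1)
    (fun k => by split_ifs <;> omega) fun y hy => ?_).trans ?_
  · have hy' : y ∈ [0, 5, 7] := (by decide : countSequences.boundVars ⊆ [0, 5, 7]) hy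
    simp only [List.mem_cons, List.not_mem_nil, or_false] at hy'
    rcases hy' with rfl | rfl | rfl <;> simp [boundClass] <;> omega
  · refine Nat.mul_le_mul_left _ ?_
    rw [Fin.prod_univ_three]
    simpa using pow_le_stepBound (r := r) (α := α) hn hm
      (by decide : countSequences.degree boundClass 2 ≤ 4)

theorem bound_estimate_le {n m r α : ℕ} {G : Network n m} {p : ℝ} {σ : HState}
    (h : Ready G r α p σ) (hn : 2 ≤ n) (hm : 1 ≤ m) :
    estimate.bound σ.nv ≤ 9 * estimate.weight * stepBound n m r (4 * α) := by
  set V := n * n + n + r + 4 * α + 4 * α with hV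
  set Q := (n + r) ^ (4 * α + 4 * α) with hQ
  have hQ1 : 1 ≤ Q := Nat.one_le_pow _ _ (by omega)
  have hV1 : 1 ≤ V := by omega
  -- The number of rounds 8m + 1 is at most 9m because m ≥ 1. One loop over rounds, one over digit
  -- sequences and at most four short loops are nested.
  refine (Cmd.bound_le (cls := boundClass) (b := ![9 * m, Q, V]) (fun k => ?_) fun y hy => ?_).trans
    ?_
  · fin_cases k
    · simp; omega
    · exact hQ1
    · exact hV1
  · have hy' : y ∈ [0, 1, 3, 4, 5, 6, 8, 9, 10] :=
      (by decide : estimate.boundVars ⊆ [0, 1, 3, 4, 5, 6, 8, 9, 10]) hy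
    simp only [List.mem_cons, List.not_mem_nil, or_false] at hy'
    rcases hy' with rfl | rfl | rfl | rfl | rfl | rfl | rfl | rfl | rfl
    · rw [h.nv_n]; simp [boundClass]; omega
    · rw [h.nv_m]; simp [boundClass]; omega
    · rw [h.nv_r]; simp [boundClass]; omega
    · rw [h.nv_D]; simp [boundClass]; omega
    · rw [h.nv_digits]; simp [boundClass]; omega
    · rw [h.nv_rounds]; simp [boundClass]; omega
    · rw [h.nv_count]; simp [boundClass, hQ]
    · rw [h.nv_pred]; simp [boundClass]; omega
    · rw [h.nv_square]; simp [boundClass]; omega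
  · rw [Fin.prod_univ_three, show estimate.degree boundClass 0 = 1 by decide,
      show estimate.degree boundClass 1 = 1 by decide]
    generalize estimate.weight = w
    calc w * ((9 * m) ^ 1 * Q ^ 1 * V ^ estimate.degree boundClass 2)
        ≤ w * ((9 * m) ^ 1 * Q ^ 1 * V ^ 4) := by
          gcongr
          decide
      _ = 9 * w * stepBound n m r (4 * α) := by
          rw [stepBound]; ring

/-- By minimality n^(-(L-1)) > ε, that is L - 1 < -log_n ε. Here L ≠ 0 because ε < 1. -/
theorem exists_least_precision {n : ℕ} {ε : ℝ} (hn : 2 ≤ n) (hε : 0 < ε) (hε1 : ε < 1) :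
    ∃ L : ℕ, (∀ k < L, ε < (1 / (n : ℝ)) ^ k) ∧ (1 / (n : ℝ)) ^ L ≤ ε ∧
      (L : ℝ) ≤ 1 - Real.logb n ε := by
  have hn1 : (1 : ℝ) < n := by exact_mod_cast (by omega : 1 < n)
  have hex : ∃ k : ℕ, (1 / (n : ℝ)) ^ k ≤ ε := by
    obtain ⟨k, hk⟩ := exists_pow_lt_of_lt_one hε
      (show 1 / (n : ℝ) < 1 by rw [div_lt_one (by linarith)]; exact hn1)
    exact ⟨k, hk.le⟩
  classical
  refine ⟨Nat.find hex, fun k hk => not_le.1 (Nat.find_min hex hk), Nat.find_spec hex, ?_⟩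
  have h0 : Nat.find hex ≠ 0 := by
    intro h
    have := Nat.find_spec hex
    rw [h, pow_zero] at this
    linarith
  have h1 := not_le.1 (Nat.find_min hex (show Nat.find hex - 1 < Nat.find hex by omega))
  have h2 := Real.logb_lt_logb hn1 hε h1
  generalize Nat.find hex = L at h0 h2
  rw [one_div, inv_pow, Real.logb_inv, Real.logb_pow, Real.logb_self_eq_one hn1, mul_one,
    Nat.cast_sub (by omega)] at h2
  push_cast at h2
  linarith

/-- K collects the weights of the pieces of the program and so depends on C and d only. The search
for L takes O(L + 1) steps, which the remaining bound covers since L + 1 ≤ r. -/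
theorem exists_runs_program (C d : ℕ) (hC : 0 < C) : ∃ K : ℕ, ∀ (n m : ℕ) (G : Network n m)
    (p ε : ℝ) (L : ℕ), 2 ≤ n → 0 < G.minCut → (∀ k < L, ε < (1 / (n : ℝ)) ^ k) →
    (1 / (n : ℝ)) ^ L ≤ ε →
    Runs (program C d) (input G p ε)
      (K * stepBound n m (C * (L + 1)) (4 * (1 + d * (4 * (C * (L + 1)) + 3))))
      fun s => ∃ S ⊆ Network.labelings n (C * (L + 1)),
        (∀ f ∈ Network.labelings n (C * (L + 1)),
          #(G.cutEdges f) ≤ (1 + d * (4 * (C * (L + 1)) + 3)) * G.minCut → f ∈ S) ∧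
        s.output = 1 - ∑ f ∈ S, labelWeight (C * (L + 1)) (univ.sup f) * p ^ #(G.cutEdges f) := by
  obtain ⟨w₁, hw₁⟩ : ∃ w, w = (Cmd.setR 2 (.cast (.lit 1))).weight := ⟨_, rfl⟩
  obtain ⟨w₂, hw₂⟩ : ∃ w, w = precisionStep.weight := ⟨_, rfl⟩
  obtain ⟨w₃, hw₃⟩ : ∃ w, w = (parameters C d).weight := ⟨_, rfl⟩
  obtain ⟨w₄, hw₄⟩ : ∃ w, w = countSequences.weight := ⟨_, rfl⟩
  obtain ⟨w₅, hw₅⟩ : ∃ w, w = estimate.weight := ⟨_, rfl⟩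
  refine ⟨3 + w₁ + (w₂ + 2) + w₃ + w₄ + 9 * w₅, fun n m G p ε L hn hc hlt hle => ?_⟩
  set r := C * (L + 1) with hr
  set α := 1 + d * (4 * r + 3) with hα
  have hm : 1 ≤ m := by
    have := G.minCut_mul_le hn
    have := Nat.mul_pos hc (by omega : 0 < n)
    omega
  have hr0 : 0 < r := Nat.mul_pos hC (by omega)
  have hLr : L + 1 ≤ r := Nat.le_mul_of_pos_left _ hC
  obtain ⟨T, hT⟩ : ∃ T, T = stepBound n m r (4 * α) := ⟨_, rfl⟩
  rw [← hT]
  have hT1 : 1 ≤ T := by simpa [hT] using pow_le_stepBound (r := r) (α := α) hn hm (i := 0)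
  have hLT : L + 1 ≤ T := by
    have := pow_le_stepBound (r := r) (α := α) hn hm (i := 1) (by norm_num)
    rw [← hT, pow_one] at this
    omega
  set σ₀ := inputState G p ε
  refine Runs.mono (Runs.seq (T := 1) (Q := fun s => s = _) (.op rfl) fun s hs => Runs.seq (T := 1)
    (Q := fun s => s = _) (.op rfl) fun s' hs' => Runs.seq (T := 1)
    (Q := Rep (m + m) σ₀) (.op ?_) fun s₁ hs₁ => (Cmd.runs_self _ rfl hs₁).seq fun s₂ hs₂ =>
    Runs.seq (Runs.loop (T := w₂) (fun k s => Rep (m + m)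
      ((σ₀.setN 2 k).setR 2 ((1 / (n : ℝ)) ^ k)) s) L ?_ ?_ ?_ ?_) fun s₃ hs₃ =>
    (Cmd.runs_self (parameters C d) rfl hs₃).seq fun s₄ hs₄ =>
    (Cmd.runs_self countSequences (by decide) hs₄).seq fun s₅ hs₅ =>
    Cmd.runs_self estimate (by decide) hs₅) ?_ fun s hs => ?_
  · rw [hs', hs]
    exact rep_preamble G p ε
  · intro k hk s hs
    have h1 := hs.rv 1
    have h2 := hs.rv 2
    simp only [Test.Holds]
    rw [show (2 : ℕ) = 2 * 1 from rfl, h1, show 4 = 2 * 2 from rfl, h2]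
    simpa [σ₀, inputState] using hlt k hk
  · intro s hs
    have h1 := hs.rv 1
    have h2 := hs.rv 2
    simp only [Test.Holds]
    rw [show (2 : ℕ) = 2 * 1 from rfl, h1, show 4 = 2 * 2 from rfl, h2]
    simpa [σ₀, inputState] using hle
  · intro k hk s hs
    refine Runs.mono (Cmd.runs_self precisionStep rfl hs) hw₂.ge fun s hs => ?_
    convert hs using 1
    simp only [precisionStep, Cmd.run, RExp.eval, NExp.eval, HState.setR_rv, HState.setR_nv,
      HState.setN_nv, if_true, (by norm_num : ¬ (0 : ℕ) = 2), if_false]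
    have : ((σ₀.nv 0 : ℕ) : ℝ) = n := by simp [σ₀, inputState]
    rw [this, pow_succ, mul_one_div]
    simp [HState.setR, HState.setN]
  · convert hs₂ using 1
    simp only [Cmd.run, RExp.eval, NExp.eval, pow_zero, Nat.cast_one]
    rw [setN_eq_self]
    simp [σ₀, inputState]
  · have hR : Ready G r α p _ := ready_run G p ε C d L ((1 / (n : ℝ)) ^ L)
    set σ₁ := (σ₀.setN 2 L).setR 2 ((1 / (n : ℝ)) ^ L)
    set σ₂ := (parameters C d).run σ₁
    set σ₃ := countSequences.run σ₂
    have g := frame_run countSequences σ₂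
    have b1 : (Cmd.setR 2 (.cast (.lit 1))).bound σ₀.nv = w₁ := hw₁.symm
    have b2 : (parameters C d).bound σ₁.nv = w₃ := hw₃.symm
    have b3 := bound_countSequences_le hn (g.nv 0 rfl ▸ hR.nv_n) (g.nv 5 rfl ▸ hR.nv_digits)
      (g.nv 7 rfl ▸ hR.nv_base) hm
    have b4 := bound_estimate_le hR hn hm
    rw [← hw₄, ← hT] at b3
    rw [← hw₅, ← hT] at b4
    have b5 : L * (w₂ + 1) + 1 ≤ (w₂ + 2) * T := by
      calc L * (w₂ + 1) + 1 ≤ (w₂ + 1) * T + 1 * T := by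
            rw [mul_comm]
            gcongr
            · omega
            · omega
        _ = _ := by ring
    have b6 : ∀ w, w ≤ w * T := fun w => Nat.le_mul_of_pos_right w hT1
    have e : (3 + w₁ + (w₂ + 2) + w₃ + w₄ + 9 * w₅) * T = 1 * T + (1 * T + (1 * T + (w₁ * T +
        ((w₂ + 2) * T + (w₃ * T +
        (w₄ * T + 9 * w₅ * T)))))) := by
      ring
    rw [b1, b2, e]
    exact Nat.add_le_add (b6 1) <| Nat.add_le_add (b6 1) <| Nat.add_le_add (b6 1) <|
      Nat.add_le_add (b6 _) <| Nat.add_le_add b5 <| Nat.add_le_add (b6 _) <| Nat.add_le_add b3 b4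
  · have hR : Ready G r α p _ := ready_run G p ε C d L ((1 / (n : ℝ)) ^ L)
    obtain ⟨S, h1, h2, h3⟩ := estimate_spec hR hn hc (by omega) hr0
    exact ⟨S, h1, h2, by rw [← h3]; exact hs.rv 0⟩

end RealRAM

/-! ### The exponent and the final estimate -/

namespace RealRAM

theorem stepBound_le {n : ℕ} (hn : 2 ≤ n) (m r D : ℕ) :
    stepBound n m r D ≤ m * n ^ ((1 + r) * (D + D) + (4 + r + D + D) * 4) := by
  have h2 : ∀ k, 2 ^ k ≤ n ^ k := fun k => Nat.pow_le_pow_left hn k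
  have h1 : n + r ≤ n ^ (1 + r) := by
    calc n + r ≤ n * (1 + r) := by nlinarith
      _ ≤ n * n ^ r := Nat.mul_le_mul_left _ (by
        have := h2 r
        have := Nat.lt_two_pow_self (n := r)
        omega)
      _ = n ^ (1 + r) := by ring
  have h3 : n * n + n + r + D + D ≤ n ^ (4 + r + D + D) := by
    calc n * n + n + r + D + D ≤ n ^ 2 * (2 + r + D + D) := by
          have : r + D + D ≤ n ^ 2 * (r + D + D) := Nat.le_mul_of_pos_left _ (by positivity)
          nlinarith
      _ ≤ n ^ 2 * n ^ (2 + r + D + D) := Nat.mul_le_mul_left _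
        ((Nat.lt_two_pow_self (n := 2 + r + D + D)).le.trans (h2 _))
      _ = n ^ (4 + r + D + D) := by ring
  calc stepBound n m r D ≤ m * (n ^ (1 + r)) ^ (D + D) * (n ^ (4 + r + D + D)) ^ 4 := by
        unfold stepBound
        gcongr
    _ = m * n ^ ((1 + r) * (D + D) + (4 + r + D + D) * 4) := by
        rw [← pow_mul, ← pow_mul, pow_add n ((1 + r) * (D + D)), mul_assoc]

/-- The numbers r and D are at most linear in L + 1, so the exponent of n in the step bound is at
most quadratic; the factor K is absorbed by K ≤ n^K. -/
theorem exists_exponent (C d K : ℕ) : ∃ H : ℕ, ∀ n m L : ℕ, 2 ≤ n →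
    K * stepBound n m (C * (L + 1)) (4 * (1 + d * (4 * (C * (L + 1)) + 3))) ≤
      m * n ^ (H * (L + 1) ^ 2) := by
  set E := 4 * (1 + d * (4 * C + 3)) with hE
  refine ⟨K + (1 + C) * (E + E) + (4 + C + E + E) * 4, fun n m L hn => ?_⟩
  set y := L + 1 with hy
  have hy1 : 1 ≤ y := by omega
  have hD : 4 * (1 + d * (4 * (C * y) + 3)) ≤ E * y := by
    have : E * y = 4 * (y + d * (4 * (C * y) + 3 * y)) := by rw [hE]; ring
    rw [this]
    gcongr
    omega
  have hyy : y ≤ y ^ 2 := by nlinarith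
  set D := 4 * (1 + d * (4 * (C * y) + 3))
  have hexp : K + ((1 + C * y) * (D + D) + (4 + C * y + D + D) * 4) ≤
      (K + (1 + C) * (E + E) + (4 + C + E + E) * 4) * y ^ 2 := by
    calc K + ((1 + C * y) * (D + D) + (4 + C * y + D + D) * 4)
        ≤ K * y ^ 2 + ((y + C * y) * (E * y + E * y) +
          (4 * y ^ 2 + C * y ^ 2 + E * y ^ 2 + E * y ^ 2) * 4) := by
          have h1 : K ≤ K * y ^ 2 := Nat.le_mul_of_pos_right _ (by positivity)
          have h2 : D ≤ E * y ^ 2 := hD.trans (Nat.mul_le_mul_left _ hyy)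
          have h3 : (4 : ℕ) ≤ 4 * y ^ 2 := Nat.le_mul_of_pos_right _ (by positivity)
          gcongr
      _ = _ := by ring
  calc K * stepBound n m (C * y) D ≤
        n ^ K * (m * n ^ ((1 + C * y) * (D + D) + (4 + C * y + D + D) * 4)) := by
        gcongr
        · exact (Nat.lt_two_pow_self (n := K)).le.trans (Nat.pow_le_pow_left hn K)
        · exact stepBound_le hn m _ _
    _ = m * n ^ (K + ((1 + C * y) * (D + D) + (4 + C * y + D + D) * 4)) := by
        rw [pow_add n K]; ring
    _ ≤ m * n ^ ((K + (1 + C) * (E + E) + (4 + C + E + E) * 4) * y ^ 2) :=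
        Nat.mul_le_mul_left _ (Nat.pow_le_pow_right (by omega) hexp)

/-- With x = 1 - log_n ε ≥ 1 one has L + 1 ≤ 2x, so that the exponent is at most 4Hx · x · x ≤
exp((4H + 2)x), by z ≤ exp z for each factor. -/
theorem pow_le_rpow_exp {n L H : ℕ} {ε : ℝ} (hn : 2 ≤ n) (hε : 0 < ε) (hε1 : ε < 1)
    (hL : (L : ℝ) ≤ 1 - Real.logb n ε) :
    (n : ℝ) ^ (H * (L + 1) ^ 2) ≤
      ((n : ℝ) / ε) ^ Real.exp ((4 * H + 2) * (1 - Real.logb n ε)) := by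
  have hn1 : (1 : ℝ) < n := by exact_mod_cast (by omega : 1 < n)
  set x := 1 - Real.logb n ε with hx
  have hx1 : 1 ≤ x := by
    have := Real.logb_neg hn1 hε hε1
    linarith
  have hbase : (n : ℝ) ≤ n / ε := by
    rw [le_div_iff₀ hε]
    nlinarith
  have h1 : ((H * (L + 1) ^ 2 : ℕ) : ℝ) ≤ Real.exp ((4 * H + 2) * x) := by
    push_cast
    have h2 : (H : ℝ) * (L + 1) ^ 2 ≤ (4 * H * x) * (x * x) := by
      have h3 : (L + 1 : ℝ) ^ 2 ≤ (2 * x) ^ 2 := by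
        gcongr
        linarith
      have hH : (0 : ℝ) ≤ H := by positivity
      calc (H : ℝ) * (L + 1) ^ 2 ≤ H * (2 * x) ^ 2 := by gcongr
        _ = (4 * H * 1) * (x * x) := by ring
        _ ≤ (4 * H * x) * (x * x) := by gcongr
    have h4 : ∀ z : ℝ, z ≤ Real.exp z := fun z => by linarith [Real.add_one_le_exp z]
    calc (H : ℝ) * (L + 1) ^ 2 ≤ (4 * H * x) * (x * x) := h2
      _ ≤ Real.exp (4 * H * x) * (Real.exp x * Real.exp x) := by
          gcongr <;> exact h4 _
      _ = Real.exp ((4 * H + 2) * x) := by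
          rw [← Real.exp_add, ← Real.exp_add]
          congr 1
          ring
  calc (n : ℝ) ^ (H * (L + 1) ^ 2) = (n : ℝ) ^ ((H * (L + 1) ^ 2 : ℕ) : ℝ) :=
        (Real.rpow_natCast _ _).symm
    _ ≤ (n : ℝ) ^ Real.exp ((4 * H + 2) * x) := Real.rpow_le_rpow_of_exponent_le hn1.le h1
    _ ≤ ((n : ℝ) / ε) ^ Real.exp ((4 * H + 2) * x) :=
        Real.rpow_le_rpow (by positivity) hbase (Real.exp_pos _).le

end RealRAM

/-- n² p^c < n^(-δ), and the d-th power of n^(-δ) is at most n^(-2). This is the only way in which δ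
enters the error estimates. -/
theorem sq_mul_pow_le_one {n c d : ℕ} {p δ : ℝ} (hn : 2 ≤ n) (hp : 0 ≤ p)
    (h : p ^ c < (n : ℝ) ^ (-(2 + δ))) (hd : 2 ≤ δ * d) :
    ((n : ℝ) ^ 2 * p ^ c) ^ d * (n : ℝ) ^ 2 ≤ 1 := by
  have hn0 : (0 : ℝ) < n := by exact_mod_cast (by omega : 0 < n)
  have hn1 : (1 : ℝ) ≤ n := by exact_mod_cast (by omega : 1 ≤ n)
  calc ((n : ℝ) ^ 2 * p ^ c) ^ d * (n : ℝ) ^ 2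
      ≤ ((n : ℝ) ^ (2 : ℝ) * (n : ℝ) ^ (-(2 + δ))) ^ (d : ℝ) * (n : ℝ) ^ (2 : ℝ) := by
        rw [Real.rpow_natCast, Real.rpow_two]
        gcongr
    _ = (n : ℝ) ^ ((2 + -(2 + δ)) * d + 2) := by
        rw [← Real.rpow_add hn0, ← Real.rpow_mul hn0.le, ← Real.rpow_add hn0]
    _ ≤ 1 := Real.rpow_le_one_of_one_le_of_nonpos hn1 (by linarith)

theorem mainTheorem6 (δ : ℝ) (hδ : 0 < δ) :
    ∃ (P : RealRAM.Program) (A : ℝ),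
      ∀ (n m : ℕ) (G : Network n m) (p ε : ℝ),
        2 ≤ n → 0 ≤ p → p ≤ 1 → 0 < ε → ε < 1 →
        (p ^ G.minCut < (n : ℝ) ^ (-(2 + δ)) ∨ G.fail p < (n : ℝ) ^ (-(2 + δ))) →
        ∃ (t : ℕ) (s : RealRAM.State),
          RealRAM.Exec P (RealRAM.input G p ε) t s ∧
          |s.output - G.fail p| ≤ ε * G.fail p ∧
          (t : ℝ) ≤ (m : ℝ) * ((n : ℝ) / ε) ^ Real.exp (A * (1 - Real.logb n ε)) := by
  obtain ⟨d, hd2, hd⟩ : ∃ d : ℕ, 2 ≤ d ∧ 2 ≤ δ * d := by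
    obtain ⟨k, hk⟩ := exists_nat_ge (2 / δ)
    refine ⟨k + 2, by omega, ?_⟩
    rw [div_le_iff₀ hδ] at hk
    push_cast
    nlinarith
  -- The two lower bounds for r = C(L + 1) in the truncation estimate: 6^(2d), and 1 + 2d(4 + L) ≤
  -- (8d + 1)(L + 1).
  obtain ⟨C, hC1, hC2⟩ : ∃ C, 6 ^ (2 * d) ≤ C ∧ 8 * d + 1 ≤ C :=
    ⟨_, le_max_left _ _, le_max_right _ _⟩
  obtain ⟨K, hK⟩ := RealRAM.exists_runs_program C d (by omega)
  obtain ⟨H, hH⟩ := RealRAM.exists_exponent C d K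
  refine ⟨RealRAM.program C d, 4 * H + 2, fun n m G p ε hn hp0 hp1 hε0 hε1 h => ?_⟩
  have hn0 : (0 : ℝ) < n := by exact_mod_cast (by omega : 0 < n)
  have hpc : p ^ G.minCut < (n : ℝ) ^ (-(2 + δ)) :=
    h.elim id fun h => (G.pow_minCut_le_fail hn hp0 hp1).trans_lt h
  -- If c were 0, then p^c = 1 would not be below n^(-(2+δ)); so the hypothesis excludes
  -- disconnected networks.
  have hc : 0 < G.minCut := by
    by_contra hc
    rw [show G.minCut = 0 by omega, pow_zero] at hpc
    have := Real.rpow_le_one_of_one_le_of_nonpos (x := (n : ℝ)) (z := -(2 + δ))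
      (by exact_mod_cast (by omega : 1 ≤ n)) (by linarith)
    linarith
  obtain ⟨L, hL1, hL2, hL3⟩ := RealRAM.exists_least_precision hn hε0 hε1
  obtain ⟨t, s, hrun, ht, S, hS, hcov, hout⟩ := hK n m G p ε L hn hc hL1 hL2
  refine ⟨t, s, hrun, ?_, ?_⟩
  · rw [hout]
    refine G.abs_estimate_sub_fail_le hn hc hp0 hp1 hd2 (sq_mul_pow_le_one hn hp0 hpc hd)
      (L := L) ?_ ?_ ?_ le_rfl S hS hcov
    · rw [one_div, inv_pow, inv_le_iff_one_le_mul₀ (by positivity)] at hL2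
      exact hL2
    · exact hC1.trans (Nat.le_mul_of_pos_right _ (by omega))
    · calc 1 + 2 * d * (4 + L) ≤ (8 * d + 1) * (L + 1) := by nlinarith
        _ ≤ C * (L + 1) := by gcongr
  · calc (t : ℝ) ≤ ((m * n ^ (H * (L + 1) ^ 2) : ℕ) : ℝ) := by
          exact_mod_cast ht.trans (hH n m L hn)
      _ = m * (n : ℝ) ^ (H * (L + 1) ^ 2) := by push_cast; ring
      _ ≤ _ := by
          gcongr
          exact RealRAM.pow_le_rpow_exp hn hε0 hε1 hL3
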